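/- **Setting.** Let $q,N\in\mathbb N$ and let $A:\mathbb R^3\to\mathbb R^3$ be linear. For $n\in\mathbb N$ let $\mathcal H_n=\wedge^nL^2(\mathbb R^3\times\{1,\dots,q\})$ with the usual norm, let $D_{A,x}=-i\nabla_x+A(x)$, and let $\mathcal Q_{n,A}=\{\Psi\in\mathcal H_n: D_{A,x_j}\Psi\in L^2 \text{ for } j=1,\dots,n\}$ with form norm $\|\Psi\|_{\mathcal Q_{n,A}}^2=\|\Psi\|^2+\sum_j\|D_{A,x_j}\Psi\|^2$. Write $\underline x_j=(x_j,\sigma_j)\in\mathbb R^3\times\{1,\dots,q\}$ and $\int d\underline x_j=\sum_{\sigma_j}\int dx_j$. For $\Psi\in\mathcal Q_{n,A}$ let $$\rho_\Psi(x)=\sum_{j=1}^n\sum_{\sigma_j}\int|\Psi(\underline x_1,\dots,(x,\sigma_j),\dots,\underline x_n)|^2\,d\underline x_1\cdots\widehat{d\underline x_j}\cdots d\underline x_n$$ be its density. Put $V_\sigma=\sigma*|\cdot|^{-1}$ and $D(\sigma)=\frac12\iint\frac{\sigma(x)\sigma(y)}{|x-y|}\,dx\,dy$, $$\mathcal E^n(\Psi)=\Big\langle\Psi,\Big(\sum_{j=1}^nD_{A,x_j}^2+\sum_{i<j}\frac1{|x_i-x_j|}\Big)\Psi\Big\rangle-D(\rho_\Psi),\qquad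 E^n=\inf\{\mathcal E^n(\Psi):\Psi\in\mathcal Q_{n,A},\ \|\Psi\|=1\},$$ $$H_\sigma^N=\sum_{j=1}^N\big(D_{A,x_j}^2-V_\sigma(x_j)\big)+\sum_{i<j}\frac1{|x_i-x_j|}+D(\sigma)\quad\text{in }\mathcal H_N .$$ **Proposition 3.2 (IMS).** Assume the binding inequality $E^N<E^k+E^{N-k}$ for all $k=1,\dots,N-1$. Let $(\Psi_k)$ be a minimizing sequence of $\mathcal E^N$ (that is, $\Psi_k\in\mathcal Q_{N,A}$, $\|\Psi_k\|=1$, $\mathcal E^N(\Psi_k)\to E^N$) whose densities $\rho_k=\rho_{\Psi_k}$ are in the case "dichotomy or compactness" of the concentration compactness principle: there are $\lambda\in(0,N]$ and, for every $\varepsilon>0$, a radius $R_\varepsilon>0$ and sequences $y_k=y_k(\varepsilon)\in\mathbb R^3$ and $P_k=P_k(\varepsilon)\in\mathbb R$ with $P_k\to\infty$ such that $\rho_{k,1}=\rho_k\chi_{B(y_k,R_\varepsilon)}$ and $\rho_{k,2}=\rho_k\chi_{B(y_k,P_k)^C}$ satisfy, for all $k$ large enough (depending on $\varepsilon$), $$\|\rho_k-\rho_{k,1}-\rho_{k,2}\|_{L^1}\le\varepsilon,\qquad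 \big|\|\rho_{k,1}\|_{L^1}-\lambda\big|\le\varepsilon,\qquad \big|\|\rho_{k,2}\|_{L^1}-(N-\lambda)\big|\le\varepsilon,$$ and $\operatorname{dist}(\operatorname{supp}\rho_{k,1},\operatorname{supp}\rho_{k,2})\to\infty$ as $k\to\infty$. Then $\sup_k\|\Psi_k\|_{\mathcal Q_{N,A}}<\infty$, and there are a subsequence, again denoted by $(\Psi_k)$ (with the corresponding $\rho_k$ and $y_k(\varepsilon)$), and a number $d>0$ such that for all $\varepsilon>0$ small enough there is a function $J_\varepsilon\in C_0^\infty(\mathbb R^{3N};[0,1])$, symmetric with respect to exchange of the particle coordinates, and a $k_0(\varepsilon)$ such that for all $k\ge k_0(\varepsilon)$ $$H_{\rho_k}^N\ \ge\ E^N+d\,(1-\tau_{y_k}J_\varepsilon)-N\big(2\sqrt\varepsilon\,C+\varepsilon N\big)-2^N(\varepsilon N)^2$$ in the sense of quadratic forms on $\mathcal Q_{N,A}$, where $y_k=y_k(\varepsilon)$, $(\tau_{y}J)(x_1,\dots,x_N)=J(x_1-y,\dots,x_N-y)$ and $C=2\sup_k\|\Psi_k\|_{\mathcal Q_{N,A}}$,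 the supremum being taken over the subsequence. If $\lambda=N$ and $N\ge2$, one may take $d=\Delta E^N:=\min\{E^k+E^{N-k}: k=1,\dots,N-1\}-E^N$. -/

import Mathlib

open MeasureTheory Filter Topology
open scoped ContDiff

noncomputable section

namespace Polaron

/-- Physical space `ℝ³` with its Euclidean norm. -/
abbrev Space : Type := EuclideanSpace ℝ (Fin 3)

/-- Configurations `(x₁, …, x_N)` of `N` points; the measure is Lebesgue measure on `ℝ^{3N}`. -/
abbrev Config (N : ℕ) : Type := Fin N → Space

/-- Wave functions of `N` particles with `q` spin states: `Ψ s x` is the value of `Ψ` at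
`((x₁, s₁), …, (x_N, s_N)) ∈ (ℝ³ × {1, …, q})^N`. -/
abbrev WaveFn (q N : ℕ) : Type := (Fin N → Fin q) → Config N → ℂ

variable {q N : ℕ}

/-- `Ψ` is square integrable and antisymmetric under exchange of the pairs `(x_j, s_j)`,
i.e. `Ψ` (represents an element that) belongs to `∧^N L²(ℝ³ × {1, …, q})`. -/
structure IsFermionic (Ψ : WaveFn q N) : Prop where
  memLp : ∀ s, MemLp (Ψ s) 2 volume
  antisymm : ∀ (π : Equiv.Perm (Fin N)) (s : Fin N → Fin q), ∀ᵐ x : Config N,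
    Ψ (s ∘ π) (x ∘ π) = ((Equiv.Perm.sign π : ℤ) : ℂ) * Ψ s x

/-- The square of the `L²` norm, `‖Ψ‖² = ∑_s ∫ |Ψ(s, x)|² dx`. -/
def normSq (Ψ : WaveFn q N) : ℝ := ∑ s, ∫ x, ‖Ψ s x‖ ^ 2

/-- The classical partial derivative of `η` with respect to the `m`-th component of `x_j`. -/
def partialDeriv (j : Fin N) (m : Fin 3) (η : Config N → ℂ) (x : Config N) : ℂ :=
  fderiv ℝ η x (Pi.single j (EuclideanSpace.single m (1 : ℝ)))

/-- `F` is the `m`-th component of `D_{A,x_j} u = -i ∇_{x_j} u + A(x_j) u` in the sense of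
distributions: `∫ F η = ∫ u (i ∂_{j,m} η + A_m(x_j) η)` for all test functions `η`. -/
def HasMagDeriv (A : Space →ₗ[ℝ] Space) (j : Fin N) (m : Fin 3) (u F : Config N → ℂ) : Prop :=
  ∀ η : Config N → ℂ, ContDiff ℝ ∞ η → HasCompactSupport η →
    ∫ x, F x * η x =
      ∫ x, u x * (Complex.I * partialDeriv j m η x + ((A (x j) m : ℝ) : ℂ) * η x)

open Classical in
/-- The `m`-th component of `D_{A,x_j} u` if it is an `L²` function (which is then unique almost
everywhere), and `0` otherwise. -/
def magDeriv (A : Space →ₗ[ℝ] Space) (j : Fin N) (m : Fin 3) (u : Config N → ℂ) :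
    Config N → ℂ :=
  if h : ∃ F, MemLp F 2 volume ∧ HasMagDeriv A j m u F then h.choose else 0

/-- The form domain `𝒬_{N,A}`: all `Ψ ∈ ∧^N L²(ℝ³ × {1, …, q})` with `D_{A,x_j} Ψ ∈ L²` for
all `j`. -/
structure InFormDomain (A : Space →ₗ[ℝ] Space) (Ψ : WaveFn q N) : Prop where
  fermionic : IsFermionic Ψ
  deriv_memLp : ∀ s j m, ∃ F, MemLp F 2 volume ∧ HasMagDeriv A j m (Ψ s) F

/-- The kinetic energy `⟨Ψ, ∑_j D_{A,x_j}² Ψ⟩ = ∑_j ‖D_{A,x_j} Ψ‖²`. -/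
def kinetic (A : Space →ₗ[ℝ] Space) (Ψ : WaveFn q N) : ℝ :=
  ∑ s, ∑ j, ∑ m, ∫ x, ‖magDeriv A j m (Ψ s) x‖ ^ 2

/-- The form norm of `𝒬_{N,A}`. -/
def formNorm (A : Space →ₗ[ℝ] Space) (Ψ : WaveFn q N) : ℝ :=
  Real.sqrt (normSq Ψ + kinetic A Ψ)

/-- The Coulomb repulsion `⟨Ψ, ∑_{i<j} |x_i - x_j|⁻¹ Ψ⟩`. -/
def repulsion (Ψ : WaveFn q N) : ℝ :=
  ∑ s, ∑ i, ∑ j ∈ Finset.Ioi i, ∫ x, ‖Ψ s x‖ ^ 2 / ‖x i - x j‖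

/-- The configuration whose `j`-th point is `x` and whose other points are given by `z`. -/
def insertAt (j : Fin N) (x : Space) (z : {i : Fin N // i ≠ j} → Space) : Config N :=
  fun i => if h : i = j then x else z ⟨i, h⟩

/-- The density `ρ_Ψ(x)`: the sum over `j` and over all spins of the integral of `|Ψ|²` over all
positions but the `j`-th one, which is `x`. -/
def density (Ψ : WaveFn q N) (x : Space) : ℝ :=
  ∑ j, ∑ s, ∫ z : {i : Fin N // i ≠ j} → Space, ‖Ψ s (insertAt j x z)‖ ^ 2

/-- `V_σ = σ * |·|⁻¹`. -/
def coulombPotential (σ : Space → ℝ) (x : Space) : ℝ := ∫ y, σ y / ‖x - y‖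

/-- `D(σ) = (1/2) ∬ σ(x) σ(y) / |x - y| dx dy`. -/
def coulombEnergy (σ : Space → ℝ) : ℝ := (1 / 2) * ∫ x, ∫ y, σ x * σ y / ‖x - y‖

/-- The Pekar-Tomasevich functional `ℰ^N` (with `α = U = 1`). -/
def energy (A : Space →ₗ[ℝ] Space) (Ψ : WaveFn q N) : ℝ :=
  kinetic A Ψ + repulsion Ψ - coulombEnergy (density Ψ)

/-- The minimal energy `E^N_{PT}` of `N` particles with `q` spin states. -/
def groundEnergy (A : Space →ₗ[ℝ] Space) (q N : ℕ) : ℝ :=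
  sInf {e | ∃ Ψ : WaveFn q N, InFormDomain A Ψ ∧ normSq Ψ = 1 ∧ energy A Ψ = e}

/-- The binding inequality `E^N < E^k + E^{N-k}` for all `k = 1, …, N - 1`. -/
def Binding (A : Space →ₗ[ℝ] Space) (q N : ℕ) : Prop :=
  ∀ k ∈ Set.Ico 1 N, groundEnergy A q N < groundEnergy A q k + groundEnergy A q (N - k)

/-- `ΔE^N = min {E^k + E^{N-k} | k = 1, …, N - 1} - E^N`, meaningful for `N ≥ 2`. -/
def bindingEnergy (A : Space →ₗ[ℝ] Space) (q N : ℕ) : ℝ :=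
  sInf ((fun k => groundEnergy A q k + groundEnergy A q (N - k)) '' Set.Ico 1 N)
    - groundEnergy A q N

/-- `(Ψ_k)` is a minimizing sequence of `ℰ^N` on the unit sphere of `𝒬_{N,A}`. -/
structure IsMinimizingSeq (A : Space →ₗ[ℝ] Space) (Ψ : ℕ → WaveFn q N) : Prop where
  mem : ∀ k, InFormDomain A (Ψ k)
  normalized : ∀ k, normSq (Ψ k) = 1
  tendsto : Tendsto (fun k => energy A (Ψ k)) atTop (𝓝 (groundEnergy A q N))

/-- The quadratic form `⟨Φ, H_σ^N Φ⟩` on `𝒬_{N,A}` of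
`H_σ^N = ∑_j (D_{A,x_j}² - V_σ(x_j)) + ∑_{i<j} |x_i - x_j|⁻¹ + D(σ)`. -/
def hamiltonianForm (A : Space →ₗ[ℝ] Space) (σ : Space → ℝ) (Φ : WaveFn q N) : ℝ :=
  kinetic A Φ - (∑ s, ∑ j, ∫ x, coulombPotential σ (x j) * ‖Φ s x‖ ^ 2)
    + repulsion Φ + coulombEnergy σ * normSq Φ

/-- The quadratic form `⟨Φ, W Φ⟩` of the multiplication operator by `W`. -/
def multForm (W : Config N → ℝ) (Φ : WaveFn q N) : ℝ := ∑ s, ∫ x, W x * ‖Φ s x‖ ^ 2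

/-- The operator inequality `H_σ^N ≥ W`, in the sense of quadratic forms on `𝒬_{N,A}`. -/
def HamiltonianGe (A : Space →ₗ[ℝ] Space) (q : ℕ) (σ : Space → ℝ) (W : Config N → ℝ) : Prop :=
  ∀ Φ : WaveFn q N, InFormDomain A Φ → multForm W Φ ≤ hamiltonianForm A σ Φ

/-- `(τ_y J)(x₁, …, x_N) = J(x₁ - y, …, x_N - y)`. -/
def translate (y : Space) (J : Config N → ℝ) : Config N → ℝ := fun x => J (fun i => x i - y)

/-- `J ∈ C₀^∞(ℝ^{3N}; [0,1])`, symmetric under exchange of particle coordinates. -/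
structure IsSymmCutoff (J : Config N → ℝ) : Prop where
  smooth : ContDiff ℝ ∞ J
  compact : HasCompactSupport J
  mem_Icc : ∀ x, J x ∈ Set.Icc (0 : ℝ) 1
  symm : ∀ (π : Equiv.Perm (Fin N)) (x : Config N), J (x ∘ π) = J x

/-- The (essential) support of a locally integrable function. -/
def essSupport (f : Space → ℝ) : Set Space :=
  (volume.withDensity fun x => ENNReal.ofReal |f x|).support

/-- The distance of two sets, with the convention that it is `∞` if one of them is empty. -/
def setDist (S T : Set Space) : ENNReal := ⨅ x ∈ S, ⨅ y ∈ T, edist x y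

/-- The case "dichotomy or compactness" of the concentration compactness principle, for densities
`ρ_k` of total mass `M`, with mass parameter `lam ∈ (0, M]`, radii `R ε`, centres `y ε k` and outer
radii `P ε k`. Here `ρ_{k,1} = ρ_k χ_{B(y_k, R)}` and `ρ_{k,2} = ρ_k χ_{B(y_k, P_k)ᶜ}`. -/
structure DichotomyOrCompactness (M : ℝ) (ρ : ℕ → Space → ℝ) (lam : ℝ) (R : ℝ → ℝ)
    (y : ℝ → ℕ → Space) (P : ℝ → ℕ → ℝ) : Prop where
  lam_mem : lam ∈ Set.Ioc 0 M
  radius_pos : ∀ ε > 0, 0 < R ε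
  outer_tendsto : ∀ ε > 0, Tendsto (P ε) atTop atTop
  remainder_le : ∀ ε > 0, ∀ᶠ k in atTop,
    ∫ x, |ρ k x - (Metric.ball (y ε k) (R ε)).indicator (ρ k) x
      - (Metric.ball (y ε k) (P ε k))ᶜ.indicator (ρ k) x| ≤ ε
  inner_mass : ∀ ε > 0, ∀ᶠ k in atTop,
    |(∫ x, |(Metric.ball (y ε k) (R ε)).indicator (ρ k) x|) - lam| ≤ ε
  outer_mass : ∀ ε > 0, ∀ᶠ k in atTop,
    |(∫ x, |(Metric.ball (y ε k) (P ε k))ᶜ.indicator (ρ k) x|) - (M - lam)| ≤ ε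
  dist_tendsto : ∀ ε > 0, Tendsto
    (fun k => setDist (essSupport ((Metric.ball (y ε k) (R ε)).indicator (ρ k)))
      (essSupport ((Metric.ball (y ε k) (P ε k))ᶜ.indicator (ρ k)))) atTop (𝓝 ⊤)

end Polaron

end

/-!
The lower bound on `H_ρ`, for `ρ = ρ_k`, comes from localising each particle inside or outside a
ball around `y_k`.

*A single cluster.* For every charge `σ ≥ 0`, `H_σ ≥ E^N`: the Coulomb kernel is positive definite,
being a superposition of products of Gaussians (`coulombKernel_eq`, `two_mul_mutualEnergy_le`), so
`∫ V_σ ρ_Φ ≤ D(σ) + D(ρ_Φ)`, and the linear form lies above the Pekar-Tomasevich functional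
(`InFormDomain.groundEnergy_mul_le`).

*Two clusters.* If `Φ` is antisymmetric within each of two groups of `k` and `N - k` particles,
freezing the coordinates of one group produces fermionic wave functions of the other
(`cluster_bound`). That magnetic weak derivatives survive the freezing for almost every slice is seen
by gauging away the vector potential in one direction, which is possible since `A` is linear, and by
replacing a weak derivative with countably many integrated identities
(`hasMagDeriv_iff_isTransDeriv`, `hasMagDeriv_glue`). Dropping the repulsion between the groups gives
a lower bound `E^k + E^{N-k}` when the two groups see different parts `ρ₁`, `ρ₂` of `ρ`, since
`D(ρ₁) + D(ρ₂) ≤ D(ρ)` (`two_cluster_bound`).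

*Localisation.* The functions `∏_{j ∈ a} χ(x_j) ∏_{j ∉ a} χ'(x_j)`, `a ⊆ {1, …, N}`, with
`χ² + χ'² = 1`, form a quadratic partition of unity, whose cost is controlled by the gradients of
`χ` and `χ'` (`InFormDomain.sum_hamiltonianForm_localize_le`). On the piece with all particles
inside, the bound is `E^N`; on the mixed pieces it is `E^k + E^{N-k}`, which exceeds `E^N` by the
binding inequality. With all particles outside, they do not see the inner part `ρ₁`, whose
self-energy `D(ρ₁) > 0` is a gap; if `λ = N ≥ 2`, they see almost no charge at all, and splitting off
one particle costs the binding energy (`InFormDomain.multForm_le_of_split`). The cutoff `J` is the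
square of the member of the partition with all particles inside.

*Errors.* The potential of a charge of mass `m` is at most `2 √m` times the form norm, by the magnetic
Hardy inequality (`hardy`, `HardyCharge.potential_le_sqrt`); with `m = ε` this controls the shell
between the inner and the outer part, and the other potentials decay with the distance.

*Uniformity of the gap.* The constant `d` must not depend on `ε`, while the centres `y_k(ε)` may.
For fixed `ε'` the self-energy of the inner part is bounded below by mass and radius, and it bounds
that of the inner part for every other `ε` whose centres stay at bounded distance. If along every
subsequence the self-energies had no uniform bound, one could select more and more values of `ε` with
mutually diverging centres, each carrying a mass of almost `λ`, which exceeds the total mass `N`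
(`DichotomyOrCompactness.exists_energy_ge`). This is the reason for passing to a subsequence.
-/

set_option linter.unusedSectionVars false

namespace Polaron

/-! ### Weak derivatives in one direction -/

section WeakDeriv

variable {E : Type*} [NormedAddCommGroup E] [NormedSpace ℝ E] [FiniteDimensional ℝ E]
  [MeasurableSpace E] [BorelSpace E] {μ : Measure E} [μ.IsAddHaarMeasure]

/-- `g` is the distributional derivative of `w` in the direction `e`. -/
def IsWeakDeriv (μ : Measure E) (e : E) (w g : E → ℂ) : Prop :=
  ∀ η : E → ℂ, ContDiff ℝ ∞ η → HasCompactSupport η →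
    ∫ x, g x * η x ∂μ = -∫ x, w x * fderiv ℝ η x e ∂μ

/-- `g` is the derivative of `w` in the direction `e` in the integrated sense: the fundamental
theorem of calculus holds along almost every segment `[x, x + t e]`, for each `t = 1 / (n + 1)`.
For square integrable functions this is equivalent to `IsWeakDeriv`, and, being a countable family
of almost everywhere statements, it passes to slices by Fubini's theorem. -/
def IsTransDeriv (μ : Measure E) (e : E) (w g : E → ℂ) : Prop :=
  ∀ n : ℕ, ∀ᵐ x ∂μ, w (x + (1 / ((n : ℝ) + 1)) • e) - w x
    = ∫ s in (0 : ℝ)..(1 / ((n : ℝ) + 1)), g (x + s • e)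

/-- The correlation of `f` with the translates of `h` in the direction `e`. -/
noncomputable def corr (μ : Measure E) (e : E) (f h : E → ℂ) (s : ℝ) : ℂ :=
  ∫ x, f (x + s • e) * h x ∂μ

lemma memLp_translate {f : E → ℂ} (hf : MemLp f 2 μ) (v : E) :
    MemLp (fun x => f (x + v)) 2 μ :=
  hf.comp_measurePreserving (measurePreserving_add_right μ v)

lemma continuous_corr (e : E) {f h : E → ℂ} (hf : MemLp f 2 μ) (hh : MemLp h 2 μ) :
    Continuous (corr μ e f h) := by
  have : Fact ((1 : ENNReal) ≤ 2) := ⟨by norm_num⟩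
  let G : ℝ → C(E, E) := fun s => ⟨fun x => x + s • e, by fun_prop⟩
  have hG : Continuous G := by
    apply ContinuousMap.continuous_of_continuous_uncurry
    simp only [G, Function.uncurry_def]
    change Continuous fun p : ℝ × E => p.2 + p.1 • e
    fun_prop
  have hGm : ∀ s, MeasurePreserving (G s) μ μ := fun s => measurePreserving_add_right μ (s • e)
  have h1 := (continuous_const (y := hf.toLp f)).compMeasurePreservingLp hG hGm
    (by norm_num : (2 : ENNReal) ≠ ⊤)
  have hs : MemLp (star h) 2 μ := hh.star
  have h2 := (continuous_const (y := hs.toLp (star h))).inner (𝕜 := ℂ) h1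
  refine h2.congr fun s => ?_
  rw [L2.inner_def, corr]
  refine integral_congr_ae ?_
  have e1 : (Lp.compMeasurePreserving (G s) (hGm s) (hf.toLp f)) =ᵐ[μ] fun x => f (x + s • e) := by
    rw [Lp.toLp_compMeasurePreserving]
    exact MemLp.coeFn_toLp _
  filter_upwards [e1, hs.coeFn_toLp] with x hx1 hx2
  rw [hx1, hx2]
  simp [mul_comm]

lemma memLp_shear [SecondCountableTopology E] [SFinite μ] (e : E) {g : E → ℂ} (hg : MemLp g 2 μ)
    (ν : Measure ℝ) [IsFiniteMeasure ν] :
    MemLp (fun p : ℝ × E => g (p.2 + p.1 • e)) 2 (ν.prod μ) := by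
  have hm : MeasurePreserving (fun p : ℝ × E => (p.1, p.2 + p.1 • e)) (ν.prod μ) (ν.prod μ) :=
    (MeasurePreserving.id ν).skew_product (g := fun (s : ℝ) (x : E) => x + s • e) (by fun_prop)
      (ae_of_all _ fun s => (measurePreserving_add_right μ (s • e)).map_eq)
  exact (hg.comp_snd ν).comp_measurePreserving hm

lemma integrable_shear_mul (e : E) {g h : E → ℂ} (hg : MemLp g 2 μ) (hh : MemLp h 2 μ)
    (ν : Measure ℝ) [IsFiniteMeasure ν] :
    Integrable (fun p : ℝ × E => g (p.2 + p.1 • e) * h p.2) (ν.prod μ) :=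
  (memLp_shear e hg ν).integrable_mul (hh.comp_snd ν)

/-- Fubini's theorem for the average of the correlation over translations. -/
lemma integral_corr (e : E) {g h : E → ℂ} (hg : MemLp g 2 μ) (hh : MemLp h 2 μ) {t : ℝ}
    (ht : 0 ≤ t) :
    ∫ s in (0 : ℝ)..t, corr μ e g h s = ∫ x, (∫ s in (0 : ℝ)..t, g (x + s • e)) * h x ∂μ := by
  simp only [intervalIntegral.integral_of_le ht, corr, ← integral_mul_const]
  exact integral_integral_swap (integrable_shear_mul e hg hh _)

lemma integrable_average_mul (e : E) {g h : E → ℂ} (hg : MemLp g 2 μ) (hh : MemLp h 2 μ) {t : ℝ}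
    (ht : 0 ≤ t) :
    Integrable (fun x => (∫ s in (0 : ℝ)..t, g (x + s • e)) * h x) μ := by
  have := (integrable_shear_mul e hg hh (volume.restrict (Set.Ioc 0 t))).integral_prod_right
  simpa only [intervalIntegral.integral_of_le ht, ← integral_mul_const] using this

/-- If the fundamental theorem of calculus holds for `v` with derivative `h`, translations of `w`
can be moved onto `v`. -/
lemma integral_diff_mul (e : E) {w v h : E → ℂ} (hw : MemLp w 2 μ) (hv : MemLp v 2 μ)
    (hh : MemLp h 2 μ) {t : ℝ} (ht : 0 ≤ t)
    (hT : ∀ᵐ x ∂μ, v (x + t • e) - v x = ∫ s in (0 : ℝ)..t, h (x + s • e)) :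
    ∫ x, (w (x + t • e) - w x) * v x ∂μ = -∫ s in (0 : ℝ)..t, corr μ e w h s := by
  have hwt := memLp_translate hw (t • e)
  have hvt := memLp_translate hv (t • e)
  have i1 : Integrable (fun x => w (x + t • e) * v x) μ := hwt.integrable_mul hv
  have i2 : Integrable (fun x => w x * v x) μ := hw.integrable_mul hv
  have i3 : Integrable (fun x => w (x + t • e) * v (x + t • e)) μ := hwt.integrable_mul hvt
  have e1 : ∫ x, w x * v x ∂μ = ∫ x, w (x + t • e) * v (x + t • e) ∂μ :=
    (integral_add_right_eq_self (fun x => w x * v x) (t • e)).symm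
  have e2 : ∫ x, (w (x + t • e) - w x) * v x ∂μ
      = -∫ x, (∫ s in (0 : ℝ)..t, h (x + s • e)) * w (x + t • e) ∂μ := by
    simp only [sub_mul]
    rw [integral_sub i1 i2, e1, ← integral_sub i1 i3, ← integral_neg]
    refine integral_congr_ae ?_
    filter_upwards [hT] with x hx
    rw [← hx]; ring
  rw [e2, ← integral_corr e hh hwt ht]
  congr 1
  have e3 := intervalIntegral.integral_comp_sub_left (a := 0) (b := t) (fun s => corr μ e w h s) t
  rw [sub_self, sub_zero] at e3
  rw [← e3]
  refine intervalIntegral.integral_congr fun s _ => ?_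
  simp only [corr]
  rw [← integral_add_right_eq_self (fun x => w (x + (t - s) • e) * h x) (s • e)]
  refine integral_congr_ae (ae_of_all _ fun x => ?_)
  simp only []
  rw [mul_comm, add_assoc, ← add_smul]
  congr 3
  ring_nf

/-- A continuous function all of whose integrals over `[0, 1 / (n + 1)]` vanish is zero at `0`. -/
lemma eq_zero_of_integral_eq_zero {b : ℝ → ℂ} (hb : Continuous b)
    (h : ∀ n : ℕ, ∫ s in (0 : ℝ)..(1 / ((n : ℝ) + 1)), b s = 0) : b 0 = 0 := by
  have hd : HasDerivAt (fun t => ∫ s in (0 : ℝ)..t, b s) (b 0) 0 :=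
    intervalIntegral.integral_hasDerivAt_right (by simp)
      (hb.stronglyMeasurableAtFilter _ _) hb.continuousAt
  have h1 := hd.tendsto_slope_zero
  have h2 : Tendsto (fun n : ℕ => 1 / ((n : ℝ) + 1)) atTop (𝓝[≠] 0) :=
    tendsto_nhdsWithin_iff.2 ⟨tendsto_one_div_add_atTop_nhds_zero_nat,
      Eventually.of_forall fun n => by
        have : (0 : ℝ) < 1 / ((n : ℝ) + 1) := by positivity
        exact this.ne'⟩
  have h3 := h1.comp h2
  refine tendsto_nhds_unique h3 (tendsto_const_nhds.congr fun n => ?_)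
  simp only [Function.comp, zero_add, h n, intervalIntegral.integral_same, sub_zero, smul_zero]

/-- Integration by parts for derivatives in the integrated sense: the sum of the two correlations is
continuous and has vanishing integrals over `[0, 1 / (n + 1)]`, so it vanishes at `0`. -/
lemma IsTransDeriv.integral_mul {e : E} {w g v h : E → ℂ} (hw : MemLp w 2 μ) (hg : MemLp g 2 μ)
    (hv : MemLp v 2 μ) (hh : MemLp h 2 μ) (h1 : IsTransDeriv μ e w g)
    (h2 : IsTransDeriv μ e v h) : ∫ x, g x * v x ∂μ = -∫ x, w x * h x ∂μ := by
  have key : corr μ e g v 0 + corr μ e w h 0 = 0 := by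
    refine eq_zero_of_integral_eq_zero (b := fun s => corr μ e g v s + corr μ e w h s)
      ((continuous_corr e hg hv).add (continuous_corr e hw hh)) fun n => ?_
    have ht : (0 : ℝ) ≤ 1 / ((n : ℝ) + 1) := by positivity
    rw [intervalIntegral.integral_add ((continuous_corr e hg hv).intervalIntegrable _ _)
      ((continuous_corr e hw hh).intervalIntegrable _ _), integral_corr e hg hv ht,
      ← neg_eq_iff_eq_neg.2 (integral_diff_mul e hw hv hh ht (h2 n)), ← sub_eq_add_neg, sub_eq_zero]
    refine integral_congr_ae ?_
    filter_upwards [h1 n] with x hx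
    rw [hx]
  simp only [corr, zero_smul, add_zero] at key
  exact eq_neg_of_add_eq_zero_left key

lemma test_ftc {η : E → ℂ} (hη : ContDiff ℝ ∞ η) (e x : E) (t : ℝ) :
    η (x + t • e) - η x = ∫ s in (0 : ℝ)..t, fderiv ℝ η (x + s • e) e := by
  have hd : ∀ s ∈ Set.uIcc 0 t, HasDerivAt (fun s : ℝ => η (x + s • e))
      (fderiv ℝ η (x + s • e) e) s := fun s _ => by
    have h1 : HasDerivAt (fun s : ℝ => x + s • e) e s := by
      simpa using ((hasDerivAt_id s).smul_const e).const_add x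
    exact ((hη.differentiable (by simp)).differentiableAt.hasFDerivAt).comp_hasDerivAt s h1
  have hc : Continuous fun s : ℝ => fderiv ℝ η (x + s • e) e :=
    ((hη.continuous_fderiv (by simp)).comp (by fun_prop : Continuous fun s : ℝ => x + s • e)).clm_apply
      continuous_const
  rw [intervalIntegral.integral_eq_sub_of_hasDerivAt hd (hc.intervalIntegrable _ _)]
  simp

lemma contDiff_fderiv_apply {F : Type*} [NormedAddCommGroup F] [NormedSpace ℝ F] {η : E → F}
    (hη : ContDiff ℝ ∞ η) (e : E) : ContDiff ℝ ∞ fun x => fderiv ℝ η x e :=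
  (hη.fderiv_right (by simp)).clm_apply contDiff_const

lemma memLp_test {η : E → ℂ} (hη : ContDiff ℝ ∞ η) (hc : HasCompactSupport η) : MemLp η 2 μ :=
  hη.continuous.memLp_of_hasCompactSupport hc

lemma memLp_test_deriv {η : E → ℂ} (hη : ContDiff ℝ ∞ η) (hc : HasCompactSupport η) (e : E) :
    MemLp (fun x => fderiv ℝ η x e) 2 μ :=
  memLp_test (contDiff_fderiv_apply hη e) (hc.fderiv_apply ℝ e)

lemma isTransDeriv_test {η : E → ℂ} (hη : ContDiff ℝ ∞ η) (e : E) :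
    IsTransDeriv μ e η fun x => fderiv ℝ η x e :=
  fun _ => ae_of_all _ fun x => test_ftc hη e x _

lemma IsTransDeriv.isWeakDeriv {e : E} {w g : E → ℂ} (hw : MemLp w 2 μ) (hg : MemLp g 2 μ)
    (h : IsTransDeriv μ e w g) : IsWeakDeriv μ e w g := fun _ hη hc =>
  h.integral_mul hw hg (memLp_test hη hc) (memLp_test_deriv hη hc e) (isTransDeriv_test hη e)

lemma locallyIntegrable_average (e : E) {g : E → ℂ} (hg : MemLp g 2 μ) {t : ℝ} (ht : 0 ≤ t) :
    LocallyIntegrable (fun x => ∫ s in (0 : ℝ)..t, g (x + s • e)) μ := by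
  rw [locallyIntegrable_iff]
  intro K hK
  have h1 : MemLp (K.indicator fun _ => (1 : ℂ)) 2 μ :=
    memLp_indicator_const 2 hK.measurableSet 1 (Or.inr hK.measure_lt_top.ne)
  have h2 := integrable_average_mul e hg h1 ht
  rw [← integrable_indicator_iff hK.measurableSet]
  refine h2.congr (ae_of_all _ fun x => ?_)
  by_cases hx : x ∈ K <;> simp [hx]

/-- Both sides of the fundamental theorem of calculus have the same integral against every test
function: the weak derivative is transferred to translates of the test function, for which the
theorem holds classically. -/
lemma IsWeakDeriv.isTransDeriv {e : E} {w g : E → ℂ} (hw : MemLp w 2 μ) (hg : MemLp g 2 μ)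
    (h : IsWeakDeriv μ e w g) : IsTransDeriv μ e w g := by
  intro n
  set t : ℝ := 1 / ((n : ℝ) + 1) with ht'
  have ht : 0 ≤ t := by positivity
  refine ae_eq_of_integral_contDiff_smul_eq
    (((memLp_translate hw (t • e)).sub hw).locallyIntegrable (by norm_num))
    (locallyIntegrable_average e hg ht) fun ζ hζ hc => ?_
  set η : E → ℂ := fun x => (ζ x : ℂ) with hη'
  have hη : ContDiff ℝ ∞ η := Complex.ofRealCLM.contDiff.comp hζ
  have hcη : HasCompactSupport η := hc.comp_left (g := fun r : ℝ => (r : ℂ)) (by simp)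
  have hshift : ∀ s, corr μ e g η s = -corr μ e w (fun x => fderiv ℝ η x e) s := by
    intro s
    have hs := h (fun x => η (x - s • e)) (hη.comp (contDiff_id.sub contDiff_const))
      (hcη.comp_homeomorph (Homeomorph.subRight (s • e)))
    simp only [corr]
    rw [← integral_add_right_eq_self (fun x => g x * η (x - s • e)) (s • e),
      ← integral_add_right_eq_self
        (fun x => w x * fderiv ℝ (fun x => η (x - s • e)) x e) (s • e)] at hs
    simp only [fderiv_comp_sub, add_sub_cancel_right] at hs
    exact hs
  calc ∫ x, ζ x • (w (x + t • e) - w x) ∂μ = ∫ x, (w (x + t • e) - w x) * η x ∂μ := by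
        refine integral_congr_ae (ae_of_all _ fun x => ?_)
        simp [hη', mul_comm]
    _ = ∫ s in (0 : ℝ)..t, corr μ e g η s := by
        rw [integral_diff_mul e hw (memLp_test hη hcη) (memLp_test_deriv hη hcη e) ht
          (ae_of_all _ fun x => test_ftc hη e x _), ← intervalIntegral.integral_neg]
        exact intervalIntegral.integral_congr fun s _ => (hshift s).symm
    _ = ∫ x, (ζ x • ∫ s in (0 : ℝ)..t, g (x + s • e)) ∂μ := by
        rw [integral_corr e hg (memLp_test hη hcη) ht]
        refine integral_congr_ae (ae_of_all _ fun x => ?_)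
        simp [hη', mul_comm]

end WeakDeriv

/-! ### Gauge transformation and magnetic derivatives -/

/-- The unit vector of configuration space in the `m`-th direction of the `j`-th particle. -/
noncomputable def unitDir {N : ℕ} (j : Fin N) (m : Fin 3) : Config N :=
  Pi.single j (EuclideanSpace.single m (1 : ℝ))

/-- A function whose derivative in the direction `unitDir j m` is `x ↦ A(x_j)_m`; multiplication by
`exp (i gauge)` turns `D_{A,x_j}` in direction `m` into `-i ∂_{j,m}`. -/
noncomputable def gauge {N : ℕ} (A : Space →ₗ[ℝ] Space) (j : Fin N) (m : Fin 3) (x : Config N) : ℝ :=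
  A (x j) m * x j m - A (EuclideanSpace.single m (1 : ℝ)) m * (x j m) ^ 2 / 2

section Gauge

variable {N : ℕ} (A : Space →ₗ[ℝ] Space) (j : Fin N) (m : Fin 3)

lemma contDiff_coord : ContDiff ℝ ∞ fun x : Config N => x j m := by fun_prop

lemma contDiff_vectorPotential : ContDiff ℝ ∞ fun x : Config N => A (x j) m := by
  have h : ContDiff ℝ ∞ fun x : Config N => (LinearMap.toContinuousLinearMap A) (x j) := by fun_prop
  have h2 : ContDiff ℝ ∞ fun x : Config N => ((LinearMap.toContinuousLinearMap A) (x j)) m := by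
    fun_prop
  exact h2

lemma contDiff_gauge : ContDiff ℝ ∞ (gauge (N := N) A j m) := by
  have h1 := contDiff_vectorPotential A j m
  have h2 := contDiff_coord (N := N) j m
  exact (h1.mul h2).sub ((contDiff_const.mul (h2.pow 2)).div_const 2)

/-- `exp (i c gauge)` for a constant `c`. -/
noncomputable def phase (c : ℝ) (x : Config N) : ℂ :=
  Complex.exp (Complex.I * ((c * gauge A j m x : ℝ) : ℂ))

lemma norm_phase (c : ℝ) (x : Config N) : ‖phase A j m c x‖ = 1 := by
  rw [phase, mul_comm]; exact Complex.norm_exp_ofReal_mul_I _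

lemma phase_neg_mul (x : Config N) : phase A j m (-1) x * phase A j m 1 x = 1 := by
  rw [phase, phase, ← Complex.exp_add]
  simp

lemma conj_phase_one (x : Config N) :
    (starRingEnd ℂ) (phase A j m 1 x) = phase A j m (-1) x := by
  rw [phase, phase, ← Complex.exp_conj]
  simp

lemma contDiff_phase (c : ℝ) : ContDiff ℝ ∞ (phase (N := N) A j m c) := by
  have h : ContDiff ℝ ∞ fun x : Config N => ((c * gauge A j m x : ℝ) : ℂ) :=
    Complex.ofRealCLM.contDiff.comp (contDiff_const.mul (contDiff_gauge A j m))
  exact (contDiff_const.mul h).cexp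

lemma coord_shift (x : Config N) (t : ℝ) :
    (x + t • unitDir j m) j = x j + t • EuclideanSpace.single m (1 : ℝ) := by
  simp [unitDir]

lemma gauge_shift (x : Config N) (t : ℝ) :
    gauge A j m (x + t • unitDir j m) = gauge A j m x + t * A (x j) m
      + t ^ 2 * A (EuclideanSpace.single m (1 : ℝ)) m / 2 := by
  simp only [gauge, coord_shift, map_add, map_smul, PiLp.add_apply, PiLp.smul_apply,
    PiLp.single_apply, if_true, smul_eq_mul]
  ring

lemma fderiv_gauge (x : Config N) : fderiv ℝ (gauge A j m) x (unitDir j m) = A (x j) m := by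
  have h1 : HasDerivAt (fun t : ℝ => gauge A j m (x + t • unitDir j m))
      (fderiv ℝ (gauge A j m) x (unitDir j m)) 0 := by
    have h0 : HasDerivAt (fun s : ℝ => x + s • unitDir j m) (unitDir j m) 0 := by
      simpa using ((hasDerivAt_id (0 : ℝ)).smul_const (unitDir j m)).const_add x
    have := ((contDiff_gauge A j m).differentiable (by simp)).differentiableAt
      (x := x + (0 : ℝ) • unitDir j m) |>.hasFDerivAt.comp_hasDerivAt (0 : ℝ) h0
    rw [zero_smul, add_zero] at this
    exact this
  have h2 : HasDerivAt (fun t : ℝ => gauge A j m (x + t • unitDir j m)) (A (x j) m) 0 := by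
    simp only [gauge_shift]
    have := (((hasDerivAt_id (0 : ℝ)).mul_const (A (x j) m)).const_add (gauge A j m x)).add
      ((((hasDerivAt_id (0 : ℝ)).pow 2).mul_const (A (EuclideanSpace.single m (1 : ℝ)) m)).div_const 2)
    refine this.congr_deriv ?_
    simp
  exact h1.unique h2

lemma fderiv_phase (c : ℝ) (x : Config N) : fderiv ℝ (phase A j m c) x (unitDir j m)
    = Complex.I * (c * A (x j) m : ℝ) * phase A j m c x := by
  have hg := ((contDiff_gauge A j m).differentiable (by simp)).differentiableAt (x := x)
  have h1 : HasFDerivAt (fun x : Config N => ((c * gauge A j m x : ℝ) : ℂ))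
      (Complex.ofRealCLM.comp (c • fderiv ℝ (gauge A j m) x)) x :=
    Complex.ofRealCLM.hasFDerivAt.comp x (hg.hasFDerivAt.const_mul c)
  have h2 := (h1.const_mul Complex.I).cexp
  rw [show phase A j m c = fun x => Complex.exp (Complex.I * ((c * gauge A j m x : ℝ) : ℂ)) from rfl,
    h2.fderiv]
  simp [fderiv_gauge]
  ring

lemma fderiv_phase_mul (c : ℝ) {ζ : Config N → ℂ} (hζ : ContDiff ℝ ∞ ζ) (x : Config N) :
    fderiv ℝ (fun x => phase A j m c x * ζ x) x (unitDir j m)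
      = phase A j m c x * (fderiv ℝ ζ x (unitDir j m) + Complex.I * (c * A (x j) m : ℝ) * ζ x) := by
  rw [fderiv_fun_mul ((contDiff_phase A j m c).differentiable (by simp)).differentiableAt
    (hζ.differentiable (by simp)).differentiableAt]
  simp only [_root_.add_apply, _root_.smul_apply, fderiv_phase,
    smul_eq_mul]
  ring

variable {A j m}

/-- The gauge transformation reduces magnetic derivatives to ordinary distributional ones. -/
lemma hasMagDeriv_iff_isWeakDeriv {u F : Config N → ℂ} :
    HasMagDeriv A j m u F ↔ IsWeakDeriv volume (unitDir j m) (fun x => phase A j m 1 x * u x)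
      (fun x => Complex.I * phase A j m 1 x * F x) := by
  constructor
  · intro h ζ hζ hc
    have := h (fun x => phase A j m 1 x * ζ x) ((contDiff_phase A j m 1).mul hζ) hc.mul_left
    have h2 : ∀ x, Complex.I * phase A j m 1 x * F x * ζ x
        = Complex.I * (F x * (phase A j m 1 x * ζ x)) := fun x => by ring
    simp only [h2]
    rw [integral_const_mul, this, ← integral_const_mul, ← integral_neg]
    refine integral_congr_ae (ae_of_all _ fun x => ?_)
    simp only [partialDeriv]
    rw [← unitDir, fderiv_phase_mul A j m 1 hζ]
    push_cast
    linear_combination (phase A j m 1 x * u x * (fderiv ℝ ζ x (unitDir j m)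
      + Complex.I * A (x j) m * ζ x)) * Complex.I_mul_I
  · intro h η hη hc
    have := h (fun x => phase A j m (-1) x * η x) ((contDiff_phase A j m (-1)).mul hη) hc.mul_left
    have h2 : ∀ x, Complex.I * phase A j m 1 x * F x * (phase A j m (-1) x * η x)
        = Complex.I * (F x * η x) := fun x => by
      linear_combination (Complex.I * (F x * η x)) * phase_neg_mul A j m x
    simp only [h2] at this
    rw [integral_const_mul] at this
    have h3 : ∫ x, F x * η x = -(Complex.I * (Complex.I * ∫ x, F x * η x)) := by
      linear_combination (∫ x, F x * η x) * Complex.I_mul_I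
    rw [h3, this, mul_neg, neg_neg, ← integral_const_mul]
    refine integral_congr_ae (ae_of_all _ fun x => ?_)
    simp only [partialDeriv]
    rw [← unitDir, fderiv_phase_mul A j m (-1) hη]
    push_cast
    linear_combination (Complex.I * u x * (fderiv ℝ η x (unitDir j m)
      - Complex.I * A (x j) m * η x)) * phase_neg_mul A j m x
      - u x * A (x j) m * η x * Complex.I_mul_I

lemma memLp_phase_mul {u : Config N → ℂ} (hu : MemLp u 2 volume) (c : ℝ) :
    MemLp (fun x => phase A j m c x * u x) 2 volume := by
  refine hu.of_le (((contDiff_phase A j m c).continuous.aestronglyMeasurable).mul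
    hu.aestronglyMeasurable) (ae_of_all _ fun x => ?_)
  rw [norm_mul, norm_phase, one_mul]

lemma memLp_I_phase_mul {F : Config N → ℂ} (hF : MemLp F 2 volume) :
    MemLp (fun x => Complex.I * phase A j m 1 x * F x) 2 volume := by
  simpa only [mul_assoc] using (memLp_phase_mul (A := A) (j := j) (m := m) hF 1).const_mul Complex.I

lemma hasMagDeriv_iff_isTransDeriv {u F : Config N → ℂ} (hu : MemLp u 2 volume)
    (hF : MemLp F 2 volume) :
    HasMagDeriv A j m u F ↔ IsTransDeriv volume (unitDir j m) (fun x => phase A j m 1 x * u x)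
      (fun x => Complex.I * phase A j m 1 x * F x) :=
  hasMagDeriv_iff_isWeakDeriv.trans
    ⟨fun h => h.isTransDeriv (memLp_phase_mul hu 1) (memLp_I_phase_mul hF),
      fun h => h.isWeakDeriv (memLp_phase_mul hu 1) (memLp_I_phase_mul hF)⟩

lemma IsTransDeriv.conj {e : Config N} {w g : Config N → ℂ} (h : IsTransDeriv volume e w g) :
    IsTransDeriv volume e (fun x => (starRingEnd ℂ) (w x)) (fun x => (starRingEnd ℂ) (g x)) := by
  intro n
  filter_upwards [h n] with x hx
  rw [← map_sub, hx]
  simp only [intervalIntegral]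
  rw [map_sub, ← integral_conj, ← integral_conj]

/-- The magnetic derivative is symmetric on its maximal domain. -/
lemma HasMagDeriv.symm {u F v G : Config N → ℂ} (hu : MemLp u 2 volume) (hF : MemLp F 2 volume)
    (hv : MemLp v 2 volume) (hG : MemLp G 2 volume) (h1 : HasMagDeriv A j m u F)
    (h2 : HasMagDeriv A j m v G) :
    ∫ x, F x * (starRingEnd ℂ) (v x) = ∫ x, u x * (starRingEnd ℂ) (G x) := by
  have k1 := (hasMagDeriv_iff_isTransDeriv hu hF).1 h1
  have k2 := ((hasMagDeriv_iff_isTransDeriv hv hG).1 h2).conj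
  have key := k1.integral_mul (memLp_phase_mul hu 1) (memLp_I_phase_mul hF)
    (memLp_phase_mul hv 1).star (memLp_I_phase_mul hG).star k2
  have e1 : ∀ x, Complex.I * phase A j m 1 x * F x * (starRingEnd ℂ) (phase A j m 1 x * v x)
      = Complex.I * (F x * (starRingEnd ℂ) (v x)) := fun x => by
    rw [map_mul, conj_phase_one]
    linear_combination (Complex.I * (F x * (starRingEnd ℂ) (v x))) * phase_neg_mul A j m x
  have e2 : ∀ x, phase A j m 1 x * u x * (starRingEnd ℂ) (Complex.I * phase A j m 1 x * G x)
      = -Complex.I * (u x * (starRingEnd ℂ) (G x)) := fun x => by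
    rw [map_mul, map_mul, conj_phase_one, Complex.conj_I]
    linear_combination (-Complex.I * (u x * (starRingEnd ℂ) (G x))) * phase_neg_mul A j m x
  have e3 : ∫ x, Complex.I * (F x * (starRingEnd ℂ) (v x))
      = -∫ x, -Complex.I * (u x * (starRingEnd ℂ) (G x)) := by
    rw [← integral_congr_ae (ae_of_all _ e1), ← integral_congr_ae (ae_of_all _ e2)]
    exact key
  replace key := e3
  rw [integral_const_mul, integral_const_mul, neg_mul, neg_neg] at key
  exact mul_left_cancel₀ Complex.I_ne_zero key

lemma HasMagDeriv.unique {u F F' : Config N → ℂ} (hF : MemLp F 2 volume) (hF' : MemLp F' 2 volume)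
    (h : HasMagDeriv A j m u F) (h' : HasMagDeriv A j m u F') : F =ᵐ[volume] F' := by
  refine ae_eq_of_integral_contDiff_smul_eq (hF.locallyIntegrable (by norm_num))
    (hF'.locallyIntegrable (by norm_num)) fun ζ hζ hc => ?_
  have hη : ContDiff ℝ ∞ fun x => (ζ x : ℂ) := Complex.ofRealCLM.contDiff.comp hζ
  have hcη : HasCompactSupport fun x => (ζ x : ℂ) := hc.comp_left (g := fun r : ℝ => (r : ℂ)) (by simp)
  have := (h _ hη hcη).trans (h' _ hη hcη).symm
  simpa only [Complex.real_smul, mul_comm] using this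

lemma HasMagDeriv.const_mul {u F : Config N → ℂ} (h : HasMagDeriv A j m u F) (c : ℂ) :
    HasMagDeriv A j m (fun x => c * u x) (fun x => c * F x) := fun η hη hc => by
  simp only [mul_assoc]
  rw [integral_const_mul, integral_const_mul, h η hη hc]

/-- Leibniz rule for the magnetic derivative of a product with a smooth real function. -/
lemma HasMagDeriv.smooth_mul {u F : Config N → ℂ} (hu : MemLp u 2 volume) (hF : MemLp F 2 volume)
    (h : HasMagDeriv A j m u F) {G : Config N → ℝ} (hG : ContDiff ℝ ∞ G) :
    HasMagDeriv A j m (fun x => G x * u x)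
      (fun x => G x * F x - Complex.I * (fderiv ℝ G x (unitDir j m) * u x)) := by
  intro η hη hc
  have hGc : ContDiff ℝ ∞ fun x => (G x : ℂ) := Complex.ofRealCLM.contDiff.comp hG
  have hdG : ∀ x, fderiv ℝ (fun x => (G x : ℂ)) x (unitDir j m) = fderiv ℝ G x (unitDir j m) :=
    fun x => by
      have := Complex.ofRealCLM.hasFDerivAt.comp x
        ((hG.differentiable (by simp)).differentiableAt (x := x)).hasFDerivAt
      rw [show (fun x => (G x : ℂ)) = Complex.ofRealCLM ∘ G from rfl, this.fderiv]
      simp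
  have hdGc : ContDiff ℝ ∞ fun x => (fderiv ℝ G x (unitDir j m) : ℂ) :=
    Complex.ofRealCLM.contDiff.comp (contDiff_fderiv_apply hG _)
  have h1 := h (fun x => G x * η x) (hGc.mul hη) hc.mul_left
  have i1 : Integrable (fun x => F x * (G x * η x)) :=
    hF.integrable_mul (memLp_test (hGc.mul hη) hc.mul_left)
  have i2 : Integrable (fun x => Complex.I * (u x * (fderiv ℝ G x (unitDir j m) * η x))) :=
    (hu.integrable_mul (memLp_test (hdGc.mul hη) hc.mul_left)).const_mul _
  have hpd : ∀ x, partialDeriv j m (fun x => G x * η x) x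
      = fderiv ℝ G x (unitDir j m) * η x + G x * partialDeriv j m η x := fun x => by
    simp only [partialDeriv]
    rw [← unitDir, fderiv_fun_mul (hGc.differentiable (by simp)).differentiableAt
      (hη.differentiable (by simp)).differentiableAt]
    simp only [_root_.add_apply, _root_.smul_apply, hdG, smul_eq_mul]
    ring
  have i3 : Integrable (fun x => u x * (Complex.I * partialDeriv j m (fun x => G x * η x) x
      + ((A (x j) m : ℝ) : ℂ) * (G x * η x))) := by
    have hd : ContDiff ℝ ∞ fun x => Complex.I * partialDeriv j m (fun x => G x * η x) x
        + ((A (x j) m : ℝ) : ℂ) * (G x * η x) :=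
      (contDiff_const.mul (contDiff_fderiv_apply (hGc.mul hη) _)).add
        ((Complex.ofRealCLM.contDiff.comp (contDiff_vectorPotential A j m)).mul (hGc.mul hη))
    have hcs : HasCompactSupport fun x => Complex.I * partialDeriv j m (fun x => G x * η x) x
        + ((A (x j) m : ℝ) : ℂ) * (G x * η x) :=
      (((hc.mul_left (f := fun x => (G x : ℂ))).fderiv_apply ℝ _).mul_left).add
        (hc.mul_left.mul_left)
    exact hu.integrable_mul (memLp_test hd hcs)
  calc ∫ x, (G x * F x - Complex.I * (fderiv ℝ G x (unitDir j m) * u x)) * η x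
      = ∫ x, F x * (G x * η x) - Complex.I * (u x * (fderiv ℝ G x (unitDir j m) * η x)) := by
        refine integral_congr_ae (ae_of_all _ fun x => ?_)
        simp only []
        ring
    _ = ∫ x, u x * (Complex.I * partialDeriv j m (fun x => G x * η x) x
          + ((A (x j) m : ℝ) : ℂ) * (G x * η x))
          - Complex.I * (u x * (fderiv ℝ G x (unitDir j m) * η x)) := by
        rw [integral_sub i1 i2, h1, ← integral_sub i3 i2]
    _ = _ := by
        refine integral_congr_ae (ae_of_all _ fun x => ?_)
        simp only [hpd]
        ring

lemma magDeriv_spec {u : Config N → ℂ} (h : ∃ F, MemLp F 2 volume ∧ HasMagDeriv A j m u F) :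
    MemLp (magDeriv A j m u) 2 volume ∧ HasMagDeriv A j m u (magDeriv A j m u) := by
  rw [magDeriv, dif_pos h]
  exact h.choose_spec

lemma magDeriv_ae_eq {u F : Config N → ℂ} (hF : MemLp F 2 volume) (h : HasMagDeriv A j m u F) :
    magDeriv A j m u =ᵐ[volume] F :=
  (magDeriv_spec ⟨F, hF, h⟩).2.unique (magDeriv_spec ⟨F, hF, h⟩).1 hF h

end Gauge

/-! ### Hardy's inequality in the magnetic form domain -/

section Hardy

variable {N : ℕ} {A : Space →ₗ[ℝ] Space} {j : Fin N} {m : Fin 3}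

lemma MemLp.integrable_norm_sq {α : Type*} [MeasurableSpace α] {μ : Measure α} {u : α → ℂ}
    (hu : MemLp u 2 μ) : Integrable (fun x => ‖u x‖ ^ 2) μ :=
  (memLp_two_iff_integrable_sq_norm hu.1).1 hu

lemma memLp_bdd_mul {u : Config N → ℂ} (hu : MemLp u 2 volume) {G : Config N → ℝ}
    (hG : Continuous G) {C : ℝ} (hC : ∀ x, |G x| ≤ C) : MemLp (fun x => (G x : ℂ) * u x) 2 volume := by
  refine MemLp.of_le_mul (c := C) hu
    ((Complex.continuous_ofReal.comp hG).aestronglyMeasurable.mul hu.1) (ae_of_all _ fun x => ?_)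
  rw [norm_mul, Complex.norm_real]
  exact mul_le_mul_of_nonneg_right (hC x) (norm_nonneg _)

lemma integrable_bdd_mul {f G : Config N → ℝ} (hf : Integrable f) (hG : Continuous G)
    {C : ℝ} (hC : ∀ x, |G x| ≤ C) : Integrable fun x => G x * f x :=
  hf.bdd_mul hG.aestronglyMeasurable (ae_of_all _ hC)

lemma memLp_smooth_mul_deriv {u F : Config N → ℂ} (hu : MemLp u 2 volume) (hF : MemLp F 2 volume)
    {G : Config N → ℝ} (hG : ContDiff ℝ ∞ G) {C C' : ℝ}
    (hC : ∀ x, |G x| ≤ C) (hC' : ∀ x, |fderiv ℝ G x (unitDir j m)| ≤ C') :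
    MemLp (fun x => G x * F x - Complex.I * (fderiv ℝ G x (unitDir j m) * u x)) 2 volume :=
  (memLp_bdd_mul hF hG.continuous hC).sub
    ((memLp_bdd_mul hu (contDiff_fderiv_apply hG _).continuous hC').const_mul Complex.I)

/-- The vector potential does not contribute to the derivative of `|u|²`:
`∂_{j,m} |u|² = -2 Im (conj u D_{A,j,m} u)`, tested against a bounded smooth function. -/
lemma HasMagDeriv.integral_norm_sq_mul {u F : Config N → ℂ} (hu : MemLp u 2 volume)
    (hF : MemLp F 2 volume) (h : HasMagDeriv A j m u F) {G : Config N → ℝ} (hG : ContDiff ℝ ∞ G)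
    {C C' : ℝ} (hC : ∀ x, |G x| ≤ C) (hC' : ∀ x, |fderiv ℝ G x (unitDir j m)| ≤ C') :
    ∫ x, fderiv ℝ G x (unitDir j m) * ‖u x‖ ^ 2
      = ∫ x, 2 * (G x * (F x * (starRingEnd ℂ) (u x)).im) := by
  have hv := memLp_bdd_mul hu hG.continuous hC
  have hH := memLp_smooth_mul_deriv hu hF hG hC hC'
  have key := h.symm hu hF hv hH (h.smooth_mul hu hF hG)
  have i1 : Integrable fun x => F x * (starRingEnd ℂ) ((G x : ℂ) * u x) :=
    hF.integrable_mul hv.star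
  have i2 : Integrable fun x => u x * (starRingEnd ℂ)
      (G x * F x - Complex.I * (fderiv ℝ G x (unitDir j m) * u x)) := hu.integrable_mul hH.star
  have i3 : Integrable fun x => F x * (starRingEnd ℂ) (u x) := hF.integrable_mul hu.star
  have i4 : Integrable fun x => G x * (F x * (starRingEnd ℂ) (u x)).im :=
    integrable_bdd_mul i3.im hG.continuous hC
  have i5 : Integrable fun x => fderiv ℝ G x (unitDir j m) * ‖u x‖ ^ 2 :=
    integrable_bdd_mul (MemLp.integrable_norm_sq hu) (contDiff_fderiv_apply hG _).continuous hC'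
  have k2 := congrArg Complex.im key
  rw [← RCLike.im_eq_complex_im, ← integral_im i1, ← integral_im i2] at k2
  have e1 : ∀ x, RCLike.im (F x * (starRingEnd ℂ) ((G x : ℂ) * u x))
      = G x * (F x * (starRingEnd ℂ) (u x)).im := fun x => by
    simp [Complex.mul_im]; ring
  have e2 : ∀ x, RCLike.im (u x * (starRingEnd ℂ)
      (G x * F x - Complex.I * (fderiv ℝ G x (unitDir j m) * u x)))
      = fderiv ℝ G x (unitDir j m) * ‖u x‖ ^ 2 - G x * (F x * (starRingEnd ℂ) (u x)).im := fun x => by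
    rw [Complex.sq_norm, Complex.normSq_apply]
    simp [Complex.mul_im, Complex.mul_re]; ring
  simp only [e1, e2] at k2
  rw [integral_sub i5 i4] at k2
  rw [integral_const_mul]
  linarith

lemma fderiv_eq_of_hasDerivAt_line {f : Config N → ℝ} {x e : Config N} {c : ℝ}
    (hf : DifferentiableAt ℝ f x) (h : HasDerivAt (fun t : ℝ => f (x + t • e)) c 0) :
    fderiv ℝ f x e = c := by
  rw [← hf.lineDeriv_eq_fderiv]
  exact HasLineDerivAt.lineDeriv h

/-- Hardy's inequality with regularised weight `1 / D`, `D = |L x - p|² + δ`. The vector field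
`G = (L x - p) / D` satisfies `1 / D ≤ div G` and `|G|² ≤ 1 / D`, so integration by parts gives
`∫ |u|² / D ≤ 2 ∫ |G| |u| |F|`, and the factor `|G| |u|` is absorbed by Young's
inequality. -/
lemma hardy_regularized {u : Config N → ℂ} {F : Fin 3 → Config N → ℂ} (hu : MemLp u 2 volume)
    (hF : ∀ m, MemLp (F m) 2 volume) (h : ∀ m, HasMagDeriv A j m u (F m))
    (L : Config N →L[ℝ] Space) (hL : ∀ m, L (unitDir j m) = EuclideanSpace.single m (1 : ℝ))
    (p : Space) {δ : ℝ} (hδ : 0 < δ) :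
    Integrable (fun x => ‖u x‖ ^ 2 / (‖L x - p‖ ^ 2 + δ)) ∧
    ∫ x, ‖u x‖ ^ 2 / (‖L x - p‖ ^ 2 + δ) ≤ 4 * ∑ m, ∫ x, ‖F m x‖ ^ 2 := by
  set D : Config N → ℝ := fun x => ‖L x - p‖ ^ 2 + δ with hD
  have hDpos : ∀ x, 0 < D x := fun x => by positivity
  have hDδ : ∀ x, δ ≤ D x := fun x => by simp only [hD]; nlinarith [sq_nonneg ‖L x - p‖]
  have hDs : ContDiff ℝ ∞ D := ((L.contDiff.sub contDiff_const).norm_sq ℝ).add contDiff_const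
  set G : Fin 3 → Config N → ℝ := fun m x => (L x - p) m / D x with hG
  have hGs : ∀ m, ContDiff ℝ ∞ (G m) := fun m => by
    have h1 : ContDiff ℝ ∞ fun x => (L x - p) m := by
      have := L.contDiff (n := ∞)
      fun_prop
    exact h1.div hDs fun x => (hDpos x).ne'
  have hnorm : ∀ x, ‖L x - p‖ ^ 2 = (L x - p) 0 ^ 2 + (L x - p) 1 ^ 2 + (L x - p) 2 ^ 2 := fun x => by
    rw [EuclideanSpace.norm_sq_eq, Fin.sum_univ_three]
    simp [sq_abs]
  have hξ : ∀ x m, (L x - p) m ^ 2 ≤ ‖L x - p‖ ^ 2 := fun x m => by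
    rw [hnorm]
    fin_cases m <;> simp <;> nlinarith [sq_nonneg ((L x - p) 0), sq_nonneg ((L x - p) 1),
      sq_nonneg ((L x - p) 2)]
  have hdG : ∀ m x, fderiv ℝ (G m) x (unitDir j m) = (D x - 2 * (L x - p) m ^ 2) / D x ^ 2 := by
    intro m x
    refine fderiv_eq_of_hasDerivAt_line ((hGs m).differentiable (by simp)).differentiableAt ?_
    have e1 : ∀ t : ℝ, G m (x + t • unitDir j m)
        = ((L x - p) m + t) / (D x + 2 * t * (L x - p) m + t ^ 2) := fun t => by
      have e2 : L (x + t • unitDir j m) - p = (L x - p) + t • EuclideanSpace.single m (1 : ℝ) := by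
        rw [map_add, map_smul, hL]; abel
      have e3 : ‖(L x - p) + t • EuclideanSpace.single m (1 : ℝ)‖ ^ 2
          = ‖L x - p‖ ^ 2 + 2 * t * (L x - p) m + t ^ 2 := by
        rw [norm_add_sq_real, inner_smul_right, EuclideanSpace.inner_single_right, norm_smul]
        simp [sq_abs]
        ring
      simp only [hG, hD, e2, e3]
      congr 1
      · simp
      · ring
    simp only [e1]
    have hn : HasDerivAt (fun t : ℝ => (L x - p) m + t) 1 0 := (hasDerivAt_id (0 : ℝ)).const_add _
    have hd : HasDerivAt (fun t : ℝ => D x + 2 * t * (L x - p) m + t ^ 2) (2 * (L x - p) m) 0 := by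
      have := ((((hasDerivAt_id (0 : ℝ)).const_mul 2).mul_const ((L x - p) m)).const_add (D x)).add
        ((hasDerivAt_id (0 : ℝ)).pow 2)
      refine this.congr_deriv ?_
      simp
    refine (hn.div hd (by simpa using (hDpos x).ne')).congr_deriv ?_
    simp
    ring
  have hGb : ∀ m x, G m x ^ 2 ≤ 1 / D x := fun m x => by
    simp only [hG]
    rw [div_pow, div_le_div_iff₀ (by have := hDpos x; positivity) (hDpos x)]
    have := hξ x m
    have := hDpos x
    have h3 : (L x - p) m ^ 2 ≤ D x := by simp only [hD]; linarith
    nlinarith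
  have hC : ∀ m x, |G m x| ≤ 1 / δ + 1 := fun m x => by
    have h1 := hGb m x
    have h2 : 1 / D x ≤ 1 / δ := one_div_le_one_div_of_le hδ (hDδ x)
    have h3 : 0 < 1 / δ := by positivity
    rw [abs_le]
    constructor <;> nlinarith
  have hC' : ∀ m x, |fderiv ℝ (G m) x (unitDir j m)| ≤ 2 / δ := fun m x => by
    rw [hdG, abs_div, abs_of_pos (pow_pos (hDpos x) 2), div_le_div_iff₀ (pow_pos (hDpos x) 2) hδ]
    have h1 := hξ x m
    have h2 := hDδ x
    have h3 : |D x - 2 * (L x - p) m ^ 2| ≤ 2 * D x := by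
      rw [abs_le]
      constructor <;> simp only [hD] <;> nlinarith [sq_nonneg ((L x - p) m)]
    nlinarith [abs_nonneg (D x - 2 * (L x - p) m ^ 2)]
  have hdivG : ∀ x, 1 / D x ≤ ∑ m, fderiv ℝ (G m) x (unitDir j m) := fun x => by
    simp only [hdG]
    rw [← Finset.sum_div, div_le_div_iff₀ (hDpos x) (pow_pos (hDpos x) 2), Fin.sum_univ_three]
    have h1 := hnorm x
    have h2 : ‖L x - p‖ ^ 2 ≤ D x := by simp only [hD]; linarith
    have := hDpos x
    nlinarith
  have hG2 : ∀ x, ∑ m, G m x ^ 2 ≤ 1 / D x := fun x => by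
    simp only [hG, div_pow]
    rw [← Finset.sum_div, div_le_div_iff₀ (pow_pos (hDpos x) 2) (hDpos x), Fin.sum_univ_three,
      ← hnorm]
    have h2 : ‖L x - p‖ ^ 2 ≤ D x := by simp only [hD]; linarith
    have := hDpos x
    nlinarith
  have iu := MemLp.integrable_norm_sq hu
  have iX : Integrable fun x => ‖u x‖ ^ 2 / D x := by
    have hc : Continuous fun x => 1 / D x :=
      continuous_const.div hDs.continuous fun x => (hDpos x).ne'
    refine (integrable_bdd_mul (C := 1 / δ) iu hc fun x => ?_).congr
      (ae_of_all _ fun x => by simp only []; ring)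
    rw [abs_of_pos (by have := hDpos x; positivity)]
    exact one_div_le_one_div_of_le hδ (hDδ x)
  have iD : ∀ m, Integrable fun x => fderiv ℝ (G m) x (unitDir j m) * ‖u x‖ ^ 2 := fun m =>
    integrable_bdd_mul iu (contDiff_fderiv_apply (hGs m) _).continuous (hC' m)
  have iI : ∀ m, Integrable fun x => 2 * (G m x * (F m x * (starRingEnd ℂ) (u x)).im) := fun m =>
    (integrable_bdd_mul ((hF m).integrable_mul hu.star).im (hGs m).continuous (hC m)).const_mul 2
  have iF : ∀ m, Integrable fun x => ‖F m x‖ ^ 2 := fun m => MemLp.integrable_norm_sq (hF m)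
  refine ⟨iX, ?_⟩
  have step1 : ∫ x, ‖u x‖ ^ 2 / D x
      ≤ ∫ x, ∑ m, 2 * (G m x * (F m x * (starRingEnd ℂ) (u x)).im) := by
    rw [integral_finsetSum _ fun m _ => iI m]
    simp only [← fun m => (h m).integral_norm_sq_mul hu (hF m) (hGs m) (hC m) (hC' m)]
    rw [← integral_finsetSum _ fun m _ => iD m]
    refine integral_mono iX (integrable_finsetSum _ fun m _ => iD m) fun x => ?_
    simp only []
    rw [← Finset.sum_mul, div_eq_mul_one_div, mul_comm]
    exact mul_le_mul_of_nonneg_right (hdivG x) (sq_nonneg _)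
  have step2 : ∫ x, ∑ m, 2 * (G m x * (F m x * (starRingEnd ℂ) (u x)).im)
      ≤ ∫ x, ((1 / 2) * (‖u x‖ ^ 2 / D x) + 2 * ∑ m, ‖F m x‖ ^ 2) := by
    refine integral_mono (integrable_finsetSum _ fun m _ => iI m)
      ((iX.const_mul _).add ((integrable_finsetSum _ fun m _ => iF m).const_mul 2)) fun x => ?_
    have h1 : ∀ m, 2 * (G m x * (F m x * (starRingEnd ℂ) (u x)).im)
        ≤ (1 / 2) * (‖u x‖ ^ 2 * G m x ^ 2) + 2 * ‖F m x‖ ^ 2 := fun m => by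
      have h2 : |(F m x * (starRingEnd ℂ) (u x)).im| ≤ ‖F m x‖ * ‖u x‖ := by
        refine (Complex.abs_im_le_norm _).trans ?_
        rw [norm_mul, RCLike.norm_conj]
      have h3 : G m x * (F m x * (starRingEnd ℂ) (u x)).im ≤ |G m x| * (‖F m x‖ * ‖u x‖) :=
        (le_abs_self _).trans (by rw [abs_mul]; gcongr)
      rw [← sq_abs (G m x)]
      nlinarith [sq_nonneg (‖u x‖ * |G m x| - 2 * ‖F m x‖)]
    have h4 : ∑ m, (1 / 2 : ℝ) * (‖u x‖ ^ 2 * G m x ^ 2) ≤ (1 / 2) * (‖u x‖ ^ 2 / D x) := by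
      rw [← Finset.mul_sum, ← Finset.mul_sum, div_eq_mul_one_div (‖u x‖ ^ 2)]
      have := hG2 x
      gcongr
    calc _ ≤ ∑ m, ((1 / 2) * (‖u x‖ ^ 2 * G m x ^ 2) + 2 * ‖F m x‖ ^ 2) :=
          Finset.sum_le_sum fun m _ => h1 m
      _ ≤ _ := by
        rw [Finset.sum_add_distrib, ← Finset.mul_sum _ (fun m => ‖F m x‖ ^ 2)]
        linarith
  rw [integral_add (iX.const_mul _) ((integrable_finsetSum _ fun m _ => iF m).const_mul 2),
    integral_const_mul, integral_const_mul, integral_finsetSum _ fun m _ => iF m] at step2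
  linarith

/-- Hardy's inequality for the magnetic derivatives with respect to one particle: `L x - p` is the
position of the `j`-th particle relative to a fixed point or to another particle. Where
`L x = p` the integrand is `0` by convention. -/
lemma hardy {u : Config N → ℂ} {F : Fin 3 → Config N → ℂ} (hu : MemLp u 2 volume)
    (hF : ∀ m, MemLp (F m) 2 volume) (h : ∀ m, HasMagDeriv A j m u (F m))
    (L : Config N →L[ℝ] Space) (hL : ∀ m, L (unitDir j m) = EuclideanSpace.single m (1 : ℝ))
    (p : Space) :
    Integrable (fun x => ‖u x‖ ^ 2 / ‖L x - p‖ ^ 2) ∧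
    ∫ x, ‖u x‖ ^ 2 / ‖L x - p‖ ^ 2 ≤ 4 * ∑ m, ∫ x, ‖F m x‖ ^ 2 := by
  set K := 4 * ∑ m, ∫ x, ‖F m x‖ ^ 2 with hK
  have hδ : ∀ n : ℕ, (0 : ℝ) < 1 / ((n : ℝ) + 1) := fun n => by positivity
  have hR := fun n => hardy_regularized hu hF h L hL p (hδ n)
  have hmeas : AEStronglyMeasurable (fun x => ‖u x‖ ^ 2 / ‖L x - p‖ ^ 2) volume := by
    refine AEMeasurable.aestronglyMeasurable ?_
    exact ((hu.1.norm.aemeasurable.pow_const 2).div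
      (((L.continuous.sub continuous_const).norm.pow 2).measurable.aemeasurable))
  have hnn : 0 ≤ᵐ[volume] fun x => ‖u x‖ ^ 2 / ‖L x - p‖ ^ 2 := ae_of_all _ fun x => by positivity
  have hle : ∫⁻ x, ENNReal.ofReal (‖u x‖ ^ 2 / ‖L x - p‖ ^ 2) ≤ ENNReal.ofReal K := by
    calc ∫⁻ x, ENNReal.ofReal (‖u x‖ ^ 2 / ‖L x - p‖ ^ 2)
        ≤ ∫⁻ x, liminf (fun n : ℕ => ENNReal.ofReal
            (‖u x‖ ^ 2 / (‖L x - p‖ ^ 2 + 1 / ((n : ℝ) + 1)))) atTop := by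
          refine lintegral_mono fun x => ?_
          rcases eq_or_ne (‖L x - p‖ ^ 2) 0 with h0 | h0
          · rw [h0, div_zero, ENNReal.ofReal_zero]; exact zero_le
          · have : Tendsto (fun n : ℕ => ENNReal.ofReal
                (‖u x‖ ^ 2 / (‖L x - p‖ ^ 2 + 1 / ((n : ℝ) + 1)))) atTop
                (𝓝 (ENNReal.ofReal (‖u x‖ ^ 2 / ‖L x - p‖ ^ 2))) := by
              refine ENNReal.tendsto_ofReal (tendsto_const_nhds.div ?_ h0)
              simpa using (tendsto_const_nhds (x := ‖L x - p‖ ^ 2)).add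
                (tendsto_one_div_add_atTop_nhds_zero_nat (𝕜 := ℝ))
            exact this.liminf_eq.ge
      _ ≤ liminf (fun n : ℕ => ∫⁻ x, ENNReal.ofReal
            (‖u x‖ ^ 2 / (‖L x - p‖ ^ 2 + 1 / ((n : ℝ) + 1)))) atTop :=
          lintegral_liminf_le' fun n => (hR n).1.aestronglyMeasurable.aemeasurable.ennreal_ofReal
      _ ≤ ENNReal.ofReal K := by
          refine liminf_le_of_le (by isBoundedDefault) fun b hb => ?_
          obtain ⟨n, hn⟩ := hb.exists
          refine hn.trans ?_
          rw [← ofReal_integral_eq_lintegral_ofReal (hR n).1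
            (ae_of_all _ fun x => by have := hδ n; positivity)]
          exact ENNReal.ofReal_le_ofReal (hR n).2
  have hint : Integrable (fun x => ‖u x‖ ^ 2 / ‖L x - p‖ ^ 2) := by
    refine ⟨hmeas, ?_⟩
    rw [hasFiniteIntegral_iff_ofReal hnn]
    exact hle.trans_lt ENNReal.ofReal_lt_top
  refine ⟨hint, ?_⟩
  have hKnn : 0 ≤ K := by positivity
  rwa [← ofReal_integral_eq_lintegral_ofReal hint hnn, ENNReal.ofReal_le_ofReal_iff hKnn] at hle

lemma hardy_point {u : Config N → ℂ} {F : Fin 3 → Config N → ℂ} (hu : MemLp u 2 volume)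
    (hF : ∀ m, MemLp (F m) 2 volume) (h : ∀ m, HasMagDeriv A j m u (F m)) (p : Space) :
    Integrable (fun x => ‖u x‖ ^ 2 / ‖x j - p‖ ^ 2) ∧
    ∫ x, ‖u x‖ ^ 2 / ‖x j - p‖ ^ 2 ≤ 4 * ∑ m, ∫ x, ‖F m x‖ ^ 2 :=
  hardy hu hF h (ContinuousLinearMap.proj j) (fun m => by simp [unitDir]) p

lemma integrable_pair {u : Config N → ℂ} {F : Fin 3 → Config N → ℂ} (hu : MemLp u 2 volume)
    (hF : ∀ m, MemLp (F m) 2 volume) (h : ∀ m, HasMagDeriv A j m u (F m)) {i : Fin N} (hij : j ≠ i) :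
    Integrable (fun x => ‖u x‖ ^ 2 / ‖x j - x i‖) := by
  have h1 := (hardy hu hF h
    (ContinuousLinearMap.proj (R := ℝ) (φ := fun _ : Fin N => Space) j - ContinuousLinearMap.proj i)
    (fun m => by
      change (unitDir j m : Config N) j - (unitDir j m : Config N) i = _
      simp [unitDir, hij.symm]) 0).1
  refine (h1.add (MemLp.integrable_norm_sq hu)).mono' (AEMeasurable.aestronglyMeasurable ?_)
    (ae_of_all _ fun x => ?_)
  · exact (hu.1.norm.aemeasurable.pow_const 2).div (by fun_prop)
  · change _ ≤ ‖u x‖ ^ 2 / ‖x j - x i - 0‖ ^ 2 + ‖u x‖ ^ 2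
    rw [sub_zero]
    rw [Real.norm_of_nonneg (by positivity)]
    rcases eq_or_lt_of_le (norm_nonneg (x j - x i)) with h0 | h0
    · rw [← h0]; simp
    · have : ‖u x‖ ^ 2 / ‖x j - x i‖ = ‖u x‖ ^ 2 * (1 / ‖x j - x i‖) := by ring
      rw [this]
      have h2 : 1 / ‖x j - x i‖ ≤ 1 / ‖x j - x i‖ ^ 2 + 1 := by
        have h3 : 1 / ‖x j - x i‖ ^ 2 = (1 / ‖x j - x i‖) ^ 2 := by rw [div_pow, one_pow]
        rw [h3]; nlinarith [sq_nonneg (1 / ‖x j - x i‖ - 1)]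
      calc _ ≤ ‖u x‖ ^ 2 * (1 / ‖x j - x i‖ ^ 2 + 1) := by gcongr
        _ = _ := by ring

end Hardy

/-! ### Positivity of the Coulomb kernel -/

section CoulombKernel

/-- The Coulomb kernel with values in `[0, ∞]`; it vanishes on the diagonal. -/
noncomputable def coulombKernel (x y : Space) : ENNReal := ENNReal.ofReal (1 / ‖x - y‖)

/-- The Gaussian `exp (-2 t² |x - z|²)` centred at `z`, where `p = (t, z)`. -/
noncomputable def gaussianBump (p : ℝ × Space) (x : Space) : ENNReal :=
  ENNReal.ofReal (Real.exp (-(2 * p.1 ^ 2) * ‖x - p.2‖ ^ 2))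

/-- The weight in the Gaussian decomposition of the Coulomb kernel: `2 / √π` comes from
`1 / r = (2 / √π) ∫ exp (-r² t²) dt` over `t > 0`, and the other factor normalises the integral
over `z` of the product of two Gaussians centred at `z`. -/
noncomputable def gaussianWeight (p : ℝ × Space) : ENNReal :=
  ENNReal.ofReal ((2 / √Real.pi) * ((Real.pi / (4 * p.1 ^ 2)) ^ ((3 : ℝ) / 2))⁻¹)

/-- Lebesgue measure on the set `(0, ∞) × ℝ³` of parameters `(t, z)` of Gaussians. -/
noncomputable def gaussianMeasure : Measure (ℝ × Space) :=
  (volume.restrict (Set.Ioi (0 : ℝ))).prod volume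

instance : SFinite gaussianMeasure := by unfold gaussianMeasure; infer_instance

@[fun_prop]
lemma measurable_gaussianBump {α : Type*} [MeasurableSpace α] {f : α → ℝ × Space} {g : α → Space}
    (hf : Measurable f) (hg : Measurable g) : Measurable fun a => gaussianBump (f a) (g a) := by
  unfold gaussianBump; fun_prop

@[fun_prop]
lemma measurable_gaussianWeight : Measurable gaussianWeight := by
  unfold gaussianWeight; fun_prop

lemma lintegral_gaussian_space {b : ℝ} (hb : 0 < b) (m : Space) :
    ∫⁻ z : Space, ENNReal.ofReal (Real.exp (-b * ‖z - m‖ ^ 2))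
      = ENNReal.ofReal ((Real.pi / b) ^ ((3 : ℝ) / 2)) := by
  have h1 := GaussianFourier.integral_rexp_neg_mul_sq_norm (V := Space) hb
  have h2 : (Module.finrank ℝ Space : ℝ) = 3 := by simp
  rw [h2] at h1
  have hi : Integrable fun v : Space => Real.exp (-b * ‖v‖ ^ 2) := by
    by_contra h
    rw [integral_undef h] at h1
    have : 0 < (Real.pi / b) ^ ((3 : ℝ) / 2) := by positivity
    exact this.ne h1
  rw [lintegral_sub_right_eq_self (fun z : Space => ENNReal.ofReal (Real.exp (-b * ‖z‖ ^ 2))) m,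
    ← ofReal_integral_eq_lintegral_ofReal hi (ae_of_all _ fun _ => (Real.exp_pos _).le), h1]

lemma lintegral_gaussian_Ioi {b : ℝ} (hb : 0 < b) :
    ∫⁻ t in Set.Ioi (0 : ℝ), ENNReal.ofReal (Real.exp (-b * t ^ 2))
      = ENNReal.ofReal (√(Real.pi / b) / 2) := by
  rw [← ofReal_integral_eq_lintegral_ofReal (integrable_exp_neg_mul_sq hb).integrableOn
    (ae_of_all _ fun _ => (Real.exp_pos _).le), integral_gaussian_Ioi]

/-- Decomposition of the Coulomb kernel into products of Gaussians, which shows that it is positive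
definite. -/
lemma coulombKernel_eq {x y : Space} (hxy : x ≠ y) :
    coulombKernel x y
      = ∫⁻ p, gaussianWeight p * (gaussianBump p x * gaussianBump p y) ∂gaussianMeasure := by
  have hr : 0 < ‖x - y‖ := norm_pos_iff.2 (sub_ne_zero.2 hxy)
  have hm : Measurable fun p : ℝ × Space =>
      gaussianWeight p * (gaussianBump p x * gaussianBump p y) := by fun_prop
  rw [gaussianMeasure, lintegral_prod _ hm.aemeasurable]
  have hinner : ∀ t ∈ Set.Ioi (0 : ℝ), ∫⁻ z : Space, gaussianWeight (t, z)
      * (gaussianBump (t, z) x * gaussianBump (t, z) y)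
      = ENNReal.ofReal (2 / √Real.pi) * ENNReal.ofReal (Real.exp (-(‖x - y‖ ^ 2) * t ^ 2)) := by
    intro t ht
    have ht' : (0 : ℝ) < t := ht
    set c := (2 / √Real.pi) * ((Real.pi / (4 * t ^ 2)) ^ ((3 : ℝ) / 2))⁻¹ with hc
    have hprod : ∀ z : Space, gaussianWeight (t, z)
        * (gaussianBump (t, z) x * gaussianBump (t, z) y)
        = ENNReal.ofReal (c * Real.exp (-(‖x - y‖ ^ 2) * t ^ 2))
          * ENNReal.ofReal (Real.exp (-(4 * t ^ 2) * ‖z - (1 / 2 : ℝ) • (x + y)‖ ^ 2)) := by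
      intro z
      rw [show gaussianWeight (t, z) = ENNReal.ofReal c from rfl]
      simp only [gaussianBump]
      rw [← ENNReal.ofReal_mul (Real.exp_pos _).le, ← ENNReal.ofReal_mul (by positivity),
        ← ENNReal.ofReal_mul (by positivity), ← Real.exp_add, mul_assoc c, ← Real.exp_add]
      congr 3
      have e1 := parallelogram_law_with_norm ℝ (x - z) (y - z)
      have e2 : (x - z) + (y - z) = (-2 : ℝ) • (z - (1 / 2 : ℝ) • (x + y)) := by
        module
      have e3 : (x - z) - (y - z) = x - y := by abel
      rw [e2, e3, norm_smul] at e1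
      norm_num [-smul_add] at e1
      linear_combination t ^ 2 * e1
    simp only [hprod]
    rw [lintegral_const_mul _ (by fun_prop), lintegral_gaussian_space (by positivity),
      ← ENNReal.ofReal_mul (by positivity), ← ENNReal.ofReal_mul (by positivity)]
    congr 1
    have : (Real.pi / (4 * t ^ 2)) ^ ((3 : ℝ) / 2) ≠ 0 := by positivity
    rw [hc]; field_simp
  rw [setLIntegral_congr_fun measurableSet_Ioi hinner, lintegral_const_mul _ (by fun_prop),
    lintegral_gaussian_Ioi (by positivity), ← ENNReal.ofReal_mul (by positivity), coulombKernel]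
  congr 1
  rw [Real.sqrt_div Real.pi_pos.le, Real.sqrt_sq hr.le]
  have : √Real.pi ≠ 0 := by positivity
  field_simp

lemma ennreal_two_mul_le (a b : ENNReal) : 2 * (a * b) ≤ a * a + b * b := by
  rcases eq_or_ne a ⊤ with rfl | ha
  · simp
  rcases eq_or_ne b ⊤ with rfl | hb
  · simp
  lift a to NNReal using ha
  lift b to NNReal using hb
  norm_cast
  rw [← NNReal.coe_le_coe]
  push_cast
  nlinarith [sq_nonneg ((a : ℝ) - b)]

/-- The mutual Coulomb energy of two charge densities, with values in `[0, ∞]`. -/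
noncomputable def mutualEnergy (f g : Space → ENNReal) : ENNReal :=
  ∫⁻ x, ∫⁻ y, coulombKernel x y * (f x * g y)

lemma measurable_gaussianAverage {g : Space → ENNReal} (hg : Measurable g) :
    Measurable fun p : ℝ × Space => ∫⁻ y, gaussianBump p y * g y := by
  have : Measurable fun q : (ℝ × Space) × Space => gaussianBump q.1 q.2 * g q.2 := by fun_prop
  exact this.lintegral_prod_right'

lemma mutualEnergy_eq {f g : Space → ENNReal} (hf : Measurable f) (hg : Measurable g) :
    mutualEnergy f g = ∫⁻ p, gaussianWeight p * ((∫⁻ x, gaussianBump p x * f x)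
      * ∫⁻ y, gaussianBump p y * g y) ∂gaussianMeasure := by
  have hint := measurable_gaussianAverage hg
  have step1 : ∀ x, ∫⁻ y, coulombKernel x y * (f x * g y)
      = ∫⁻ p, gaussianWeight p * (gaussianBump p x * f x * ∫⁻ y, gaussianBump p y * g y)
        ∂gaussianMeasure := by
    intro x
    have hne : ∀ᵐ y : Space, x ≠ y := by
      filter_upwards [compl_mem_ae_iff.2 (measure_singleton x)] with y hy hxy
      exact hy (by simp [hxy])
    calc ∫⁻ y, coulombKernel x y * (f x * g y)
        = ∫⁻ y, ∫⁻ p, gaussianWeight p * (gaussianBump p x * f x * (gaussianBump p y * g y))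
            ∂gaussianMeasure := by
          refine lintegral_congr_ae ?_
          filter_upwards [hne] with y hy
          rw [coulombKernel_eq hy, ← lintegral_mul_const _ (by fun_prop)]
          exact lintegral_congr fun p => by ring
      _ = ∫⁻ p, ∫⁻ y, gaussianWeight p * (gaussianBump p x * f x * (gaussianBump p y * g y))
            ∂volume ∂gaussianMeasure := by
          refine lintegral_lintegral_swap (Measurable.aemeasurable ?_)
          unfold Function.uncurry
          fun_prop
      _ = _ := by
          refine lintegral_congr fun p => ?_
          rw [lintegral_const_mul _ (by fun_prop), lintegral_const_mul _ (by fun_prop)]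
  rw [mutualEnergy]
  simp only [step1]
  rw [lintegral_lintegral_swap]
  · refine lintegral_congr fun p => ?_
    rw [lintegral_const_mul _ (by fun_prop), lintegral_mul_const _ (by fun_prop)]
  · refine Measurable.aemeasurable ?_
    have h2 := hint.comp (measurable_snd : Measurable (Prod.snd : Space × (ℝ × Space) → _))
    have h3 : Measurable fun q : Space × (ℝ × Space) =>
      gaussianWeight q.2 * (gaussianBump q.2 q.1 * f q.1) := by fun_prop
    convert h3.mul h2 using 1
    ext q
    simp only [Function.uncurry, Function.comp, Pi.mul_apply]
    ring

/-- The Coulomb kernel is positive definite: by the Gaussian decomposition the mutual energies are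
integrals of products of Gaussian averages of `f` and `g`. -/
lemma two_mul_mutualEnergy_le {f g : Space → ENNReal} (hf : AEMeasurable f volume)
    (hg : AEMeasurable g volume) :
    2 * mutualEnergy f g ≤ mutualEnergy f f + mutualEnergy g g := by
  have hcongr : ∀ {a a' b b' : Space → ENNReal}, a =ᵐ[volume] a' → b =ᵐ[volume] b' →
      mutualEnergy a b = mutualEnergy a' b' := fun {a a' b b'} ha hb => by
    refine lintegral_congr_ae ?_
    filter_upwards [ha] with x hx
    refine lintegral_congr_ae ?_
    filter_upwards [hb] with y hy
    rw [hx, hy]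
  have ef := hf.ae_eq_mk
  have eg := hg.ae_eq_mk
  rw [hcongr ef eg, hcongr ef ef, hcongr eg eg]
  have mf := hf.measurable_mk
  have mg := hg.measurable_mk
  have hF := measurable_gaussianAverage mf
  have hG := measurable_gaussianAverage mg
  rw [mutualEnergy_eq mf mg, mutualEnergy_eq mf mf, mutualEnergy_eq mg mg,
    ← lintegral_const_mul _ (by fun_prop), ← lintegral_add_left (by fun_prop)]
  refine lintegral_mono fun p => ?_
  rw [← mul_add, mul_left_comm]
  gcongr
  exact ennreal_two_mul_le _ _

end CoulombKernel

/-! ### Charge distributions and their Coulomb energy -/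

section Charge

/-- A nonnegative integrable charge density `σ` satisfying Hardy's inequality with constant `K`,
`∫ σ(y) |p - y|⁻² dy ≤ 4 K` for all `p`. Its Coulomb potential is bounded. -/
structure HardyCharge (K : ℝ) (σ : Space → ℝ) : Prop where
  nonneg : ∀ x, 0 ≤ σ x
  integrable : Integrable σ
  integrable_div : ∀ p : Space, Integrable fun y => σ y / ‖p - y‖ ^ 2
  integral_le : ∀ p : Space, ∫ y, σ y / ‖p - y‖ ^ 2 ≤ 4 * K

lemma HardyCharge.zero : HardyCharge 0 fun _ => 0 where
  nonneg _ := le_rfl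
  integrable := integrable_zero _ _ _
  integrable_div p := by simp
  integral_le p := by simp

variable {K K' : ℝ} {σ τ : Space → ℝ}

lemma HardyCharge.indicator (h : HardyCharge K σ) {S : Set Space} (hS : MeasurableSet S) :
    HardyCharge K (S.indicator σ) := by
  have e : ∀ p y : Space, S.indicator σ y / ‖p - y‖ ^ 2
      = S.indicator (fun y => σ y / ‖p - y‖ ^ 2) y := fun p y => by
    by_cases hy : y ∈ S <;> simp [hy]
  refine ⟨fun x => Set.indicator_nonneg (fun y _ => h.nonneg y) x, h.integrable.indicator hS,
    fun p => ?_, fun p => ?_⟩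
  · simp only [e]
    exact (h.integrable_div p).indicator hS
  · simp only [e]
    refine le_trans (integral_mono ((h.integrable_div p).indicator hS) (h.integrable_div p)
      fun y => ?_) (h.integral_le p)
    exact Set.indicator_le_self' (fun y _ => div_nonneg (h.nonneg y) (sq_nonneg _)) y

lemma div_norm_le {a r c : ℝ} (ha : 0 ≤ a) (hc : 0 < c) :
    a / r ≤ c / 2 * a + 1 / (2 * c) * (a / r ^ 2) := by
  rcases eq_or_ne r 0 with rfl | hr
  · simp; positivity
  · have h1 : 1 / r ≤ c / 2 + 1 / (2 * c) * (1 / r) ^ 2 := by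
      have h2 : 0 ≤ 1 / (2 * c) * (1 / r - c) ^ 2 := by positivity
      have h3 : 1 / (2 * c) * (1 / r - c) ^ 2
          = c / 2 + 1 / (2 * c) * (1 / r) ^ 2 - 1 / r := by
        field_simp; ring
      linarith
    calc a / r = a * (1 / r) := by ring
      _ ≤ a * (c / 2 + 1 / (2 * c) * (1 / r) ^ 2) := mul_le_mul_of_nonneg_left h1 ha
      _ = _ := by ring

lemma HardyCharge.integrable_potential (h : HardyCharge K σ) (x : Space) :
    Integrable fun y => σ y / ‖x - y‖ := by
  refine ((h.integrable.const_mul (1 / 2)).add ((h.integrable_div x).const_mul (1 / 2))).mono'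
    ((h.integrable.1.aemeasurable.div (by fun_prop)).aestronglyMeasurable)
    (ae_of_all _ fun y => ?_)
  rw [Real.norm_of_nonneg (div_nonneg (h.nonneg y) (norm_nonneg _))]
  have := div_norm_le (r := ‖x - y‖) (h.nonneg y) one_pos
  norm_num at this ⊢
  exact this

lemma HardyCharge.potential_nonneg (h : HardyCharge K σ) (x : Space) : 0 ≤ coulombPotential σ x :=
  integral_nonneg fun y => div_nonneg (h.nonneg y) (norm_nonneg _)

/-- The potential is bounded by interpolation between the mass and Hardy's inequality; optimising in
`c` gives `2 √(mass K)`. -/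
lemma HardyCharge.potential_le (h : HardyCharge K σ) {c : ℝ} (hc : 0 < c) (x : Space) :
    coulombPotential σ x ≤ c / 2 * (∫ y, σ y) + 2 * K / c := by
  have h1 : coulombPotential σ x
      ≤ ∫ y, (c / 2 * σ y + 1 / (2 * c) * (σ y / ‖x - y‖ ^ 2)) :=
    integral_mono (h.integrable_potential x) ((h.integrable.const_mul _).add
      ((h.integrable_div x).const_mul _)) fun y => div_norm_le (h.nonneg y) hc
  rw [integral_add (h.integrable.const_mul _) ((h.integrable_div x).const_mul _),
    integral_const_mul, integral_const_mul] at h1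
  have h2 : 1 / (2 * c) * ∫ y, σ y / ‖x - y‖ ^ 2 ≤ 1 / (2 * c) * (4 * K) :=
    mul_le_mul_of_nonneg_left (h.integral_le x) (by positivity)
  have h3 : 1 / (2 * c) * (4 * K) = 2 * K / c := by field_simp; ring
  linarith

lemma HardyCharge.exists_potential_le (h : HardyCharge K σ) :
    ∃ M, ∀ x, |coulombPotential σ x| ≤ M :=
  ⟨_, fun x => by rw [abs_of_nonneg (h.potential_nonneg x)]; exact h.potential_le one_pos x⟩

/-- If `σ` has mass at most `m` and `K ≤ S²` then `V_σ ≤ 2 √m S`. -/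
lemma HardyCharge.potential_le_sqrt (h : HardyCharge K σ) {m S : ℝ} (hm : 0 < m) (hS : 0 < S)
    (hσ : ∫ y, σ y ≤ m) (hK : K ≤ S ^ 2) (x : Space) :
    coulombPotential σ x ≤ 2 * √m * S := by
  have hs : 0 < √m := Real.sqrt_pos.2 hm
  have h1 := h.potential_le (c := 2 * S / √m) (by positivity) x
  have h2 : 2 * S / √m / 2 * ∫ y, σ y ≤ 2 * S / √m / 2 * m :=
    mul_le_mul_of_nonneg_left hσ (by positivity)
  have h3 : 2 * S / √m / 2 * m = √m * S := by
    field_simp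
    rw [Real.sq_sqrt hm.le]
  have h4 : 2 * K / (2 * S / √m) ≤ √m * S := by
    rw [div_le_iff₀ (by positivity)]
    have : √m * S * (2 * S / √m) = 2 * S ^ 2 := by field_simp
    rw [this]; linarith
  linarith

lemma HardyCharge.stronglyMeasurable_potential (h : HardyCharge K σ) :
    StronglyMeasurable (coulombPotential σ) := by
  have e : coulombPotential σ = fun x => ∫ y, h.integrable.1.mk σ y / ‖x - y‖ := by
    ext x
    refine integral_congr_ae ?_
    filter_upwards [h.integrable.1.ae_eq_mk] with y hy
    rw [← hy]
  rw [e]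
  have hm := h.integrable.1.stronglyMeasurable_mk.measurable
  refine StronglyMeasurable.integral_prod_right (f := fun x y => h.integrable.1.mk σ y / ‖x - y‖)
    (Measurable.stronglyMeasurable ?_)
  unfold Function.uncurry
  exact (hm.comp measurable_snd).div (by fun_prop)

lemma HardyCharge.integrable_mul_potential (hσ : HardyCharge K σ) (hτ : HardyCharge K' τ) :
    Integrable fun x => σ x * coulombPotential τ x := by
  obtain ⟨M, hM⟩ := hτ.exists_potential_le
  exact hσ.integrable.mul_bdd hτ.stronglyMeasurable_potential.aestronglyMeasurable
    (ae_of_all _ hM)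

lemma HardyCharge.mutualEnergy_eq (hσ : HardyCharge K σ) (hτ : HardyCharge K' τ) :
    mutualEnergy (fun x => ENNReal.ofReal (σ x)) (fun x => ENNReal.ofReal (τ x))
      = ENNReal.ofReal (∫ x, σ x * coulombPotential τ x) := by
  rw [ofReal_integral_eq_lintegral_ofReal (hσ.integrable_mul_potential hτ)
    (ae_of_all _ fun x => mul_nonneg (hσ.nonneg x) (hτ.potential_nonneg x)), mutualEnergy]
  refine lintegral_congr fun x => ?_
  rw [coulombPotential, ENNReal.ofReal_mul (hσ.nonneg x),
    ofReal_integral_eq_lintegral_ofReal (hτ.integrable_potential x)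
      (ae_of_all _ fun y => div_nonneg (hτ.nonneg y) (norm_nonneg _)),
    ← lintegral_const_mul' _ _ ENNReal.ofReal_ne_top]
  refine lintegral_congr fun y => ?_
  rw [coulombKernel, ← ENNReal.ofReal_mul (hσ.nonneg x), ← ENNReal.ofReal_mul (by positivity),
    ← ENNReal.ofReal_mul (hσ.nonneg x)]
  congr 1
  ring

lemma coulombEnergy_eq (σ : Space → ℝ) :
    coulombEnergy σ = 1 / 2 * ∫ x, σ x * coulombPotential σ x := by
  rw [coulombEnergy]
  congr 1
  refine integral_congr_ae (ae_of_all _ fun x => ?_)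
  simp only [coulombPotential]
  rw [← integral_const_mul]
  exact integral_congr_ae (ae_of_all _ fun y => mul_div_assoc _ _ _)

lemma HardyCharge.coulombEnergy_nonneg (h : HardyCharge K σ) : 0 ≤ coulombEnergy σ := by
  rw [coulombEnergy_eq]
  have : 0 ≤ ∫ x, σ x * coulombPotential σ x :=
    integral_nonneg fun x => mul_nonneg (h.nonneg x) (h.potential_nonneg x)
  linarith

/-- The Coulomb energy of `σ - τ` is nonnegative. -/
lemma HardyCharge.integral_mul_potential_le (hσ : HardyCharge K σ) (hτ : HardyCharge K' τ) :
    ∫ x, σ x * coulombPotential τ x ≤ coulombEnergy σ + coulombEnergy τ := by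
  have h := two_mul_mutualEnergy_le hσ.integrable.1.aemeasurable.ennreal_ofReal
    hτ.integrable.1.aemeasurable.ennreal_ofReal
  have n : ∀ {K K' : ℝ} {σ τ : Space → ℝ}, HardyCharge K σ → HardyCharge K' τ →
      0 ≤ ∫ x, σ x * coulombPotential τ x := fun h h' =>
    integral_nonneg fun x => mul_nonneg (h.nonneg x) (h'.potential_nonneg x)
  rw [hσ.mutualEnergy_eq hτ, hσ.mutualEnergy_eq hσ, hτ.mutualEnergy_eq hτ,
    ← ENNReal.ofReal_add (n hσ hσ) (n hτ hτ), two_mul,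
    ← ENNReal.ofReal_add (n hσ hτ) (n hσ hτ),
    ENNReal.ofReal_le_ofReal_iff (add_nonneg (n hσ hσ) (n hτ hτ))] at h
  rw [coulombEnergy_eq, coulombEnergy_eq]
  linarith

lemma HardyCharge.potential_mono (hσ : HardyCharge K σ) (hτ : HardyCharge K' τ)
    (h : ∀ x, σ x ≤ τ x) (x : Space) : coulombPotential σ x ≤ coulombPotential τ x :=
  integral_mono (hσ.integrable_potential x) (hτ.integrable_potential x) fun y => by
    have := h y
    simp only []
    gcongr

/-- Superadditivity of the Coulomb energy on nonnegative densities. -/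
lemma HardyCharge.coulombEnergy_add_le {K'' : ℝ} {ρ : Space → ℝ} (hρ : HardyCharge K'' ρ)
    (hσ : HardyCharge K σ) (hτ : HardyCharge K' τ) (h : ∀ x, σ x + τ x ≤ ρ x) :
    coulombEnergy σ + coulombEnergy τ ≤ coulombEnergy ρ := by
  rw [coulombEnergy_eq, coulombEnergy_eq, coulombEnergy_eq, ← mul_add,
    ← integral_add (hσ.integrable_mul_potential hσ) (hτ.integrable_mul_potential hτ)]
  refine mul_le_mul_of_nonneg_left (integral_mono ((hσ.integrable_mul_potential hσ).add
    (hτ.integrable_mul_potential hτ)) (hρ.integrable_mul_potential hρ) fun x => ?_) (by norm_num)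
  have h1 := hσ.potential_mono hρ (fun y => by linarith [h y, hτ.nonneg y]) x
  have h2 := hτ.potential_mono hρ (fun y => by linarith [h y, hσ.nonneg y]) x
  have h3 := hσ.nonneg x
  have h4 := hτ.nonneg x
  have h5 := hρ.potential_nonneg x
  simp only []
  nlinarith [h x, mul_le_mul_of_nonneg_left h1 h3, mul_le_mul_of_nonneg_left h2 h4,
    mul_le_mul_of_nonneg_right (h x) h5]

lemma HardyCharge.coulombEnergy_le (h : HardyCharge K σ) {c : ℝ} (hc : 0 < c) :
    coulombEnergy σ ≤ 1 / 2 * ((∫ x, σ x) * (c / 2 * (∫ y, σ y) + 2 * K / c)) := by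
  rw [coulombEnergy_eq, ← integral_mul_const]
  refine mul_le_mul_of_nonneg_left (integral_mono (h.integrable_mul_potential h)
    (h.integrable.mul_const _) fun x => ?_) (by norm_num)
  exact mul_le_mul_of_nonneg_left (h.potential_le hc x) (h.nonneg x)

/-- A density supported at distance at least `r` from `x` has potential at most `mass / r` there. -/
lemma HardyCharge.potential_le_of_far (h : HardyCharge K σ) {x : Space} {r : ℝ} (hr : 0 < r)
    (hfar : ∀ y, σ y ≠ 0 → r ≤ ‖x - y‖) : coulombPotential σ x ≤ (∫ y, σ y) / r := by
  rw [← integral_div]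
  refine integral_mono (h.integrable_potential x) (h.integrable.div_const r) fun y => ?_
  rcases eq_or_ne (σ y) 0 with h0 | h0
  · simp [h0]
  · exact div_le_div_of_nonneg_left (h.nonneg y) hr (hfar y h0)

/-- A density supported in a ball has Coulomb energy bounded below in terms of mass and radius. -/
lemma HardyCharge.le_coulombEnergy (h : HardyCharge K σ) {y₀ : Space} {r : ℝ} (hr : 0 < r)
    (hsupp : ∀ y, σ y ≠ 0 → y ∈ Metric.ball y₀ r) :
    (∫ y, σ y) ^ 2 / (4 * r) ≤ coulombEnergy σ := by
  have hV : ∀ x, σ x ≠ 0 → (∫ y, σ y) / (2 * r) ≤ coulombPotential σ x := fun x hx => by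
    rw [← integral_div]
    refine integral_mono_ae (h.integrable.div_const _) (h.integrable_potential x) ?_
    filter_upwards [compl_mem_ae_iff.2 (measure_singleton x)] with y hy
    rcases eq_or_ne (σ y) 0 with h0 | h0
    · simp [h0]
    · refine div_le_div_of_nonneg_left (h.nonneg y) (norm_pos_iff.2 (sub_ne_zero.2 ?_)) ?_
      · rintro rfl; exact hy rfl
      · have h1 := hsupp x hx
        have h2 := hsupp y h0
        rw [Metric.mem_ball] at h1 h2
        rw [← dist_eq_norm]
        have := dist_triangle_right x y y₀
        linarith
  have h1 : ∫ x, σ x * ((∫ y, σ y) / (2 * r)) ≤ ∫ x, σ x * coulombPotential σ x := by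
    refine integral_mono (h.integrable.mul_const _) (h.integrable_mul_potential h) fun x => ?_
    rcases eq_or_ne (σ x) 0 with h0 | h0
    · simp [h0]
    · exact mul_le_mul_of_nonneg_left (hV x h0) (h.nonneg x)
  rw [integral_mul_const] at h1
  rw [coulombEnergy_eq]
  have h2 : (∫ y, σ y) ^ 2 / (4 * r) = 1 / 2 * ((∫ y, σ y) * ((∫ y, σ y) / (2 * r))) := by
    field_simp; ring
  rw [h2]; linarith

end Charge

/-! ### Densities of fermionic wave functions -/

section Density

variable {q N : ℕ}

lemma measurePreserving_insertAt (j : Fin N) :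
    MeasurePreserving (fun p : Space × ({i : Fin N // i ≠ j} → Space) => insertAt j p.1 p.2)
      volume volume := by
  have hm : Measurable
      (fun p : Space × ({i : Fin N // i ≠ j} → Space) => insertAt j p.1 p.2) := by
    refine measurable_pi_lambda _ fun i => ?_
    unfold insertAt
    by_cases h : i = j
    · simp only [h, dite_true]; fun_prop
    · simp only [h, dite_false]; fun_prop
  refine ⟨hm, ?_⟩
  rw [volume_pi]
  refine (Measure.pi_eq fun s hs => ?_).symm
  rw [Measure.map_apply hm (MeasurableSet.univ_pi hs)]
  have : (fun p : Space × ({i : Fin N // i ≠ j} → Space) => insertAt j p.1 p.2) ⁻¹' Set.univ.pi s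
      = s j ×ˢ Set.univ.pi fun i : {i : Fin N // i ≠ j} => s i := by
    ext p
    simp only [Set.mem_preimage, Set.mem_pi, Set.mem_univ, forall_true_left, Set.mem_prod,
      Subtype.forall]
    constructor
    · intro h
      refine ⟨by simpa [insertAt] using h j, fun i hi => ?_⟩
      have := h i
      simpa [insertAt, hi] using this
    · rintro ⟨h1, h2⟩ i
      by_cases hi : i = j
      · subst hi; simpa [insertAt] using h1
      · simpa [insertAt, hi] using h2 i hi
  rw [this, Measure.volume_eq_prod, Measure.prod_prod, volume_pi, Measure.pi_pi,
    ← Fintype.prod_eq_mul_prod_subtype_ne (fun i => volume (s i)) j]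

lemma insertAt_self (j : Fin N) (x : Space) (z : {i : Fin N // i ≠ j} → Space) :
    insertAt j x z j = x := by simp [insertAt]

/-- Integrals against the density are expectations of the corresponding one-body observable. -/
lemma integral_mul_density {Ψ : WaveFn q N} {f : Space → ℝ}
    (hf : ∀ j s, Integrable fun x : Config N => f (x j) * ‖Ψ s x‖ ^ 2) :
    (Integrable fun x => f x * density Ψ x) ∧
    ∫ x, f x * density Ψ x = ∑ j, ∑ s, ∫ x : Config N, f (x j) * ‖Ψ s x‖ ^ 2 := by
  have hI : ∀ j s, Integrable (fun p : Space × ({i : Fin N // i ≠ j} → Space) =>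
      f p.1 * ‖Ψ s (insertAt j p.1 p.2)‖ ^ 2) (volume.prod volume) := fun j s => by
    have := (measurePreserving_insertAt j).integrable_comp_of_integrable (hf j s)
    simp only [Function.comp_def, insertAt_self] at this
    exact this
  have hI2 : ∀ j s, Integrable fun x : Space =>
      f x * ∫ z : {i : Fin N // i ≠ j} → Space, ‖Ψ s (insertAt j x z)‖ ^ 2 := fun j s => by
    simpa only [integral_const_mul] using (hI j s).integral_prod_left
  have hval : ∀ j s, ∫ x : Config N, f (x j) * ‖Ψ s x‖ ^ 2 = ∫ x : Space,
      f x * ∫ z : {i : Fin N // i ≠ j} → Space, ‖Ψ s (insertAt j x z)‖ ^ 2 := fun j s => by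
    have h1 := (measurePreserving_insertAt j).map_eq
    have h2 : AEStronglyMeasurable (fun x : Config N => f (x j) * ‖Ψ s x‖ ^ 2)
        (Measure.map (fun p : Space × ({i : Fin N // i ≠ j} → Space) => insertAt j p.1 p.2)
          volume) := by
      rw [h1]; exact (hf j s).1
    rw [← h1, integral_map (measurePreserving_insertAt j).measurable.aemeasurable h2]
    simp only [insertAt_self]
    rw [Measure.volume_eq_prod, integral_prod _ (hI j s)]
    simp only [integral_const_mul]
  have e : (fun x => f x * density Ψ x) = fun x => ∑ j, ∑ s,
      f x * ∫ z : {i : Fin N // i ≠ j} → Space, ‖Ψ s (insertAt j x z)‖ ^ 2 := by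
    ext x
    simp only [density, Finset.mul_sum]
  rw [e]
  refine ⟨integrable_finsetSum _ fun j _ => integrable_finsetSum _ fun s _ => hI2 j s, ?_⟩
  rw [integral_finsetSum _ fun j _ => integrable_finsetSum _ fun s _ => hI2 j s]
  refine Finset.sum_congr rfl fun j _ => ?_
  rw [integral_finsetSum _ fun s _ => hI2 j s]
  exact Finset.sum_congr rfl fun s _ => (hval j s).symm

lemma density_nonneg (Ψ : WaveFn q N) (x : Space) : 0 ≤ density Ψ x :=
  Finset.sum_nonneg fun _ _ => Finset.sum_nonneg fun _ _ => integral_nonneg fun _ => sq_nonneg _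

lemma IsFermionic.integrable_density {Ψ : WaveFn q N} (h : IsFermionic Ψ) :
    Integrable (density Ψ) ∧ ∫ x, density Ψ x = N * normSq Ψ := by
  have := integral_mul_density (Ψ := Ψ) (f := fun _ => 1)
    (fun j s => by simpa using MemLp.integrable_norm_sq (h.memLp s))
  simpa [normSq] using this

end Density

/-! ### Form bounds and the ground state energy -/

section GroundState

variable {q N : ℕ} {A : Space →ₗ[ℝ] Space} {Φ : WaveFn q N}

lemma kinetic_eq {F : (Fin N → Fin q) → Fin N → Fin 3 → Config N → ℂ}
    (hF : ∀ s j m, MemLp (F s j m) 2 volume) (h : ∀ s j m, HasMagDeriv A j m (Φ s) (F s j m)) :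
    kinetic A Φ = ∑ s, ∑ j, ∑ m, ∫ x, ‖F s j m x‖ ^ 2 := by
  refine Finset.sum_congr rfl fun s _ => Finset.sum_congr rfl fun j _ =>
    Finset.sum_congr rfl fun m _ => integral_congr_ae ?_
  filter_upwards [magDeriv_ae_eq (hF s j m) (h s j m)] with x hx
  rw [hx]

lemma kinetic_nonneg (A : Space →ₗ[ℝ] Space) (Φ : WaveFn q N) : 0 ≤ kinetic A Φ :=
  Finset.sum_nonneg fun _ _ => Finset.sum_nonneg fun _ _ => Finset.sum_nonneg fun _ _ =>
    integral_nonneg fun _ => sq_nonneg _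

lemma repulsion_nonneg (Φ : WaveFn q N) : 0 ≤ repulsion Φ :=
  Finset.sum_nonneg fun _ _ => Finset.sum_nonneg fun _ _ => Finset.sum_nonneg fun _ _ =>
    integral_nonneg fun _ => by positivity

lemma normSq_nonneg (Φ : WaveFn q N) : 0 ≤ normSq Φ :=
  Finset.sum_nonneg fun _ _ => integral_nonneg fun _ => sq_nonneg _

lemma InFormDomain.memLp_magDeriv (h : InFormDomain A Φ) (s : Fin N → Fin q) (j : Fin N)
    (m : Fin 3) : MemLp (magDeriv A j m (Φ s)) 2 volume :=
  (magDeriv_spec (h.deriv_memLp s j m)).1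

lemma InFormDomain.hasMagDeriv (h : InFormDomain A Φ) (s : Fin N → Fin q) (j : Fin N)
    (m : Fin 3) : HasMagDeriv A j m (Φ s) (magDeriv A j m (Φ s)) :=
  (magDeriv_spec (h.deriv_memLp s j m)).2

/-- Hardy's inequality, summed over the particles. -/
lemma InFormDomain.hardyCharge (h : InFormDomain A Φ) :
    HardyCharge (kinetic A Φ) (density Φ) := by
  have hh := fun s j p => hardy_point (h.fermionic.memLp s) (h.memLp_magDeriv s j)
    (h.hasMagDeriv s j) p
  have hd := fun p : Space => integral_mul_density (Ψ := Φ) (f := fun y => 1 / ‖p - y‖ ^ 2)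
    (fun j s => ((hh s j p).1).congr (ae_of_all _ fun x => by
      simp only []; rw [norm_sub_rev p]; ring))
  have e : ∀ p y : Space, density Φ y / ‖p - y‖ ^ 2 = 1 / ‖p - y‖ ^ 2 * density Φ y :=
    fun p y => by ring
  refine ⟨density_nonneg Φ, h.fermionic.integrable_density.1, fun p => ?_, fun p => ?_⟩
  · simp only [e]; exact (hd p).1
  · simp only [e]
    rw [(hd p).2, Finset.sum_comm, kinetic, Finset.mul_sum]
    refine Finset.sum_le_sum fun s _ => ?_
    rw [Finset.mul_sum]
    refine Finset.sum_le_sum fun j _ => le_trans (le_of_eq ?_) (hh s j p).2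
    refine integral_congr_ae (ae_of_all _ fun x => ?_)
    simp only []; rw [norm_sub_rev p]; ring

/-- The self-attraction is controlled by half of the kinetic energy. -/
lemma InFormDomain.coulombEnergy_density_le (h : InFormDomain A Φ) (hn : normSq Φ = 1) :
    coulombEnergy (density Φ) ≤ kinetic A Φ / 2 + (N : ℝ) ^ 2 * (N + 1) / 2 := by
  have hN : (0 : ℝ) ≤ N := Nat.cast_nonneg N
  -- with this `c` the kinetic energy enters with the factor `N / (2 * (N + 1)) ≤ 1 / 2`
  have h1 := h.hardyCharge.coulombEnergy_le (c := 2 * (N + 1)) (by positivity)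
  rw [h.fermionic.integrable_density.2, hn, mul_one] at h1
  have hK := kinetic_nonneg A Φ
  have h2 : (N : ℝ) * (2 * kinetic A Φ / (2 * (N + 1))) ≤ kinetic A Φ := by
    have h3 : (N : ℝ) * (2 * kinetic A Φ / (2 * (N + 1))) = N / (N + 1) * kinetic A Φ := by
      field_simp
    rw [h3]
    exact mul_le_of_le_one_left hK ((div_le_one (by positivity)).2 (by linarith))
  nlinarith

lemma InFormDomain.kinetic_le (h : InFormDomain A Φ) (hn : normSq Φ = 1) :
    kinetic A Φ ≤ 2 * energy A Φ + (N : ℝ) ^ 2 * (N + 1) := by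
  have h1 := h.coulombEnergy_density_le hn
  have h2 := repulsion_nonneg Φ
  rw [energy]; linarith

lemma bddBelow_energy (A : Space →ₗ[ℝ] Space) (q N : ℕ) :
    BddBelow {e | ∃ Ψ : WaveFn q N, InFormDomain A Ψ ∧ normSq Ψ = 1 ∧ energy A Ψ = e} := by
  refine ⟨-((N : ℝ) ^ 2 * (N + 1)) / 2, ?_⟩
  rintro e ⟨Ψ, h, hn, rfl⟩
  have := h.kinetic_le hn
  have := kinetic_nonneg A Ψ
  linarith

lemma InFormDomain.groundEnergy_le (h : InFormDomain A Φ) (hn : normSq Φ = 1) :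
    groundEnergy A q N ≤ energy A Φ :=
  csInf_le (bddBelow_energy A q N) ⟨Φ, h, hn, rfl⟩

/-- The vacuum has energy `0`; the convention `sInf ∅ = 0` makes it unnecessary to exhibit the
normalised vacuum state. -/
lemma groundEnergy_zero (A : Space →ₗ[ℝ] Space) (q : ℕ) : groundEnergy A q 0 = 0 := by
  have h0 : ∀ Ψ : WaveFn q 0, energy A Ψ = 0 := fun Ψ => by
    have : density Ψ = fun _ => 0 := by ext x; simp [density]
    simp [energy, kinetic, repulsion, coulombEnergy, this]
  rw [groundEnergy]
  rcases Set.eq_empty_or_nonempty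
    {e | ∃ Ψ : WaveFn q 0, InFormDomain A Ψ ∧ normSq Ψ = 1 ∧ energy A Ψ = e} with h | h
  · rw [h, Real.sInf_empty]
  · have : {e | ∃ Ψ : WaveFn q 0, InFormDomain A Ψ ∧ normSq Ψ = 1 ∧ energy A Ψ = e} = {0} := by
      refine (Set.Nonempty.subset_singleton_iff h).1 ?_
      rintro e ⟨Ψ, _, _, rfl⟩
      exact h0 Ψ
    rw [this, csInf_singleton]

/-- The pointwise multiple `c Φ`. -/
def scale (c : ℝ) (Φ : WaveFn q N) : WaveFn q N := fun s x => c * Φ s x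

lemma norm_scale_sq (c : ℝ) (Φ : WaveFn q N) (s : Fin N → Fin q) (x : Config N) :
    ‖scale c Φ s x‖ ^ 2 = c ^ 2 * ‖Φ s x‖ ^ 2 := by
  rw [scale, norm_mul, mul_pow, Complex.norm_real, Real.norm_eq_abs, sq_abs]

lemma InFormDomain.scale (h : InFormDomain A Φ) (c : ℝ) : InFormDomain A (scale c Φ) where
  fermionic :=
    { memLp := fun s => (h.fermionic.memLp s).const_mul _
      antisymm := fun π s => by
        filter_upwards [h.fermionic.antisymm π s] with x hx
        simp only [Polaron.scale]
        rw [hx]; ring }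
  deriv_memLp s j m := ⟨_, (h.memLp_magDeriv s j m).const_mul (c : ℂ),
    (h.hasMagDeriv s j m).const_mul c⟩

lemma InFormDomain.kinetic_scale (h : InFormDomain A Φ) (c : ℝ) :
    kinetic A (Polaron.scale c Φ) = c ^ 2 * kinetic A Φ := by
  rw [kinetic_eq (Φ := Polaron.scale c Φ) (fun s j m => (h.memLp_magDeriv s j m).const_mul (c : ℂ))
    (fun s j m => (h.hasMagDeriv s j m).const_mul c), kinetic]
  simp only [Finset.mul_sum, ← integral_const_mul, norm_mul, mul_pow, Complex.norm_real,
    Real.norm_eq_abs, sq_abs]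

lemma normSq_scale (c : ℝ) (Φ : WaveFn q N) : normSq (scale c Φ) = c ^ 2 * normSq Φ := by
  simp only [normSq, norm_scale_sq, integral_const_mul, Finset.mul_sum]

lemma repulsion_scale (c : ℝ) (Φ : WaveFn q N) :
    repulsion (scale c Φ) = c ^ 2 * repulsion Φ := by
  simp only [repulsion, norm_scale_sq, mul_div_assoc, integral_const_mul, Finset.mul_sum]

lemma density_scale (c : ℝ) (Φ : WaveFn q N) (x : Space) :
    density (scale c Φ) x = c ^ 2 * density Φ x := by
  simp only [density, norm_scale_sq, integral_const_mul, Finset.mul_sum]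

lemma integrable_potential_mul {K : ℝ} {σ : Space → ℝ} (hσ : HardyCharge K σ) {u : Config N → ℂ}
    (hu : MemLp u 2 volume) (j : Fin N) :
    Integrable fun x : Config N => coulombPotential σ (x j) * ‖u x‖ ^ 2 := by
  obtain ⟨M, hM⟩ := hσ.exists_potential_le
  exact (MemLp.integrable_norm_sq hu).bdd_mul
    (hσ.stronglyMeasurable_potential.comp_measurable (measurable_pi_apply j)).aestronglyMeasurable
    (ae_of_all _ fun x => hM _)

lemma IsFermionic.sum_integral_potential (h : IsFermionic Φ) {K : ℝ} {σ : Space → ℝ}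
    (hσ : HardyCharge K σ) :
    ∑ s, ∑ j, ∫ x : Config N, coulombPotential σ (x j) * ‖Φ s x‖ ^ 2
      = ∫ x, density Φ x * coulombPotential σ x := by
  simp only [mul_comm (density Φ _)]
  rw [Finset.sum_comm]
  exact (integral_mul_density fun j s => integrable_potential_mul hσ (h.memLp s) j).2.symm

/-- Completing the square: for every nonnegative `σ` the linear Hamiltonian `H_σ` lies above the
nonlinear functional, because the Coulomb energy of `ρ_Φ - σ` is nonnegative. -/
lemma InFormDomain.groundEnergy_mul_le (h : InFormDomain A Φ) {K : ℝ} {σ : Space → ℝ}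
    (hσ : HardyCharge K σ) : groundEnergy A q N * normSq Φ ≤ hamiltonianForm A σ Φ := by
  rcases eq_or_ne (normSq Φ) 0 with h0 | h0
  · have hz : ∀ s, ∀ᵐ x, ‖Φ s x‖ ^ 2 = 0 := fun s => by
      have h1 := (Finset.sum_eq_zero_iff_of_nonneg fun s _ =>
        integral_nonneg fun x : Config N => sq_nonneg ‖Φ s x‖).1 h0 s (Finset.mem_univ s)
      exact (integral_eq_zero_iff_of_nonneg (fun x => sq_nonneg ‖Φ s x‖)
        (MemLp.integrable_norm_sq (h.fermionic.memLp s))).1 h1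
    have hV : ∑ s, ∑ j, ∫ x : Config N, coulombPotential σ (x j) * ‖Φ s x‖ ^ 2 = 0 :=
      Finset.sum_eq_zero fun s _ => Finset.sum_eq_zero fun j _ =>
        integral_eq_zero_of_ae (by filter_upwards [hz s] with x hx; simp [hx])
    rw [hamiltonianForm, hV, h0]
    have := kinetic_nonneg A Φ
    have := repulsion_nonneg Φ
    linarith
  · have hn : 0 < normSq Φ := lt_of_le_of_ne (normSq_nonneg Φ) h0.symm
    set n := normSq Φ with hndef
    set c := (√n)⁻¹ with hc
    have hc2 : c ^ 2 = n⁻¹ := by rw [hc, inv_pow, Real.sq_sqrt hn.le]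
    have h1 := h.scale c
    have hn1 : normSq (Polaron.scale c Φ) = 1 := by
      rw [normSq_scale, hc2, ← hndef, inv_mul_cancel₀ h0]
    have h2 := h1.groundEnergy_le hn1
    rw [energy, h.kinetic_scale, repulsion_scale, hc2] at h2
    have h3 := h1.hardyCharge.integral_mul_potential_le hσ
    have h4 : ∫ x, density (Polaron.scale c Φ) x * coulombPotential σ x
        = n⁻¹ * ∫ x, density Φ x * coulombPotential σ x := by
      simp only [density_scale, hc2, mul_assoc]
      exact integral_const_mul _ _
    rw [h4] at h3
    rw [hamiltonianForm, h.fermionic.sum_integral_potential hσ]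
    have h5 : groundEnergy A q N ≤ n⁻¹ * kinetic A Φ + n⁻¹ * repulsion Φ
        - n⁻¹ * (∫ x, density Φ x * coulombPotential σ x) + coulombEnergy σ := by linarith
    calc groundEnergy A q N * n ≤ (n⁻¹ * kinetic A Φ + n⁻¹ * repulsion Φ
        - n⁻¹ * (∫ x, density Φ x * coulombPotential σ x) + coulombEnergy σ) * n :=
          mul_le_mul_of_nonneg_right h5 hn.le
      _ = _ := by rw [← hndef]; field_simp; ring

lemma IsMinimizingSeq.bddAbove_formNorm {Ψ : ℕ → WaveFn q N} (h : IsMinimizingSeq A Ψ) :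
    BddAbove (Set.range fun k => formNorm A (Ψ k)) := by
  obtain ⟨B, hB⟩ := h.tendsto.bddAbove_range
  refine ⟨√(1 + (2 * B + (N : ℝ) ^ 2 * (N + 1))), ?_⟩
  rintro _ ⟨k, rfl⟩
  simp only [formNorm]
  refine Real.sqrt_le_sqrt ?_
  have h1 := (h.mem k).kinetic_le (h.normalized k)
  have h2 : energy A (Ψ k) ≤ B := hB ⟨k, rfl⟩
  rw [h.normalized k]; linarith

end GroundState

/-! ### Slicing a wave function into clusters -/

section Slices

variable {q N k l : ℕ}

/-- The family indexed by `Fin N ≃ Fin k ⊕ Fin l` that is `x` on the first and `z` on the second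
cluster. -/
def glue {α : Type*} (ε : Fin k ⊕ Fin l ≃ Fin N) (x : Fin k → α) (z : Fin l → α) : Fin N → α :=
  fun i => Sum.elim x z (ε.symm i)

@[simp] lemma glue_inl {α : Type*} (ε : Fin k ⊕ Fin l ≃ Fin N) (x : Fin k → α) (z : Fin l → α)
    (i : Fin k) : glue ε x z (ε (Sum.inl i)) = x i := by simp [glue]

/-- A permutation of the first cluster as a permutation of all particles. -/
def liftPerm (ε : Fin k ⊕ Fin l ≃ Fin N) (π : Equiv.Perm (Fin k)) : Equiv.Perm (Fin N) :=
  ε.permCongr (Equiv.Perm.sumCongr π 1)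

lemma sign_liftPerm (ε : Fin k ⊕ Fin l ≃ Fin N) (π : Equiv.Perm (Fin k)) :
    Equiv.Perm.sign (liftPerm ε π) = Equiv.Perm.sign π := by
  rw [liftPerm, Equiv.Perm.sign_permCongr, Equiv.Perm.sign_sumCongr]
  simp

lemma glue_comp_liftPerm {α : Type*} (ε : Fin k ⊕ Fin l ≃ Fin N) (π : Equiv.Perm (Fin k))
    (x : Fin k → α) (z : Fin l → α) : glue ε x z ∘ liftPerm ε π = glue ε (x ∘ π) z := by
  ext i
  simp only [glue, liftPerm, Function.comp, Equiv.permCongr_apply, Equiv.symm_apply_apply]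
  rcases ε.symm i with a | a <;> simp

lemma measurePreserving_glue (ε : Fin k ⊕ Fin l ≃ Fin N) :
    MeasurePreserving (fun p : Config l × Config k => glue ε p.2 p.1)
      (volume.prod volume) (volume : Measure (Config N)) := by
  have hm : Measurable (fun p : Config l × Config k => glue ε p.2 p.1) := by
    refine measurable_pi_lambda _ fun i => ?_
    unfold glue
    rcases ε.symm i with a | a <;> simp <;> fun_prop
  refine ⟨hm, ?_⟩
  rw [volume_pi]
  refine (Measure.pi_eq fun s hs => ?_).symm
  rw [Measure.map_apply hm (MeasurableSet.univ_pi hs)]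
  have : (fun p : Config l × Config k => glue ε p.2 p.1) ⁻¹' Set.univ.pi s
      = (Set.univ.pi fun i => s (ε (Sum.inr i))) ×ˢ Set.univ.pi fun i => s (ε (Sum.inl i)) := by
    ext p
    simp only [Set.mem_preimage, Set.mem_pi, Set.mem_univ, forall_true_left, Set.mem_prod]
    constructor
    · intro h
      exact ⟨fun i => by simpa [glue] using h (ε (Sum.inr i)),
        fun i => by simpa [glue] using h (ε (Sum.inl i))⟩
    · rintro ⟨h1, h2⟩ i
      obtain ⟨a, rfl⟩ := ε.surjective i
      rcases a with a | a
      · simpa [glue] using h2 a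
      · simpa [glue] using h1 a
  rw [this, Measure.prod_prod]
  simp only [volume_pi]
  rw [Measure.pi_pi, Measure.pi_pi, ← Equiv.prod_comp ε, Fintype.prod_sum_type, mul_comm]

lemma sum_glue {α M : Type*} [Fintype α] [DecidableEq α] [AddCommMonoid M]
    (ε : Fin k ⊕ Fin l ≃ Fin N) (f : (Fin N → α) → M) :
    ∑ s, f s = ∑ s'' : Fin l → α, ∑ s' : Fin k → α, f (glue ε s' s'') := by
  rw [Finset.sum_comm, ← Fintype.sum_prod_type']
  refine (Fintype.sum_equiv ((Equiv.sumArrowEquivProdArrow (Fin k) (Fin l) α).symm.trans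
    (Equiv.arrowCongr ε (Equiv.refl α))) _ _ fun p => ?_).symm
  rfl

lemma integral_glue (ε : Fin k ⊕ Fin l ≃ Fin N) {f : Config N → ℝ} (hf : Integrable f) :
    (∀ᵐ z : Config l, Integrable fun x : Config k => f (glue ε x z)) ∧
    (Integrable fun z : Config l => ∫ x : Config k, f (glue ε x z)) ∧
    ∫ x, f x = ∫ z : Config l, ∫ x : Config k, f (glue ε x z) := by
  have hmp := measurePreserving_glue ε
  have hI := hmp.integrable_comp_of_integrable hf
  refine ⟨hI.prod_right_ae, hI.integral_prod_left, ?_⟩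
  have h2 : AEStronglyMeasurable f (Measure.map (fun p : Config l × Config k => glue ε p.2 p.1)
      (volume.prod volume)) := by rw [hmp.map_eq]; exact hf.1
  rw [← hmp.map_eq, integral_map hmp.measurable.aemeasurable h2]
  exact integral_prod _ hI

lemma ae_glue (ε : Fin k ⊕ Fin l ≃ Fin N) {p : Config N → Prop} (h : ∀ᵐ x, p x) :
    ∀ᵐ z : Config l, ∀ᵐ x : Config k, p (glue ε x z) :=
  Measure.ae_ae_of_ae_prod ((measurePreserving_glue ε).quasiMeasurePreserving.ae h)

lemma memLp_glue (ε : Fin k ⊕ Fin l ≃ Fin N) {u : Config N → ℂ} (hu : MemLp u 2 volume) :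
    ∀ᵐ z : Config l, MemLp (fun x : Config k => u (glue ε x z)) 2 volume := by
  have h1 := (hu.1.comp_measurePreserving (measurePreserving_glue ε)).prodMk_left
  filter_upwards [h1, (integral_glue ε (MemLp.integrable_norm_sq hu)).1] with z h2 h3
  exact (memLp_two_iff_integrable_sq_norm h2).2 h3

lemma glue_add_unitDir (ε : Fin k ⊕ Fin l ≃ Fin N) (x : Config k) (z : Config l) (i : Fin k)
    (m : Fin 3) (t : ℝ) : glue ε x z + t • unitDir (ε (Sum.inl i)) m
      = glue ε (x + t • unitDir i m) z := by
  ext1 b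
  obtain ⟨a, rfl⟩ := ε.surjective b
  rcases a with a | a
  · by_cases h : a = i
    · subst h; simp [glue, unitDir]
    · simp [glue, unitDir, h]
  · simp [glue, unitDir]

lemma phase_glue (A : Space →ₗ[ℝ] Space) (ε : Fin k ⊕ Fin l ≃ Fin N) (x : Config k) (z : Config l)
    (i : Fin k) (m : Fin 3) (c : ℝ) :
    phase A (ε (Sum.inl i)) m c (glue ε x z) = phase A i m c x := by
  simp [phase, gauge]

/-- Magnetic derivatives pass to almost every slice. -/
lemma hasMagDeriv_glue {A : Space →ₗ[ℝ] Space} (ε : Fin k ⊕ Fin l ≃ Fin N) {u F : Config N → ℂ}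
    (hu : MemLp u 2 volume) (hF : MemLp F 2 volume) {i : Fin k} {m : Fin 3}
    (h : HasMagDeriv A (ε (Sum.inl i)) m u F) :
    ∀ᵐ z : Config l, HasMagDeriv A i m (fun x => u (glue ε x z)) (fun x => F (glue ε x z)) := by
  have h1 := (hasMagDeriv_iff_isTransDeriv hu hF).1 h
  have h2 := ae_all_iff.2 fun n => ae_glue ε (h1 n)
  filter_upwards [h2, memLp_glue ε hu, memLp_glue ε hF] with z hz hzu hzF
  refine (hasMagDeriv_iff_isTransDeriv hzu hzF).2 fun n => ?_
  filter_upwards [hz n] with x hx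
  simpa only [glue_add_unitDir, phase_glue] using hx

end Slices

/-! ### Lower bound for two separated clusters -/

section Cluster

variable {q N k l : ℕ} {A : Space →ₗ[ℝ] Space}

/-- Linearity of the integral for the terms of a cluster Hamiltonian. -/
lemma integral_cluster_terms {α ι κ : Type*} [MeasurableSpace α] {μ : Measure α} [Fintype ι]
    [Fintype κ] {f₁ : ι → κ → α → ℝ} {f₂ : ι → α → ℝ} {f₃ : ι → ι → α → ℝ} {f₄ : α → ℝ}
    {T : ι → Finset ι} (h₁ : ∀ i m, Integrable (f₁ i m) μ) (h₂ : ∀ i, Integrable (f₂ i) μ)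
    (h₃ : ∀ i, ∀ j ∈ T i, Integrable (f₃ i j) μ) (h₄ : Integrable f₄ μ) (c : ℝ) :
    Integrable (fun x => (∑ i, ∑ m, f₁ i m x) - (∑ i, f₂ i x) + (∑ i, ∑ j ∈ T i, f₃ i j x)
      + c * f₄ x) μ ∧
    ∫ x, ((∑ i, ∑ m, f₁ i m x) - (∑ i, f₂ i x) + (∑ i, ∑ j ∈ T i, f₃ i j x) + c * f₄ x) ∂μ
      = (∑ i, ∑ m, ∫ x, f₁ i m x ∂μ) - (∑ i, ∫ x, f₂ i x ∂μ)
        + (∑ i, ∑ j ∈ T i, ∫ x, f₃ i j x ∂μ) + c * ∫ x, f₄ x ∂μ := by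
  have j1 : Integrable (fun x => ∑ i, ∑ m, f₁ i m x) μ := integrable_finsetSum Finset.univ fun i _ =>
    integrable_finsetSum Finset.univ fun m _ => h₁ i m
  have j2 : Integrable (fun x => ∑ i, f₂ i x) μ := integrable_finsetSum Finset.univ fun i _ => h₂ i
  have j3 : Integrable (fun x => ∑ i, ∑ j ∈ T i, f₃ i j x) μ :=
    integrable_finsetSum Finset.univ fun i _ => integrable_finsetSum (T i) fun j hj => h₃ i j hj
  have j12 : Integrable (fun x => (∑ i, ∑ m, f₁ i m x) - (∑ i, f₂ i x)) μ := j1.sub j2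
  have j123 : Integrable (fun x => (∑ i, ∑ m, f₁ i m x) - (∑ i, f₂ i x)
    + (∑ i, ∑ j ∈ T i, f₃ i j x)) μ := j12.add j3
  refine ⟨j123.add (h₄.const_mul c), ?_⟩
  rw [integral_add j123 (h₄.const_mul c), integral_add j12 j3, integral_sub j1 j2,
    integral_const_mul, integral_finsetSum _ fun i _ => h₂ i,
    integral_finsetSum _ fun i _ => integrable_finsetSum _ fun m _ => h₁ i m,
    integral_finsetSum _ fun i _ => integrable_finsetSum _ fun j hj => h₃ i j hj]
  congr 3
  · exact Finset.sum_congr rfl fun i _ => integral_finsetSum _ fun m _ => h₁ i m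
  · exact funext fun i => integral_finsetSum _ fun j hj => h₃ i j hj

lemma hamiltonianForm_sub_eq {Φ : WaveFn q k} (h : InFormDomain A Φ)
    {F : (Fin k → Fin q) → Fin k → Fin 3 → Config k → ℂ}
    (hF : ∀ s j m, MemLp (F s j m) 2 volume) (hD : ∀ s j m, HasMagDeriv A j m (Φ s) (F s j m))
    {K : ℝ} {σ : Space → ℝ} (hσ : HardyCharge K σ) (c : ℝ) :
    hamiltonianForm A σ Φ - c * normSq Φ = ∑ s, ∫ x,
      ((∑ i, ∑ m, ‖F s i m x‖ ^ 2) - (∑ i, coulombPotential σ (x i) * ‖Φ s x‖ ^ 2)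
        + (∑ i, ∑ j ∈ Finset.Ioi i, ‖Φ s x‖ ^ 2 / ‖x i - x j‖)
        + (coulombEnergy σ - c) * ‖Φ s x‖ ^ 2) := by
  have i1 : ∀ s i m, Integrable fun x => ‖F s i m x‖ ^ 2 := fun s i m =>
    MemLp.integrable_norm_sq (hF s i m)
  have i2 : ∀ s i, Integrable fun x : Config k => coulombPotential σ (x i) * ‖Φ s x‖ ^ 2 :=
    fun s i => integrable_potential_mul hσ (h.fermionic.memLp s) i
  have i3 : ∀ s i, ∀ j ∈ Finset.Ioi i, Integrable fun x : Config k => ‖Φ s x‖ ^ 2 / ‖x i - x j‖ :=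
    fun s i j hj => integrable_pair (h.fermionic.memLp s) (hF s i) (hD s i)
      (Finset.mem_Ioi.1 hj).ne
  have i4 : ∀ s, Integrable fun x => ‖Φ s x‖ ^ 2 := fun s =>
    MemLp.integrable_norm_sq (h.fermionic.memLp s)
  have e := fun s => (integral_cluster_terms (i1 s) (i2 s) (i3 s) (i4 s)
    (coulombEnergy σ - c)).2
  simp only [e, Finset.sum_add_distrib, Finset.sum_sub_distrib, ← Finset.mul_sum]
  rw [hamiltonianForm, kinetic_eq hF hD, repulsion, normSq]
  ring

/-- Energy of a cluster: if `Φ` is antisymmetric in the particles of the first cluster, freezing the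
others gives `k`-particle wave functions, so the cluster Hamiltonian is bounded below by the
`k`-particle ground state energy. -/
lemma cluster_bound (ε : Fin k ⊕ Fin l ≃ Fin N) {Φ : WaveFn q N}
    (hΦ : ∀ s, MemLp (Φ s) 2 volume) {F : (Fin N → Fin q) → Fin N → Fin 3 → Config N → ℂ}
    (hF : ∀ s j m, MemLp (F s j m) 2 volume) (hD : ∀ s j m, HasMagDeriv A j m (Φ s) (F s j m))
    (hanti : ∀ (π : Equiv.Perm (Fin k)) (s : Fin N → Fin q), ∀ᵐ x : Config N,
      Φ (s ∘ liftPerm ε π) (x ∘ liftPerm ε π) = ((Equiv.Perm.sign π : ℤ) : ℂ) * Φ s x)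
    {K : ℝ} {σ : Space → ℝ} (hσ : HardyCharge K σ) :
    groundEnergy A q k * normSq Φ ≤
      ∑ s, ((∑ i : Fin k, ∑ m, ∫ x, ‖F s (ε (Sum.inl i)) m x‖ ^ 2)
        - (∑ i : Fin k, ∫ x : Config N, coulombPotential σ (x (ε (Sum.inl i))) * ‖Φ s x‖ ^ 2)
        + (∑ i : Fin k, ∑ j ∈ Finset.Ioi i,
          ∫ x : Config N, ‖Φ s x‖ ^ 2 / ‖x (ε (Sum.inl i)) - x (ε (Sum.inl j))‖))
        + coulombEnergy σ * normSq Φ := by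
  have i1 : ∀ s (i : Fin k) m, Integrable fun x => ‖F s (ε (Sum.inl i)) m x‖ ^ 2 := fun s i m =>
    MemLp.integrable_norm_sq (hF s _ m)
  have i2 : ∀ s (i : Fin k), Integrable
      fun x : Config N => coulombPotential σ (x (ε (Sum.inl i))) * ‖Φ s x‖ ^ 2 :=
    fun s i => integrable_potential_mul hσ (hΦ s) _
  have i3 : ∀ s (i : Fin k), ∀ j ∈ Finset.Ioi i, Integrable
      fun x : Config N => ‖Φ s x‖ ^ 2 / ‖x (ε (Sum.inl i)) - x (ε (Sum.inl j))‖ :=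
    fun s i j hj => integrable_pair (hΦ s) (hF s _) (hD s _) fun h =>
      (Finset.mem_Ioi.1 hj).ne (Sum.inl_injective (ε.injective h))
  have i4 : ∀ s, Integrable fun x => ‖Φ s x‖ ^ 2 := fun s => MemLp.integrable_norm_sq (hΦ s)
  set c := groundEnergy A q k with hc
  set L : (Fin N → Fin q) → Config N → ℝ := fun s x =>
    (∑ i : Fin k, ∑ m, ‖F s (ε (Sum.inl i)) m x‖ ^ 2)
      - (∑ i : Fin k, coulombPotential σ (x (ε (Sum.inl i))) * ‖Φ s x‖ ^ 2)
      + (∑ i : Fin k, ∑ j ∈ Finset.Ioi i,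
        ‖Φ s x‖ ^ 2 / ‖x (ε (Sum.inl i)) - x (ε (Sum.inl j))‖)
      + (coulombEnergy σ - c) * ‖Φ s x‖ ^ 2 with hL
  have hLi : ∀ s, Integrable (L s) := fun s =>
    (integral_cluster_terms (i1 s) (i2 s) (i3 s) (i4 s) (coulombEnergy σ - c)).1
  have e := fun s => (integral_cluster_terms (i1 s) (i2 s) (i3 s) (i4 s) (coulombEnergy σ - c)).2
  suffices hmain : 0 ≤ ∑ s, ∫ x, L s x by
    simp only [hL, e] at hmain
    rw [Finset.sum_add_distrib, ← Finset.mul_sum] at hmain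
    rw [normSq]
    linarith
  rw [sum_glue ε]
  refine Finset.sum_nonneg fun s'' _ => ?_
  rw [Finset.sum_congr rfl fun s' _ => (integral_glue ε (hLi (glue ε s' s''))).2.2,
    ← integral_finsetSum _ fun s' _ => (integral_glue ε (hLi (glue ε s' s''))).2.1]
  refine integral_nonneg_of_ae ?_
  have a1 := ae_all_iff.2 fun s' : Fin k → Fin q => memLp_glue ε (hΦ (glue ε s' s''))
  have a2 := ae_all_iff.2 fun s' : Fin k → Fin q => ae_all_iff.2 fun i : Fin k =>
    ae_all_iff.2 fun m => memLp_glue ε (hF (glue ε s' s'') (ε (Sum.inl i)) m)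
  have a3 := ae_all_iff.2 fun s' : Fin k → Fin q => ae_all_iff.2 fun i : Fin k =>
    ae_all_iff.2 fun m => hasMagDeriv_glue ε (hΦ (glue ε s' s''))
      (hF (glue ε s' s'') (ε (Sum.inl i)) m) (hD (glue ε s' s'') (ε (Sum.inl i)) m)
  have a4 := ae_all_iff.2 fun π : Equiv.Perm (Fin k) => ae_all_iff.2 fun s' : Fin k → Fin q =>
    ae_glue ε (hanti π (glue ε s' s''))
  filter_upwards [a1, a2, a3, a4] with z h1 h2 h3 h4
  set φ : WaveFn q k := fun s' x => Φ (glue ε s' s'') (glue ε x z) with hφ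
  have hdom : InFormDomain A φ :=
    { fermionic := ⟨h1, fun π s' => by
        filter_upwards [h4 π s'] with x hx
        rw [glue_comp_liftPerm, glue_comp_liftPerm] at hx
        exact hx⟩
      deriv_memLp := fun s' i m => ⟨_, h2 s' i m, h3 s' i m⟩ }
  have key := hdom.groundEnergy_mul_le hσ
  have key2 := hamiltonianForm_sub_eq hdom h2 h3 hσ c
  simp only [hL, glue_inl]
  change (0 : ℝ) ≤ _
  rw [← key2]
  linarith

end Cluster

/-! ### Rearrangement of the potential energy -/

section Regions

variable {q N k l : ℕ} {A : Space →ₗ[ℝ] Space}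

lemma two_mul_sum_Ioi {n : ℕ} {g : Fin n → Fin n → ℝ} (hs : ∀ i j, g i j = g j i)
    (h0 : ∀ i, g i i = 0) : 2 * ∑ i, ∑ j ∈ Finset.Ioi i, g i j = ∑ i, ∑ j, g i j := by
  have h1 : ∀ i, ∑ j, g i j = ∑ j ∈ Finset.Ioi i, g i j + ∑ j ∈ Finset.Iio i, g i j := fun i => by
    have hd : Disjoint (Finset.Ioi i) (Finset.Iio i) := by
      rw [Finset.disjoint_left]; intro j h1 h2
      exact absurd (Finset.mem_Ioi.1 h1) (not_lt.2 (Finset.mem_Iio.1 h2).le)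
    rw [← Finset.sum_union hd]
    refine (Finset.sum_subset (Finset.subset_univ _) fun j _ hj => ?_).symm
    rw [Finset.mem_union, Finset.mem_Ioi, Finset.mem_Iio, not_or, not_lt, not_lt] at hj
    rw [le_antisymm hj.1 hj.2, h0]
  have h2 : ∑ i, ∑ j ∈ Finset.Iio i, g i j = ∑ i, ∑ j ∈ Finset.Ioi i, g i j := by
    rw [Finset.sum_comm' (t' := Finset.univ) (s' := fun j => Finset.Ioi j) (by simp)]
    exact Finset.sum_congr rfl fun i _ => Finset.sum_congr rfl fun j _ => hs j i
  simp only [h1]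
  rw [Finset.sum_add_distrib, h2]
  ring

/-- Dropping the repulsion between two clusters. -/
lemma sum_Ioi_clusters_le (ε : Fin k ⊕ Fin l ≃ Fin N) {g : Fin N → Fin N → ℝ}
    (hs : ∀ i j, g i j = g j i) (h0 : ∀ i, g i i = 0) (hg : ∀ i j, 0 ≤ g i j) :
    (∑ i : Fin k, ∑ j ∈ Finset.Ioi i, g (ε (Sum.inl i)) (ε (Sum.inl j)))
      + ∑ i : Fin l, ∑ j ∈ Finset.Ioi i, g (ε (Sum.inr i)) (ε (Sum.inr j))
      ≤ ∑ i, ∑ j ∈ Finset.Ioi i, g i j := by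
  have e1 := two_mul_sum_Ioi (g := fun i j : Fin k => g (ε (Sum.inl i)) (ε (Sum.inl j)))
    (fun i j => hs _ _) fun i => h0 _
  have e2 := two_mul_sum_Ioi (g := fun i j : Fin l => g (ε (Sum.inr i)) (ε (Sum.inr j)))
    (fun i j => hs _ _) fun i => h0 _
  have e3 := two_mul_sum_Ioi hs h0
  have e4 : ∑ i, ∑ j, g i j = (∑ i : Fin k, ∑ j : Fin k, g (ε (Sum.inl i)) (ε (Sum.inl j)))
      + (∑ i : Fin k, ∑ j : Fin l, g (ε (Sum.inl i)) (ε (Sum.inr j)))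
      + ((∑ i : Fin l, ∑ j : Fin k, g (ε (Sum.inr i)) (ε (Sum.inl j)))
      + (∑ i : Fin l, ∑ j : Fin l, g (ε (Sum.inr i)) (ε (Sum.inr j)))) := by
    rw [← Equiv.sum_comp ε, Fintype.sum_sum_type]
    simp only [← Equiv.sum_comp ε (fun j => g _ j), Fintype.sum_sum_type, Finset.sum_add_distrib]
  have n1 : 0 ≤ ∑ i : Fin k, ∑ j : Fin l, g (ε (Sum.inl i)) (ε (Sum.inr j)) :=
    Finset.sum_nonneg fun _ _ => Finset.sum_nonneg fun _ _ => hg _ _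
  have n2 : 0 ≤ ∑ i : Fin l, ∑ j : Fin k, g (ε (Sum.inr i)) (ε (Sum.inl j)) :=
    Finset.sum_nonneg fun _ _ => Finset.sum_nonneg fun _ _ => hg _ _
  linarith

/-- If `Φ` is antisymmetric within two complementary clusters, and if on the support of `Φ` the
potential of `ρ` acts on the clusters like those of `σ₁` and `σ₂` up to an error `b`, then the
Hamiltonian decouples. -/
lemma two_cluster_bound (ε : Fin k ⊕ Fin l ≃ Fin N) {Φ : WaveFn q N}
    (hΦ : ∀ s, MemLp (Φ s) 2 volume)
    (hD : ∀ s j m, ∃ F, MemLp F 2 volume ∧ HasMagDeriv A j m (Φ s) F)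
    (h₁ : ∀ (π : Equiv.Perm (Fin k)) (s : Fin N → Fin q), ∀ᵐ x : Config N,
      Φ (s ∘ liftPerm ε π) (x ∘ liftPerm ε π) = ((Equiv.Perm.sign π : ℤ) : ℂ) * Φ s x)
    (h₂ : ∀ (π : Equiv.Perm (Fin l)) (s : Fin N → Fin q), ∀ᵐ x : Config N,
      Φ (s ∘ liftPerm ((Equiv.sumComm _ _).trans ε) π)
        (x ∘ liftPerm ((Equiv.sumComm _ _).trans ε) π) = ((Equiv.Perm.sign π : ℤ) : ℂ) * Φ s x)
    {K K₁ K₂ b D₀ : ℝ} {ρ σ₁ σ₂ : Space → ℝ} (hρ : HardyCharge K ρ) (hσ₁ : HardyCharge K₁ σ₁)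
    (hσ₂ : HardyCharge K₂ σ₂)
    (hV₁ : ∀ s x, Φ s x ≠ 0 → ∀ i, coulombPotential ρ (x (ε (Sum.inl i)))
      ≤ coulombPotential σ₁ (x (ε (Sum.inl i))) + b)
    (hV₂ : ∀ s x, Φ s x ≠ 0 → ∀ i, coulombPotential ρ (x (ε (Sum.inr i)))
      ≤ coulombPotential σ₂ (x (ε (Sum.inr i))) + b)
    (hD₀ : coulombEnergy σ₁ + coulombEnergy σ₂ + D₀ ≤ coulombEnergy ρ) :
    (groundEnergy A q k + groundEnergy A q l + D₀ - N * b) * normSq Φ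
      ≤ hamiltonianForm A ρ Φ := by
  have hF : ∀ s j m, MemLp (magDeriv A j m (Φ s)) 2 volume := fun s j m =>
    (magDeriv_spec (hD s j m)).1
  have hF' : ∀ s j m, HasMagDeriv A j m (Φ s) (magDeriv A j m (Φ s)) := fun s j m =>
    (magDeriv_spec (hD s j m)).2
  have c1 := cluster_bound ε hΦ hF hF' h₁ hσ₁
  have c2 := cluster_bound ((Equiv.sumComm _ _).trans ε) hΦ hF hF' h₂ hσ₂
  simp only [Equiv.trans_apply, Equiv.sumComm_apply, Sum.swap_inl] at c2
  have hn := normSq_nonneg Φ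
  have kin : kinetic A Φ
      = (∑ s, ∑ i : Fin k, ∑ m, ∫ x, ‖magDeriv A (ε (Sum.inl i)) m (Φ s) x‖ ^ 2)
      + ∑ s, ∑ i : Fin l, ∑ m, ∫ x, ‖magDeriv A (ε (Sum.inr i)) m (Φ s) x‖ ^ 2 := by
    rw [kinetic, ← Finset.sum_add_distrib]
    refine Finset.sum_congr rfl fun s _ => ?_
    rw [← Equiv.sum_comp ε, Fintype.sum_sum_type]
  have potb : ∀ s (j : Fin N) {σ : Space → ℝ} {K' : ℝ}, HardyCharge K' σ →
      (∀ x, Φ s x ≠ 0 → coulombPotential ρ (x j) ≤ coulombPotential σ (x j) + b) →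
      ∫ x : Config N, coulombPotential ρ (x j) * ‖Φ s x‖ ^ 2
        ≤ (∫ x : Config N, coulombPotential σ (x j) * ‖Φ s x‖ ^ 2) + b * ∫ x, ‖Φ s x‖ ^ 2 := by
    intro s j σ K' hσ hb
    have i1 := integrable_potential_mul hσ (hΦ s) j
    have i2 := (MemLp.integrable_norm_sq (hΦ s)).const_mul b
    rw [← integral_const_mul, ← integral_add i1 i2]
    refine integral_mono (integrable_potential_mul hρ (hΦ s) j) (i1.add i2) fun x => ?_
    rcases eq_or_ne (Φ s x) 0 with h0 | h0
    · simp [h0]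
    · simp only []
      rw [← add_mul]
      exact mul_le_mul_of_nonneg_right (hb x h0) (sq_nonneg _)
  have pot : ∑ s, ∑ j, ∫ x : Config N, coulombPotential ρ (x j) * ‖Φ s x‖ ^ 2
      ≤ (∑ s, ∑ i : Fin k, ∫ x : Config N,
          coulombPotential σ₁ (x (ε (Sum.inl i))) * ‖Φ s x‖ ^ 2)
        + (∑ s, ∑ i : Fin l, ∫ x : Config N,
          coulombPotential σ₂ (x (ε (Sum.inr i))) * ‖Φ s x‖ ^ 2) + N * b * normSq Φ := by
    rw [normSq, Finset.mul_sum, ← Finset.sum_add_distrib, ← Finset.sum_add_distrib]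
    refine Finset.sum_le_sum fun s _ => ?_
    rw [← Equiv.sum_comp ε, Fintype.sum_sum_type]
    have b1 := Finset.sum_le_sum fun i (_ : i ∈ (Finset.univ : Finset (Fin k))) =>
      potb s (ε (Sum.inl i)) hσ₁ fun x hx => hV₁ s x hx i
    have b2 := Finset.sum_le_sum fun i (_ : i ∈ (Finset.univ : Finset (Fin l))) =>
      potb s (ε (Sum.inr i)) hσ₂ fun x hx => hV₂ s x hx i
    rw [Finset.sum_add_distrib, Finset.sum_const, Finset.card_univ, Fintype.card_fin,
      nsmul_eq_mul] at b1 b2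
    have hN : (N : ℝ) = k + l := by
      have := Fintype.card_congr ε
      simp only [Fintype.card_sum, Fintype.card_fin] at this
      rw [← this]; push_cast; ring
    rw [hN]
    linarith
  have rep : (∑ s, ∑ i : Fin k, ∑ j ∈ Finset.Ioi i,
        ∫ x : Config N, ‖Φ s x‖ ^ 2 / ‖x (ε (Sum.inl i)) - x (ε (Sum.inl j))‖)
      + ∑ s, ∑ i : Fin l, ∑ j ∈ Finset.Ioi i,
        ∫ x : Config N, ‖Φ s x‖ ^ 2 / ‖x (ε (Sum.inr i)) - x (ε (Sum.inr j))‖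
      ≤ repulsion Φ := by
    rw [repulsion, ← Finset.sum_add_distrib]
    refine Finset.sum_le_sum fun s _ => ?_
    refine sum_Ioi_clusters_le ε (g := fun i j => ∫ x : Config N, ‖Φ s x‖ ^ 2 / ‖x i - x j‖)
      (fun i j => ?_) (fun i => by simp) fun i j => integral_nonneg fun x => by positivity
    simp only [norm_sub_rev]
  rw [Finset.sum_add_distrib, Finset.sum_sub_distrib] at c1 c2
  rw [hamiltonianForm]
  have hD' := mul_le_mul_of_nonneg_right hD₀ hn
  linarith

end Regions

/-! ### The IMS localisation formula -/

section Localization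

variable {q N : ℕ} {A : Space →ₗ[ℝ] Space}

/-- Localisation functions on one-particle space: `χ² + χ'² = 1` with gradients bounded by `δ`. -/
structure CutoffPair (δ : ℝ) (χ χ' : Space → ℝ) : Prop where
  smooth : ContDiff ℝ ∞ χ
  smooth' : ContDiff ℝ ∞ χ'
  sq_add_sq : ∀ x, χ x ^ 2 + χ' x ^ 2 = 1
  deriv_le : ∀ x m, |fderiv ℝ χ x (EuclideanSpace.single m (1 : ℝ))| ≤ δ
  deriv_le' : ∀ x m, |fderiv ℝ χ' x (EuclideanSpace.single m (1 : ℝ))| ≤ δ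

/-- The member of the partition of unity that localises the particles in `a` inside and the
others outside. -/
noncomputable def locFn (χ χ' : Space → ℝ) (a : Finset (Fin N)) (x : Config N) : ℝ :=
  ∏ j, (if j ∈ a then χ else χ') (x j)

variable {δ : ℝ} {χ χ' : Space → ℝ}

lemma sum_locFn_sq (h : CutoffPair δ χ χ') (x : Config N) :
    ∑ a : Finset (Fin N), locFn χ χ' a x ^ 2 = 1 := by
  have h1 := Finset.prod_add (fun j => χ (x j) ^ 2) (fun j => χ' (x j) ^ 2)
    (Finset.univ : Finset (Fin N))
  simp only [h.sq_add_sq, Finset.prod_const_one, Finset.powerset_univ] at h1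
  rw [h1]
  refine Finset.sum_congr rfl fun a _ => ?_
  rw [locFn, ← Finset.prod_pow, ← Finset.prod_mul_prod_compl a, ← Finset.compl_eq_univ_sdiff]
  congr 1
  · exact Finset.prod_congr rfl fun j hj => by simp [hj]
  · exact Finset.prod_congr rfl fun j hj => by simp [Finset.mem_compl.1 hj]

lemma CutoffPair.contDiff_ite (h : CutoffPair δ χ χ') (p : Prop) [Decidable p] :
    ContDiff ℝ ∞ (if p then χ else χ') := by
  split_ifs
  exacts [h.smooth, h.smooth']

lemma CutoffPair.abs_ite_le (h : CutoffPair δ χ χ') (p : Prop) [Decidable p] (x : Space) :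
    |(if p then χ else χ') x| ≤ 1 := by
  have := h.sq_add_sq x
  rw [← sq_le_one_iff_abs_le_one]
  split_ifs <;> nlinarith [sq_nonneg (χ x), sq_nonneg (χ' x)]

lemma contDiff_locFn (h : CutoffPair δ χ χ') (a : Finset (Fin N)) :
    ContDiff ℝ ∞ (locFn χ χ' a) := by
  unfold locFn
  exact contDiff_prod fun j _ => (h.contDiff_ite (j ∈ a)).comp (contDiff_apply ℝ Space j)

lemma abs_locFn_le (h : CutoffPair δ χ χ') (a : Finset (Fin N)) (x : Config N) :
    |locFn χ χ' a x| ≤ 1 := by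
  rw [locFn, Finset.abs_prod]
  exact Finset.prod_le_one (fun _ _ => abs_nonneg _) fun j _ => h.abs_ite_le _ _

lemma abs_fderiv_locFn_le (h : CutoffPair δ χ χ') (a : Finset (Fin N)) (x : Config N) (j : Fin N)
    (m : Fin 3) : |fderiv ℝ (locFn χ χ' a) x (unitDir j m)| ≤ δ := by
  set c := ∏ i ∈ Finset.univ.erase j, (if i ∈ a then χ else χ') (x i) with hc
  have hline : ∀ t : ℝ, locFn χ χ' a (x + t • unitDir j m)
      = (if j ∈ a then χ else χ') (x j + t • EuclideanSpace.single m (1 : ℝ)) * c := fun t => by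
    rw [locFn, ← Finset.mul_prod_erase _ _ (Finset.mem_univ j), coord_shift]
    congr 1
    refine Finset.prod_congr rfl fun i hi => ?_
    have : (x + t • unitDir j m) i = x i := by
      simp [unitDir, Finset.ne_of_mem_erase hi]
    rw [this]
  have hd : HasDerivAt (fun t : ℝ => locFn χ χ' a (x + t • unitDir j m))
      (fderiv ℝ (if j ∈ a then χ else χ') (x j) (EuclideanSpace.single m (1 : ℝ)) * c) 0 := by
    simp only [hline]
    refine HasDerivAt.mul_const ?_ c
    have h0 : HasDerivAt (fun s : ℝ => x j + s • EuclideanSpace.single m (1 : ℝ))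
        (EuclideanSpace.single m (1 : ℝ)) 0 := by
      simpa using ((hasDerivAt_id (0 : ℝ)).smul_const
        (EuclideanSpace.single m (1 : ℝ))).const_add (x j)
    have := ((h.contDiff_ite (j ∈ a)).differentiable (by simp)).differentiableAt
      (x := x j + (0 : ℝ) • EuclideanSpace.single m (1 : ℝ)) |>.hasFDerivAt.comp_hasDerivAt
        (0 : ℝ) h0
    rw [zero_smul, add_zero] at this
    exact this
  rw [fderiv_eq_of_hasDerivAt_line ((contDiff_locFn h a).differentiable (by simp)).differentiableAt
    hd, abs_mul]
  have hc1 : |c| ≤ 1 := by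
    rw [hc, Finset.abs_prod]
    exact Finset.prod_le_one (fun _ _ => abs_nonneg _) fun j _ => h.abs_ite_le _ _
  have hd1 : |fderiv ℝ (if j ∈ a then χ else χ') (x j) (EuclideanSpace.single m (1 : ℝ))| ≤ δ := by
    split_ifs
    exacts [h.deriv_le _ _, h.deriv_le' _ _]
  calc _ ≤ δ * 1 := mul_le_mul hd1 hc1 (abs_nonneg _) ((abs_nonneg _).trans hd1)
    _ = δ := mul_one δ

/-- The cross terms in the localisation formula cancel. -/
lemma sum_locFn_mul_fderiv (h : CutoffPair δ χ χ') (x : Config N) (j : Fin N) (m : Fin 3) :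
    ∑ a, locFn χ χ' a x * fderiv ℝ (locFn χ χ' a) x (unitDir j m) = 0 := by
  have h1 : fderiv ℝ (fun x : Config N => ∑ a, locFn χ χ' a x ^ 2) x (unitDir j m) = 0 := by
    simp only [sum_locFn_sq h]
    simp
  rw [fderiv_fun_sum (A := fun a (x : Config N) => locFn χ χ' a x ^ 2) fun a _ =>
    (((contDiff_locFn h a).differentiable (by simp)).differentiableAt).pow 2] at h1
  rw [sum_apply] at h1
  have h2 : ∀ a, fderiv ℝ (fun x : Config N => locFn χ χ' a x ^ 2) x (unitDir j m)
      = 2 * (locFn χ χ' a x * fderiv ℝ (locFn χ χ' a) x (unitDir j m)) := fun a => by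
    rw [fderiv_fun_pow 2 ((contDiff_locFn h a).differentiable (by simp)).differentiableAt]
    simp
    ring
  simp only [h2, ← Finset.mul_sum] at h1
  linarith

lemma locFn_comp_perm (a : Finset (Fin N)) {π : Equiv.Perm (Fin N)} (hπ : ∀ j, π j ∈ a ↔ j ∈ a)
    (x : Config N) : locFn χ χ' a (x ∘ π) = locFn χ χ' a x := by
  rw [locFn, locFn, ← Equiv.prod_comp π fun j => (if j ∈ a then χ else χ') (x j)]
  exact Finset.prod_congr rfl fun j _ => by simp [hπ]

lemma locFn_ne_zero {a : Finset (Fin N)} {x : Config N} (h : locFn χ χ' a x ≠ 0) (j : Fin N) :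
    (if j ∈ a then χ else χ') (x j) ≠ 0 := fun h0 =>
  h (Finset.prod_eq_zero (Finset.mem_univ j) h0)

/-- The localised wave function. -/
noncomputable def localize (χ χ' : Space → ℝ) (a : Finset (Fin N)) (Φ : WaveFn q N) :
    WaveFn q N := fun s x => locFn χ χ' a x * Φ s x

/-- Its magnetic derivative according to the Leibniz rule. -/
noncomputable def localizeDeriv (A : Space →ₗ[ℝ] Space) (χ χ' : Space → ℝ) (a : Finset (Fin N))
    (Φ : WaveFn q N) (s : Fin N → Fin q) (j : Fin N) (m : Fin 3) (x : Config N) : ℂ :=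
  locFn χ χ' a x * magDeriv A j m (Φ s) x
    - Complex.I * (fderiv ℝ (locFn χ χ' a) x (unitDir j m) * Φ s x)

lemma norm_localize_sq (a : Finset (Fin N)) (Φ : WaveFn q N) (s : Fin N → Fin q) (x : Config N) :
    ‖localize χ χ' a Φ s x‖ ^ 2 = locFn χ χ' a x ^ 2 * ‖Φ s x‖ ^ 2 := by
  rw [localize, norm_mul, mul_pow, Complex.norm_real, Real.norm_eq_abs, sq_abs]

variable {Φ : WaveFn q N}

lemma InFormDomain.memLp_localize (hΦ : InFormDomain A Φ) (h : CutoffPair δ χ χ')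
    (a : Finset (Fin N)) (s : Fin N → Fin q) : MemLp (localize χ χ' a Φ s) 2 volume :=
  memLp_bdd_mul (hΦ.fermionic.memLp s) (contDiff_locFn h a).continuous (abs_locFn_le h a)

lemma InFormDomain.memLp_localizeDeriv (hΦ : InFormDomain A Φ) (h : CutoffPair δ χ χ')
    (a : Finset (Fin N)) (s : Fin N → Fin q) (j : Fin N) (m : Fin 3) :
    MemLp (localizeDeriv A χ χ' a Φ s j m) 2 volume :=
  memLp_smooth_mul_deriv (hΦ.fermionic.memLp s) (hΦ.memLp_magDeriv s j m) (contDiff_locFn h a)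
    (abs_locFn_le h a) fun x => abs_fderiv_locFn_le h a x j m

lemma InFormDomain.hasMagDeriv_localize (hΦ : InFormDomain A Φ) (h : CutoffPair δ χ χ')
    (a : Finset (Fin N)) (s : Fin N → Fin q) (j : Fin N) (m : Fin 3) :
    HasMagDeriv A j m (localize χ χ' a Φ s) (localizeDeriv A χ χ' a Φ s j m) :=
  (hΦ.hasMagDeriv s j m).smooth_mul (hΦ.fermionic.memLp s) (hΦ.memLp_magDeriv s j m)
    (contDiff_locFn h a)

lemma IsFermionic.localize (hΦ : IsFermionic Φ) {a : Finset (Fin N)} {π : Equiv.Perm (Fin N)}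
    (hπ : ∀ j, π j ∈ a ↔ j ∈ a) (s : Fin N → Fin q) : ∀ᵐ x : Config N,
      Polaron.localize χ χ' a Φ (s ∘ π) (x ∘ π)
        = ((Equiv.Perm.sign π : ℤ) : ℂ) * Polaron.localize χ χ' a Φ s x := by
  filter_upwards [hΦ.antisymm π s] with x hx
  simp only [Polaron.localize]
  rw [locFn_comp_perm a hπ, hx]
  ring

/-- The cross terms of the Leibniz rule cancel in the sum over the partition of unity. -/
lemma sum_norm_localizeDeriv_sq_le (h : CutoffPair δ χ χ') (s : Fin N → Fin q) (j : Fin N)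
    (m : Fin 3) (x : Config N) :
    ∑ a, ‖localizeDeriv A χ χ' a Φ s j m x‖ ^ 2
      ≤ ‖magDeriv A j m (Φ s) x‖ ^ 2 + 2 ^ N * δ ^ 2 * ‖Φ s x‖ ^ 2 := by
  set F := magDeriv A j m (Φ s) x
  set u := Φ s x
  have e : ∀ a, ‖localizeDeriv A χ χ' a Φ s j m x‖ ^ 2
      = locFn χ χ' a x ^ 2 * ‖F‖ ^ 2
        + 2 * (F.re * u.im - F.im * u.re)
          * (locFn χ χ' a x * fderiv ℝ (locFn χ χ' a) x (unitDir j m))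
        + fderiv ℝ (locFn χ χ' a) x (unitDir j m) ^ 2 * ‖u‖ ^ 2 := fun a => by
    simp only [localizeDeriv, Complex.sq_norm, Complex.normSq_apply]
    simp [F, u]
    ring
  simp only [e, Finset.sum_add_distrib]
  rw [← Finset.sum_mul, ← Finset.mul_sum, ← Finset.sum_mul, sum_locFn_sq h,
    sum_locFn_mul_fderiv h, one_mul, mul_zero, add_zero]
  have h2 : ∑ a : Finset (Fin N), fderiv ℝ (locFn χ χ' a) x (unitDir j m) ^ 2 ≤ 2 ^ N * δ ^ 2 := by
    calc _ ≤ ∑ _a : Finset (Fin N), δ ^ 2 := Finset.sum_le_sum fun a _ => by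
          rw [← sq_abs]
          exact pow_le_pow_left₀ (abs_nonneg _) (abs_fderiv_locFn_le h a x j m) 2
      _ = _ := by simp
  have := mul_le_mul_of_nonneg_right h2 (sq_nonneg ‖u‖)
  linarith

lemma integral_sum_locFn_mul (h : CutoffPair δ χ χ') {f : Config N → ℝ} (hf : Integrable f) :
    ∑ a, ∫ x, locFn χ χ' a x ^ 2 * f x = ∫ x, f x := by
  rw [← integral_finsetSum]
  · refine integral_congr_ae (ae_of_all _ fun x => ?_)
    simp only []
    rw [← Finset.sum_mul, sum_locFn_sq h, one_mul]
  · intro a _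
    refine integrable_bdd_mul (G := fun x => locFn χ χ' a x ^ 2) (C := 1) hf
      ((contDiff_locFn h a).continuous.pow 2) fun x => ?_
    rw [abs_pow]
    exact pow_le_one₀ (abs_nonneg _) (abs_locFn_le h a x)

lemma InFormDomain.sum_normSq_localize (hΦ : InFormDomain A Φ) (h : CutoffPair δ χ χ') :
    ∑ a, normSq (Polaron.localize χ χ' a Φ) = normSq Φ := by
  simp only [normSq, norm_localize_sq]
  rw [Finset.sum_comm]
  exact Finset.sum_congr rfl fun s _ =>
    integral_sum_locFn_mul h (MemLp.integrable_norm_sq (hΦ.fermionic.memLp s))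

lemma InFormDomain.sum_kinetic_localize_le (hΦ : InFormDomain A Φ) (h : CutoffPair δ χ χ') :
    ∑ a, kinetic A (Polaron.localize χ χ' a Φ)
      ≤ kinetic A Φ + 3 * N * 2 ^ N * δ ^ 2 * normSq Φ := by
  have e : ∀ a, kinetic A (Polaron.localize χ χ' a Φ)
      = ∑ s, ∑ j, ∑ m, ∫ x, ‖localizeDeriv A χ χ' a Φ s j m x‖ ^ 2 := fun a =>
    kinetic_eq (hΦ.memLp_localizeDeriv h a) (hΦ.hasMagDeriv_localize h a)
  have b : ∀ s j m, ∑ a, ∫ x, ‖localizeDeriv A χ χ' a Φ s j m x‖ ^ 2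
      ≤ (∫ x, ‖magDeriv A j m (Φ s) x‖ ^ 2) + 2 ^ N * δ ^ 2 * ∫ x, ‖Φ s x‖ ^ 2 := fun s j m => by
    have i0 := fun a => MemLp.integrable_norm_sq (hΦ.memLp_localizeDeriv h a s j m)
    have i1 := MemLp.integrable_norm_sq (hΦ.memLp_magDeriv s j m)
    have i2 := (MemLp.integrable_norm_sq (hΦ.fermionic.memLp s)).const_mul (2 ^ N * δ ^ 2)
    rw [← integral_finsetSum _ fun a _ => i0 a, ← integral_const_mul, ← integral_add i1 i2]
    exact integral_mono (integrable_finsetSum _ fun a _ => i0 a) (i1.add i2)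
      fun x => sum_norm_localizeDeriv_sq_le h s j m x
  simp only [e]
  rw [Finset.sum_comm, kinetic, normSq, Finset.mul_sum, ← Finset.sum_add_distrib]
  refine Finset.sum_le_sum fun s _ => ?_
  rw [Finset.sum_comm]
  have c : (3 * N * 2 ^ N * δ ^ 2 * ∫ x, ‖Φ s x‖ ^ 2)
      = ∑ _j : Fin N, ∑ _m : Fin 3, 2 ^ N * δ ^ 2 * ∫ x, ‖Φ s x‖ ^ 2 := by
    simp; ring
  rw [c, ← Finset.sum_add_distrib]
  refine Finset.sum_le_sum fun j _ => ?_
  rw [Finset.sum_comm, ← Finset.sum_add_distrib]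
  exact Finset.sum_le_sum fun m _ => b s j m

/-- The IMS localisation formula. -/
lemma InFormDomain.sum_hamiltonianForm_localize_le (hΦ : InFormDomain A Φ)
    (h : CutoffPair δ χ χ') {K : ℝ} {ρ : Space → ℝ} (hρ : HardyCharge K ρ) :
    ∑ a, hamiltonianForm A ρ (Polaron.localize χ χ' a Φ)
      ≤ hamiltonianForm A ρ Φ + 3 * N * 2 ^ N * δ ^ 2 * normSq Φ := by
  have k1 := hΦ.sum_kinetic_localize_le h
  have k2 : ∑ a, (∑ s, ∑ j, ∫ x : Config N,
      coulombPotential ρ (x j) * ‖Polaron.localize χ χ' a Φ s x‖ ^ 2)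
      = ∑ s, ∑ j, ∫ x : Config N, coulombPotential ρ (x j) * ‖Φ s x‖ ^ 2 := by
    rw [Finset.sum_comm]
    refine Finset.sum_congr rfl fun s _ => ?_
    rw [Finset.sum_comm]
    refine Finset.sum_congr rfl fun j _ => ?_
    simp only [norm_localize_sq, mul_left_comm (coulombPotential ρ _)]
    exact integral_sum_locFn_mul h (integrable_potential_mul hρ (hΦ.fermionic.memLp s) j)
  have k3 : ∑ a, repulsion (Polaron.localize χ χ' a Φ) = repulsion Φ := by
    simp only [repulsion]
    rw [Finset.sum_comm]
    refine Finset.sum_congr rfl fun s _ => ?_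
    rw [Finset.sum_comm]
    refine Finset.sum_congr rfl fun i _ => ?_
    rw [Finset.sum_comm]
    refine Finset.sum_congr rfl fun j hj => ?_
    simp only [norm_localize_sq, mul_div_assoc]
    exact integral_sum_locFn_mul h (integrable_pair (hΦ.fermionic.memLp s)
      (hΦ.memLp_magDeriv s i) (hΦ.hasMagDeriv s i) (Finset.mem_Ioi.1 hj).ne)
  simp only [hamiltonianForm, Finset.sum_add_distrib, Finset.sum_sub_distrib]
  rw [k2, k3, ← Finset.mul_sum, hΦ.sum_normSq_localize h]
  linarith

lemma liftPerm_mem {k l : ℕ} (ε : Fin k ⊕ Fin l ≃ Fin N) {a : Finset (Fin N)} {c : Bool → Prop}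
    (h : ∀ b, ε b ∈ a ↔ c b.isLeft) (π : Equiv.Perm (Fin k)) (j : Fin N) :
    liftPerm ε π j ∈ a ↔ j ∈ a := by
  obtain ⟨b, rfl⟩ := ε.surjective j
  rw [liftPerm, Equiv.permCongr_apply, Equiv.symm_apply_apply, h, h]
  rcases b with b | b <;> simp

/-- Lower bound on the part of the energy in which the localisation `a` splits the particles into
two clusters. -/
lemma InFormDomain.localize_bound (hΦ : InFormDomain A Φ) (h : CutoffPair δ χ χ') {k l : ℕ}
    (ε : Fin k ⊕ Fin l ≃ Fin N) {a : Finset (Fin N)} {c : Bool → Prop}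
    (hε : ∀ b, ε b ∈ a ↔ c b.isLeft) {K K₁ K₂ b D₀ : ℝ} {ρ σ₁ σ₂ : Space → ℝ}
    (hρ : HardyCharge K ρ) (hσ₁ : HardyCharge K₁ σ₁) (hσ₂ : HardyCharge K₂ σ₂)
    (hV₁ : ∀ x, locFn χ χ' a x ≠ 0 → ∀ i, coulombPotential ρ (x (ε (Sum.inl i)))
      ≤ coulombPotential σ₁ (x (ε (Sum.inl i))) + b)
    (hV₂ : ∀ x, locFn χ χ' a x ≠ 0 → ∀ i, coulombPotential ρ (x (ε (Sum.inr i)))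
      ≤ coulombPotential σ₂ (x (ε (Sum.inr i))) + b)
    (hD₀ : coulombEnergy σ₁ + coulombEnergy σ₂ + D₀ ≤ coulombEnergy ρ) :
    (groundEnergy A q k + groundEnergy A q l + D₀ - N * b) * normSq (Polaron.localize χ χ' a Φ)
      ≤ hamiltonianForm A ρ (Polaron.localize χ χ' a Φ) := by
  have hne : ∀ s x, Polaron.localize χ χ' a Φ s x ≠ 0 → locFn χ χ' a x ≠ 0 := fun s x hx h0 =>
    hx (by simp [Polaron.localize, h0])
  have hε' : ∀ b : Fin l ⊕ Fin k, ((Equiv.sumComm _ _).trans ε) b ∈ a ↔ c (!b.isLeft) := fun b => by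
    rw [Equiv.trans_apply, hε]
    rcases b with b | b <;> simp
  refine two_cluster_bound ε (hΦ.memLp_localize h a)
    (fun s j m => ⟨_, hΦ.memLp_localizeDeriv h a s j m, hΦ.hasMagDeriv_localize h a s j m⟩)
    (fun π s => ?_) (fun π s => ?_) hρ hσ₁ hσ₂ (fun s x hx => hV₁ x (hne s x hx))
    (fun s x hx => hV₂ x (hne s x hx)) hD₀
  · rw [← sign_liftPerm ε π]
    exact hΦ.fermionic.localize (liftPerm_mem ε hε π) s
  · rw [← sign_liftPerm ((Equiv.sumComm _ _).trans ε) π]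
    exact hΦ.fermionic.localize
      (liftPerm_mem (c := fun b => c (!b)) ((Equiv.sumComm _ _).trans ε) hε' π) s

/-- If the localised pieces have energy at least `e`, with an additional gap `d` whenever some
particle is outside, then the Hamiltonian is bounded below by `e + d (1 - J)` up to the
localisation error. -/
lemma InFormDomain.multForm_le (hΦ : InFormDomain A Φ) (h : CutoffPair δ χ χ') {K : ℝ}
    {ρ : Space → ℝ} (hρ : HardyCharge K ρ) {e d w : ℝ}
    (huniv : e * normSq (Polaron.localize χ χ' Finset.univ Φ)
      ≤ hamiltonianForm A ρ (Polaron.localize χ χ' Finset.univ Φ))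
    (hgap : ∀ a ≠ Finset.univ, (e + d) * normSq (Polaron.localize χ χ' a Φ)
      ≤ hamiltonianForm A ρ (Polaron.localize χ χ' a Φ))
    {J : Config N → ℝ} (hJ : ∀ x, J x = locFn χ χ' Finset.univ x ^ 2)
    (hw : w ≤ e - 3 * N * 2 ^ N * δ ^ 2) :
    multForm (fun x => w + d * (1 - J x)) Φ ≤ hamiltonianForm A ρ Φ := by
  have k1 := hΦ.sum_hamiltonianForm_localize_le h hρ
  have k2 : ∑ a, (e + d) * normSq (Polaron.localize χ χ' a Φ)
      - d * normSq (Polaron.localize χ χ' Finset.univ Φ)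
      ≤ ∑ a, hamiltonianForm A ρ (Polaron.localize χ χ' a Φ) := by
    rw [← Finset.add_sum_erase _ _ (Finset.mem_univ Finset.univ),
      ← Finset.add_sum_erase Finset.univ (fun a => hamiltonianForm A ρ (Polaron.localize χ χ' a Φ))
        (Finset.mem_univ Finset.univ)]
    have := Finset.sum_le_sum fun a (ha : a ∈ Finset.univ.erase (Finset.univ : Finset (Fin N))) =>
      hgap a (Finset.ne_of_mem_erase ha)
    linarith
  rw [← Finset.mul_sum, hΦ.sum_normSq_localize h] at k2
  have k3 : multForm (fun x => w + d * (1 - J x)) Φ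
      = (w + d) * normSq Φ - d * normSq (Polaron.localize χ χ' Finset.univ Φ) := by
    simp only [multForm, normSq, norm_localize_sq]
    rw [Finset.mul_sum, Finset.mul_sum, ← Finset.sum_sub_distrib]
    refine Finset.sum_congr rfl fun s _ => ?_
    have i1 := MemLp.integrable_norm_sq (hΦ.fermionic.memLp s)
    have i2 : Integrable fun x => locFn χ χ' Finset.univ x ^ 2 * ‖Φ s x‖ ^ 2 := by
      have := MemLp.integrable_norm_sq (hΦ.memLp_localize h Finset.univ s)
      simpa only [norm_localize_sq] using this
    rw [← integral_const_mul, ← integral_const_mul, ← integral_sub (i1.const_mul _)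
      (i2.const_mul _)]
    refine integral_congr_ae (ae_of_all _ fun x => ?_)
    simp only [hJ]
    ring
  have := mul_le_mul_of_nonneg_right hw (normSq_nonneg Φ)
  rw [k3]
  linarith

end Localization

/-! ### Smooth cutoffs -/

section Cutoff

/-- A smooth angle equal to `0` on the unit ball and to `π / 2` outside the ball of radius `2`. -/
noncomputable def cutoffAngle (x : Space) : ℝ :=
  Real.pi / 2 * Real.smoothTransition ((‖x‖ ^ 2 - 1) / 3)

lemma contDiff_cutoffAngle : ContDiff ℝ ∞ cutoffAngle := by
  unfold cutoffAngle
  have h : ContDiff ℝ ∞ fun x : Space => (‖x‖ ^ 2 - 1) / 3 :=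
    ((contDiff_norm_sq ℝ).sub contDiff_const).div_const 3
  exact contDiff_const.mul (Real.smoothTransition.contDiff.comp h)

lemma cutoffAngle_of_le {x : Space} (hx : ‖x‖ ≤ 1) : cutoffAngle x = 0 := by
  rw [cutoffAngle, Real.smoothTransition.zero_of_nonpos, mul_zero]
  nlinarith [norm_nonneg x]

lemma cutoffAngle_of_ge {x : Space} (hx : 2 ≤ ‖x‖) : cutoffAngle x = Real.pi / 2 := by
  rw [cutoffAngle, Real.smoothTransition.one_of_one_le, mul_one]
  nlinarith [norm_nonneg x]

lemma exists_norm_fderiv_cutoffAngle_le : ∃ C, ∀ x, ‖fderiv ℝ cutoffAngle x‖ ≤ C := by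
  have hc : HasCompactSupport (fun x => cutoffAngle x - Real.pi / 2) := by
    refine HasCompactSupport.intro (isCompact_closedBall (0 : Space) 2) fun x hx => ?_
    rw [mem_closedBall_zero_iff, not_le] at hx
    rw [cutoffAngle_of_ge hx.le, sub_self]
  have h1 := hc.fderiv (𝕜 := ℝ)
  have h2 : fderiv ℝ (fun x => cutoffAngle x - Real.pi / 2) = fderiv ℝ cutoffAngle := by
    ext1 x; rw [fderiv_sub_const]
  rw [h2] at h1
  obtain ⟨C, hC⟩ := h1.exists_bound_of_continuous
    (contDiff_cutoffAngle.continuous_fderiv (by simp))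
  exact ⟨C, hC⟩

/-- Smooth localisation functions with arbitrarily small gradient and arbitrarily large scale. -/
lemma exists_cutoffPair {δ : ℝ} (hδ : 0 < δ) (L₀ : ℝ) : ∃ L, L₀ ≤ L ∧ 0 < L ∧
    ∃ χ χ' : Space → ℝ, CutoffPair δ χ χ' ∧ (∀ x, χ x ≠ 0 → ‖x‖ ≤ 2 * L) ∧
      ∀ x, χ' x ≠ 0 → L ≤ ‖x‖ := by
  obtain ⟨C, hC⟩ := exists_norm_fderiv_cutoffAngle_le
  have hC0 : 0 ≤ C := (norm_nonneg _).trans (hC 0)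
  set L := max (max L₀ 1) (C / δ) with hL
  have hL1 : 1 ≤ L := (le_max_right _ _).trans (le_max_left _ _)
  have hLpos : 0 < L := by linarith
  have hLC : C / L ≤ δ := by
    rw [div_le_iff₀ hLpos, mul_comm, ← div_le_iff₀ hδ]
    exact le_max_right _ _
  set f : Space → ℝ := fun x => cutoffAngle (L⁻¹ • x) with hf
  have hfs : ContDiff ℝ ∞ f := contDiff_cutoffAngle.comp (contDiff_const_smul L⁻¹)
  have hfd : ∀ x m, |fderiv ℝ f x (EuclideanSpace.single m (1 : ℝ))| ≤ δ := fun x m => by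
    have h1 : HasFDerivAt f ((fderiv ℝ cutoffAngle (L⁻¹ • x)).comp
        (L⁻¹ • ContinuousLinearMap.id ℝ Space)) x :=
      (contDiff_cutoffAngle.differentiable (by simp)).differentiableAt.hasFDerivAt.comp x
        ((hasFDerivAt_id x).const_smul L⁻¹)
    rw [h1.fderiv, ContinuousLinearMap.comp_apply]
    have h2 : (L⁻¹ • ContinuousLinearMap.id ℝ Space) (EuclideanSpace.single m (1 : ℝ))
        = L⁻¹ • EuclideanSpace.single m (1 : ℝ) := rfl
    rw [h2, map_smul, smul_eq_mul, abs_mul, abs_of_pos (inv_pos.2 hLpos)]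
    have h3 := (fderiv ℝ cutoffAngle (L⁻¹ • x)).le_opNorm (EuclideanSpace.single m (1 : ℝ))
    rw [show ‖EuclideanSpace.single m (1 : ℝ)‖ = 1 by simp, mul_one, Real.norm_eq_abs] at h3
    calc L⁻¹ * |(fderiv ℝ cutoffAngle (L⁻¹ • x)) (EuclideanSpace.single m (1 : ℝ))|
        ≤ L⁻¹ * C := by gcongr; exact h3.trans (hC _)
      _ = C / L := by ring
      _ ≤ δ := hLC
  have hfda : ∀ x, DifferentiableAt ℝ f x := fun x => (hfs.differentiable (by simp)).differentiableAt
  have hnorm : ∀ x : Space, ‖L⁻¹ • x‖ = ‖x‖ / L := fun x => by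
    rw [norm_smul, Real.norm_of_nonneg (inv_pos.2 hLpos).le]; ring
  refine ⟨L, (le_max_left _ _).trans (le_max_left _ _), hLpos, fun x => Real.cos (f x),
    fun x => Real.sin (f x), ⟨hfs.cos, hfs.sin, fun x => Real.cos_sq_add_sin_sq _, fun x m => ?_,
      fun x m => ?_⟩, fun x hx => ?_, fun x hx => ?_⟩
  · rw [((hfda x).hasFDerivAt.cos).fderiv]
    simp only [_root_.smul_apply, smul_eq_mul, abs_mul, abs_neg]
    calc _ ≤ 1 * δ := mul_le_mul (Real.abs_sin_le_one _) (hfd x m) (abs_nonneg _) zero_le_one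
      _ = δ := one_mul δ
  · rw [((hfda x).hasFDerivAt.sin).fderiv]
    simp only [_root_.smul_apply, smul_eq_mul, abs_mul]
    calc _ ≤ 1 * δ := mul_le_mul (Real.abs_cos_le_one _) (hfd x m) (abs_nonneg _) zero_le_one
      _ = δ := one_mul δ
  · by_contra! h
    refine hx ?_
    simp only [hf]
    rw [cutoffAngle_of_ge, Real.cos_pi_div_two]
    rw [hnorm, le_div_iff₀ hLpos]; exact h.le
  · by_contra! h
    refine hx ?_
    simp only [hf]
    rw [cutoffAngle_of_le, Real.sin_zero]
    rw [hnorm, div_le_one hLpos]; exact h.le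

lemma CutoffPair.translate {δ : ℝ} {χ χ' : Space → ℝ} (h : CutoffPair δ χ χ') (y : Space) :
    CutoffPair δ (fun x => χ (x - y)) (fun x => χ' (x - y)) where
  smooth := h.smooth.comp (contDiff_id.sub contDiff_const)
  smooth' := h.smooth'.comp (contDiff_id.sub contDiff_const)
  sq_add_sq x := h.sq_add_sq _
  deriv_le x m := by rw [fderiv_comp_sub]; exact h.deriv_le _ _
  deriv_le' x m := by rw [fderiv_comp_sub]; exact h.deriv_le' _ _

lemma isSymmCutoff_locFn {N : ℕ} {δ L : ℝ} {χ χ' : Space → ℝ} (h : CutoffPair δ χ χ')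
    (hL : 0 < L) (hχ : ∀ x, χ x ≠ 0 → ‖x‖ ≤ 2 * L) :
    IsSymmCutoff fun x : Config N => locFn χ χ' Finset.univ x ^ 2 where
  smooth := (contDiff_locFn h _).pow 2
  compact := by
    refine HasCompactSupport.intro (isCompact_closedBall (0 : Config N) (2 * L)) fun x hx => ?_
    by_contra h0
    refine hx ?_
    rw [mem_closedBall_zero_iff, pi_norm_le_iff_of_nonneg (by positivity)]
    intro j
    have := locFn_ne_zero (fun h1 => h0 (by rw [h1]; simp)) j
    simp only [Finset.mem_univ, if_true] at this
    exact hχ _ this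
  mem_Icc x := ⟨sq_nonneg _, by
    have h1 := abs_locFn_le h Finset.univ x
    rwa [sq_le_one_iff_abs_le_one]⟩
  symm π x := by rw [locFn_comp_perm Finset.univ (by simp)]

end Cutoff

/-! ### Lower bound from a splitting of the charge -/

section LowerBound

variable {q N : ℕ} {A : Space →ₗ[ℝ] Space}

/-- The localisation argument for a charge distribution `ρ` with inner part `ρ₁` and outer part
`ρ₂`. The gap in the region where all particles are outside comes from the self-energy of `ρ₁`, or,
if the whole potential is small there, from splitting off one particle. -/
lemma InFormDomain.multForm_le_of_split {Φ : WaveFn q N} (hΦ : InFormDomain A Φ) {δ : ℝ}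
    {χ χ' : Space → ℝ} (h : CutoffPair δ χ χ') {K K₁ K₂ b d w : ℝ} {ρ ρ₁ ρ₂ : Space → ℝ}
    (hρ : HardyCharge K ρ) (hρ₁ : HardyCharge K₁ ρ₁) (hρ₂ : HardyCharge K₂ ρ₂)
    (hadd : coulombEnergy ρ₁ + coulombEnergy ρ₂ ≤ coulombEnergy ρ)
    (hin : ∀ v, χ v ≠ 0 → coulombPotential ρ v ≤ coulombPotential ρ₁ v + b)
    (hout : ∀ v, χ' v ≠ 0 → coulombPotential ρ v ≤ coulombPotential ρ₂ v + b)
    (hgap : ∀ k ∈ Set.Ico 1 N,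
      groundEnergy A q N + d ≤ groundEnergy A q k + groundEnergy A q (N - k))
    (hempty : d ≤ coulombEnergy ρ₁ ∨ (2 ≤ N ∧ ∀ v, χ' v ≠ 0 → coulombPotential ρ v ≤ b))
    (hw : w ≤ groundEnergy A q N - N * b - 3 * N * 2 ^ N * δ ^ 2)
    {J : Config N → ℝ} (hJ : ∀ x, J x = locFn χ χ' Finset.univ x ^ 2) :
    multForm (fun x => w + d * (1 - J x)) Φ ≤ hamiltonianForm A ρ Φ := by
  -- `E_0 = 0`, so that a single cluster is the case of a second cluster without particles
  have hz : coulombEnergy (fun _ => 0) = 0 := by simp [coulombEnergy]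
  have hzV : ∀ v, coulombPotential (fun _ => 0) v = 0 := fun v => by simp [coulombPotential]
  have n1 := hρ₁.coulombEnergy_nonneg
  have n2 := hρ₂.coulombEnergy_nonneg
  refine hΦ.multForm_le h hρ (e := groundEnergy A q N - N * b) ?_ (fun a ha => ?_) hJ hw
  -- all particles inside: dropping `D(ρ₂) ≥ 0` leaves the `N`-particle energy
  · have := hΦ.localize_bound h (finSumFinEquiv : Fin N ⊕ Fin 0 ≃ Fin N) (a := Finset.univ)
      (c := fun _ => True) (fun b => by simp) (b := b) (D₀ := 0) hρ hρ₁ HardyCharge.zero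
      (fun x hx i => hin _ (by simpa using locFn_ne_zero hx _))
      (fun x hx i => i.elim0) (by rw [hz]; linarith)
    rw [groundEnergy_zero] at this
    simpa using this
  · have hcard : a.card + aᶜ.card = N := by
      rw [Finset.card_add_card_compl, Fintype.card_fin]
    have hlt : a.card < N := by
      simpa using (Finset.card_lt_iff_ne_univ a).2 ha
    rcases Finset.eq_empty_or_nonempty a with rfl | hne
    · have hout' : ∀ x : Config N, locFn χ χ' ∅ x ≠ 0 → ∀ j, χ' (x j) ≠ 0 := fun x hx j => by
        simpa using locFn_ne_zero hx j
      rcases hempty with h1 | ⟨h2, h3⟩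
      -- all particles outside: they do not see `ρ₁`, whose self-energy is left over
      · have := hΦ.localize_bound h
          ((finCongr (Nat.zero_add N)).symm.trans
            (finSumFinEquiv (m := 0) (n := N)).symm).symm (a := ∅)
          (c := fun _ => False) (fun b => by simp) (b := b) (D₀ := coulombEnergy ρ₁) hρ
          HardyCharge.zero hρ₂ (fun x hx i => i.elim0) (fun x hx i => hout _ (hout' x hx _))
          (by rw [hz]; linarith)
        rw [groundEnergy_zero] at this
        refine le_trans (mul_le_mul_of_nonneg_right ?_ (normSq_nonneg _)) this
        linarith
      -- all particles outside, where there is no attraction: one particle is split off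
      · have hN : 1 + (N - 1) = N := by omega
        have := hΦ.localize_bound h
          ((finCongr hN).symm.trans (finSumFinEquiv (m := 1) (n := N - 1)).symm).symm (a := ∅)
          (c := fun _ => False) (fun b => by simp) (b := b) (D₀ := 0) hρ
          HardyCharge.zero HardyCharge.zero
          (fun x hx i => by rw [hzV, zero_add]; exact h3 _ (hout' x hx _))
          (fun x hx i => by rw [hzV, zero_add]; exact h3 _ (hout' x hx _))
          (by rw [hz]; linarith)
        refine le_trans (mul_le_mul_of_nonneg_right ?_ (normSq_nonneg _)) this
        have := hgap 1 ⟨le_rfl, by omega⟩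
        linarith
    -- particles on both sides
    · have hc : aᶜ.card = N - a.card := by omega
      have := hΦ.localize_bound h (finSumEquivOfFinset rfl hc) (a := a)
        (c := fun b => b = true)
        (fun b => by
          rcases b with b | b
          · simp only [finSumEquivOfFinset_inl, Sum.isLeft_inl, iff_true]
            exact Finset.orderEmbOfFin_mem _ _ _
          · simp only [finSumEquivOfFinset_inr, Sum.isLeft_inr, Bool.false_eq_true, iff_false]
            exact Finset.mem_compl.1 (Finset.orderEmbOfFin_mem _ _ _))
        (b := b) (D₀ := 0) hρ hρ₁ hρ₂
        (fun x hx i => hin _ (by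
          have h1 := locFn_ne_zero hx (finSumEquivOfFinset rfl hc (Sum.inl i))
          rwa [if_pos (by
            rw [finSumEquivOfFinset_inl]; exact Finset.orderEmbOfFin_mem _ _ _)] at h1))
        (fun x hx i => hout _ (by
          have h1 := locFn_ne_zero hx (finSumEquivOfFinset rfl hc (Sum.inr i))
          rwa [if_neg (by
            rw [finSumEquivOfFinset_inr]
            exact Finset.mem_compl.1 (Finset.orderEmbOfFin_mem _ _ _))] at h1))
        (by linarith)
      refine le_trans (mul_le_mul_of_nonneg_right ?_ (normSq_nonneg _)) this
      have := hgap a.card ⟨hne.card_pos, hlt⟩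
      linarith

end LowerBound

/-! ### Concentrated parts of a sequence of densities -/

section Dichotomy

variable {M lam : ℝ} {ρ : ℕ → Space → ℝ} {K : ℕ → ℝ} {R : ℝ → ℝ} {y : ℝ → ℕ → Space}
  {P : ℝ → ℕ → ℝ}

/-- The mass of the inner part, of the shell and of the outer part of the densities. -/
lemma DichotomyOrCompactness.eventually_masses (h : DichotomyOrCompactness M ρ lam R y P)
    (hρ : ∀ k, HardyCharge (K k) (ρ k)) {ε : ℝ} (hε : 0 < ε) (B : ℝ) :
    ∀ᶠ k in atTop, R ε < P ε k ∧ B < P ε k ∧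
      lam - ε ≤ ∫ x, (Metric.ball (y ε k) (R ε)).indicator (ρ k) x ∧
      ∫ x, (Metric.ball (y ε k) (P ε k) \ Metric.ball (y ε k) (R ε)).indicator (ρ k) x ≤ ε ∧
      ∫ x, ((Metric.ball (y ε k) (P ε k))ᶜ).indicator (ρ k) x ≤ M - lam + ε := by
  have habs : ∀ k (S : Set Space) x, |S.indicator (ρ k) x| = S.indicator (ρ k) x := fun k S x =>
    abs_of_nonneg (Set.indicator_nonneg (fun z _ => (hρ k).nonneg z) x)
  filter_upwards [(h.outer_tendsto ε hε).eventually_gt_atTop (R ε),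
    (h.outer_tendsto ε hε).eventually_gt_atTop B, h.remainder_le ε hε, h.inner_mass ε hε,
    h.outer_mass ε hε] with k h1 h2 h3 h4 h5
  simp only [habs] at h4 h5
  refine ⟨h1, h2, by linarith [(abs_le.1 h4).1], ?_, by linarith [(abs_le.1 h5).2]⟩
  refine le_trans (le_of_eq (integral_congr_ae (ae_of_all _ fun x => ?_))) h3
  rw [← habs]
  congr 1
  by_cases hP : x ∈ Metric.ball (y ε k) (P ε k)
  · by_cases hR : x ∈ Metric.ball (y ε k) (R ε)
    · simp [hP, hR]
    · simp only [Set.indicator, Set.mem_sdiff, Set.mem_compl_iff, hP, hR]; simp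
  · have hR : x ∉ Metric.ball (y ε k) (R ε) := fun hR =>
      hP (Metric.ball_subset_ball h1.le hR)
    simp [hP, hR]

lemma HardyCharge.coulombEnergy_mono {K K' : ℝ} {σ τ : Space → ℝ} (hσ : HardyCharge K σ)
    (hτ : HardyCharge K' τ) (h : ∀ x, σ x ≤ τ x) : coulombEnergy σ ≤ coulombEnergy τ := by
  have := hτ.coulombEnergy_add_le hσ HardyCharge.zero (by simpa using h)
  linarith [HardyCharge.zero.coulombEnergy_nonneg]

/-- The mass of `U` is at most that of `V ⊇ U ∩ T` plus that of `S ⊇ U \ T`. -/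
lemma HardyCharge.integral_indicator_add_le {K : ℝ} {σ : Space → ℝ} (hσ : HardyCharge K σ)
    {S T U V : Set Space} (hS : MeasurableSet S) (hU : MeasurableSet U) (hV : U ∩ T ⊆ V)
    (hVm : MeasurableSet V) (hUTS : U ⊆ T ∪ S) :
    ∫ x, U.indicator σ x ≤ (∫ x, V.indicator σ x) + ∫ x, S.indicator σ x := by
  rw [← integral_add (hσ.integrable.indicator hVm) (hσ.integrable.indicator hS)]
  refine integral_mono (hσ.integrable.indicator hU)
    ((hσ.integrable.indicator hVm).add (hσ.integrable.indicator hS)) fun x => ?_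
  have n1 : 0 ≤ V.indicator σ x := Set.indicator_nonneg (fun z _ => hσ.nonneg z) x
  have n2 : 0 ≤ S.indicator σ x := Set.indicator_nonneg (fun z _ => hσ.nonneg z) x
  by_cases hx : x ∈ U
  · rcases hUTS hx with h1 | h1
    · have h2 : V.indicator σ x = σ x := Set.indicator_of_mem (hV ⟨hx, h1⟩) σ
      rw [Set.indicator_of_mem hx]
      linarith
    · have h2 : S.indicator σ x = σ x := Set.indicator_of_mem h1 σ
      rw [Set.indicator_of_mem hx]
      linarith
  · rw [Set.indicator_of_notMem hx]
    exact add_nonneg n1 n2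

/-- If the centre for `ε` stays within distance `B` of the centre for `ε'`, the inner part for `ε`
captures most of the lump of radius `R ε'`, whose self-energy does not depend on `ε`. -/
lemma DichotomyOrCompactness.eventually_energy_ge (h : DichotomyOrCompactness M ρ lam R y P)
    (hρ : ∀ k, HardyCharge (K k) (ρ k)) {ε ε' : ℝ} (hε : 0 < ε) (hε' : 0 < ε')
    (hl : ε < lam / 8) (hl' : ε' < lam / 8) (B : ℝ) :
    ∀ᶠ k in atTop, dist (y ε' k) (y ε k) ≤ B → (lam / 2) ^ 2 / (4 * R ε')
      ≤ coulombEnergy ((Metric.ball (y ε k) (R ε)).indicator (ρ k)) := by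
  filter_upwards [h.eventually_masses hρ hε (B + R ε'), h.eventually_masses hρ hε' 0]
    with k h1 h2 hd
  obtain ⟨-, hP, -, hshell, -⟩ := h1
  obtain ⟨-, -, hm, -, -⟩ := h2
  have hlam := h.lam_mem.1
  set b' := Metric.ball (y ε' k) (R ε') with hb'
  set b := Metric.ball (y ε k) (R ε) with hb
  set s := Metric.ball (y ε k) (P ε k) \ b with hs
  -- the lump for `ε'` is not reached by the outer part for `ε`, since `P ε k` diverges
  have hsub : b' ⊆ b ∪ s := by
    intro x hx
    have hx' : x ∈ Metric.ball (y ε k) (P ε k) := by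
      rw [hb', Metric.mem_ball] at hx
      rw [Metric.mem_ball]
      have := dist_triangle x (y ε' k) (y ε k)
      linarith
    by_cases hxb : x ∈ b
    · exact Or.inl hxb
    · exact Or.inr ⟨hx', hxb⟩
  have hbm : MeasurableSet b := measurableSet_ball
  have hbm' : MeasurableSet b' := measurableSet_ball
  have hmass := (hρ k).integral_indicator_add_le (S := s) (T := b) (U := b') (V := b' ∩ b)
    (measurableSet_ball.diff hbm) hbm' subset_rfl (hbm'.inter hbm) hsub
  have hmass2 : lam / 2 ≤ ∫ x, (b' ∩ b).indicator (ρ k) x := by linarith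
  have hc := (hρ k).indicator (hbm'.inter hbm)
  have h1 := hc.le_coulombEnergy (y₀ := y ε' k) (h.radius_pos ε' hε') fun z hz => by
    by_contra h0
    exact hz (Set.indicator_of_notMem (fun h3 => h0 h3.1) _)
  have h2 := hc.coulombEnergy_mono ((hρ k).indicator hbm) fun x =>
    Set.indicator_le_indicator_of_subset Set.inter_subset_right (fun z => (hρ k).nonneg z) x
  refine le_trans ?_ (h1.trans h2)
  have := h.radius_pos ε' hε'
  gcongr

/-- Inner masses around mutually diverging centres add up, so there are at most `2 M / lam`
such centres. -/
lemma DichotomyOrCompactness.card_mul_le (h : DichotomyOrCompactness M ρ lam R y P)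
    (hρ : ∀ k, HardyCharge (K k) (ρ k)) (hM : ∀ k, ∫ x, ρ k x = M) {φ : ℕ → ℕ}
    (hφ : StrictMono φ) {m : ℕ} {e : ℕ → ℝ} (he : ∀ i < m, 0 < e i ∧ e i < lam / 8)
    (hsep : ∀ i j, i < j → j < m →
      Tendsto (fun k => dist (y (e i) (φ k)) (y (e j) (φ k))) atTop atTop) :
    m * (lam / 2) ≤ M := by
  have hlam := h.lam_mem.1
  have e1 : ∀ᶠ k in atTop, ∀ i ∈ Finset.range m, lam - e i
      ≤ ∫ x, (Metric.ball (y (e i) (φ k)) (R (e i))).indicator (ρ (φ k)) x := by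
    rw [Filter.eventually_all_finset]
    intro i hi
    have := hφ.tendsto_atTop.eventually
      (h.eventually_masses hρ (he i (Finset.mem_range.1 hi)).1 0)
    exact this.mono fun k hk => hk.2.2.1
  have e2 : ∀ᶠ k in atTop, ∀ j ∈ Finset.range m, ∀ i ∈ Finset.range j,
      R (e i) + R (e j) ≤ dist (y (e i) (φ k)) (y (e j) (φ k)) := by
    rw [Filter.eventually_all_finset]
    intro j hj
    rw [Filter.eventually_all_finset]
    intro i hi
    exact (hsep i j (Finset.mem_range.1 hi) (Finset.mem_range.1 hj)).eventually_ge_atTop _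
  obtain ⟨k, h1, h2⟩ := (e1.and e2).exists
  have hdis : Set.PairwiseDisjoint (↑(Finset.range m) : Set ℕ)
      fun i => Metric.ball (y (e i) (φ k)) (R (e i)) := by
    intro i hi j hj hij
    rw [Finset.mem_coe] at hi hj
    rcases lt_or_gt_of_ne hij with hlt | hlt
    · exact Metric.ball_disjoint_ball (h2 j hj i (Finset.mem_range.2 hlt))
    · refine Metric.ball_disjoint_ball ?_
      rw [add_comm, dist_comm]
      exact h2 i hi j (Finset.mem_range.2 hlt)
  have hint := (hρ (φ k)).integrable
  calc m * (lam / 2) = ∑ _i ∈ Finset.range m, lam / 2 := by simp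
    _ ≤ ∑ i ∈ Finset.range m, ∫ x in Metric.ball (y (e i) (φ k)) (R (e i)), ρ (φ k) x := by
        refine Finset.sum_le_sum fun i hi => ?_
        have := h1 i hi
        rw [integral_indicator measurableSet_ball] at this
        linarith [(he i (Finset.mem_range.1 hi)).2]
    _ = ∫ x in ⋃ i ∈ Finset.range m, Metric.ball (y (e i) (φ k)) (R (e i)), ρ (φ k) x :=
        (integral_biUnion_finset _ (fun i _ => measurableSet_ball) hdis
          fun i _ => hint.integrableOn).symm
    _ ≤ ∫ x, ρ (φ k) x := setIntegral_le_integral hint (ae_of_all _ (hρ (φ k)).nonneg)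
    _ = M := hM _

/-- Along a subsequence the self-energy of the inner part is bounded below uniformly in `ε`. If
not, one could successively select arbitrarily many values of `ε` whose centres diverge from
each other, contradicting the bound on the number of lumps of mass about `lam`. -/
lemma DichotomyOrCompactness.exists_energy_ge (h : DichotomyOrCompactness M ρ lam R y P)
    (hρ : ∀ k, HardyCharge (K k) (ρ k)) (hM : ∀ k, ∫ x, ρ k x = M) :
    ∃ φ : ℕ → ℕ, StrictMono φ ∧ ∃ d > 0, ∀ ε, 0 < ε → ε < lam / 8 → ∀ᶠ k in atTop,
      d ≤ coulombEnergy ((Metric.ball (y ε (φ k)) (R ε)).indicator (ρ (φ k))) := by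
  by_contra! hcon
  have hlam := h.lam_mem.1
  have step : ∀ m : ℕ, ∃ φ : ℕ → ℕ, StrictMono φ ∧ ∃ e : ℕ → ℝ,
      (∀ i < m, 0 < e i ∧ e i < lam / 8) ∧ ∀ i j, i < j → j < m →
        Tendsto (fun k => dist (y (e i) (φ k)) (y (e j) (φ k))) atTop atTop := by
    intro m
    induction m with
    | zero => exact ⟨id, strictMono_id, fun _ => 0, by simp, by simp⟩
    | succ m ih =>
      obtain ⟨φ, hφ, e, he, hsep⟩ := ih
      -- the smallest of the self-energies guaranteed near the centres selected so far
      obtain ⟨d, hd0, hd⟩ : ∃ d > 0, ∀ i < m, d ≤ (lam / 2) ^ 2 / (4 * R (e i)) := by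
        have hpos : ∀ i < m, 0 < (lam / 2) ^ 2 / (4 * R (e i)) := fun i hi => by
          have := h.radius_pos (e i) (he i hi).1
          positivity
        rcases Nat.eq_zero_or_pos m with rfl | hm
        · exact ⟨1, one_pos, by simp⟩
        · obtain ⟨i₀, hi₀, hmin⟩ := Finset.exists_min_image (Finset.range m)
            (fun i => (lam / 2) ^ 2 / (4 * R (e i))) ⟨0, Finset.mem_range.2 hm⟩
          exact ⟨_, hpos i₀ (Finset.mem_range.1 hi₀), fun i hi => hmin i (Finset.mem_range.2 hi)⟩
      obtain ⟨ε, hε, hεl, hfreq⟩ := hcon φ hφ d hd0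
      obtain ⟨ψ, hψ, hψd⟩ := extraction_of_frequently_atTop hfreq
      refine ⟨φ ∘ ψ, hφ.comp hψ, Function.update e m ε, fun i hi => ?_, fun i j hij hj => ?_⟩
      · rcases Nat.lt_succ_iff_lt_or_eq.1 hi with h1 | rfl
        · rw [Function.update_of_ne h1.ne]; exact he i h1
        · rw [Function.update_self]; exact ⟨hε, hεl⟩
      · rcases Nat.lt_succ_iff_lt_or_eq.1 hj with h1 | rfl
        · rw [Function.update_of_ne h1.ne, Function.update_of_ne (hij.trans h1).ne]
          exact (hsep i j hij h1).comp hψ.tendsto_atTop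
        · rw [Function.update_self, Function.update_of_ne hij.ne, tendsto_atTop]
          intro B
          have := (hφ.comp hψ).tendsto_atTop.eventually
            (h.eventually_energy_ge hρ hε (he i hij).1 hεl (he i hij).2 B)
          filter_upwards [this] with k hk
          by_contra! hlt
          exact absurd (hψd k) (not_lt.2 ((hd i hij).trans (hk hlt.le)))
  obtain ⟨m, hm⟩ := exists_nat_gt (M / (lam / 2))
  obtain ⟨φ, hφ, e, he, hsep⟩ := step m
  have := h.card_mul_le hρ hM hφ he hsep
  rw [div_lt_iff₀ (by positivity)] at hm
  linarith

end Dichotomy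

/-! ### The operator inequality along a subsequence -/

section Assembly

variable {q N : ℕ} {A : Space →ₗ[ℝ] Space}

lemma HardyCharge.potential_split {K : ℝ} {ρ : Space → ℝ} (h : HardyCharge K ρ) {R P : ℝ}
    (hRP : R < P) (y v : Space) :
    coulombPotential ρ v = coulombPotential ((Metric.ball y R).indicator ρ) v
      + coulombPotential ((Metric.ball y P)ᶜ.indicator ρ) v
      + coulombPotential ((Metric.ball y P \ Metric.ball y R).indicator ρ) v := by
  have h1 := (h.indicator (measurableSet_ball (x := y) (ε := R))).integrable_potential v
  have h2 := (h.indicator (measurableSet_ball (x := y) (ε := P)).compl).integrable_potential v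
  have h3 := (h.indicator ((measurableSet_ball (x := y) (ε := P)).diff
    (measurableSet_ball (x := y) (ε := R)))).integrable_potential v
  unfold coulombPotential
  rw [← integral_add h1 h2]
  refine Eq.trans ?_ (integral_add (h1.add h2) h3)
  refine integral_congr_ae (ae_of_all _ fun x => ?_)
  change ρ x / ‖v - x‖ = (Metric.ball y R).indicator ρ x / ‖v - x‖
    + (Metric.ball y P)ᶜ.indicator ρ x / ‖v - x‖
    + (Metric.ball y P \ Metric.ball y R).indicator ρ x / ‖v - x‖
  rw [← add_div, ← add_div]
  congr 1
  by_cases hP : x ∈ Metric.ball y P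
  · by_cases hR : x ∈ Metric.ball y R
    · simp [hP, hR]
    · simp only [Set.indicator, Set.mem_sdiff, Set.mem_compl_iff, hP, hR]; simp
  · have hR : x ∉ Metric.ball y R := fun hR => hP (Metric.ball_subset_ball hRP.le hR)
    simp [hP, hR]

lemma HardyCharge.integral_indicator_le {K : ℝ} {ρ : Space → ℝ} (h : HardyCharge K ρ)
    {S : Set Space} (hS : MeasurableSet S) : ∫ x, S.indicator ρ x ≤ ∫ x, ρ x := by
  rw [integral_indicator hS]
  exact setIntegral_le_integral h.integrable (ae_of_all _ h.nonneg)

/-- The operator inequality for a single charge distribution `ρ` that consists of a part in a ball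
of radius `R`, a part outside a much larger ball, and a shell of mass at most `ε`. -/
lemma hamiltonianGe_of_masses {δ L : ℝ} {χ χ' : Space → ℝ} (h : CutoffPair δ χ χ')
    (hχ : ∀ x, χ x ≠ 0 → ‖x‖ ≤ 2 * L) (hχ' : ∀ x, χ' x ≠ 0 → L ≤ ‖x‖)
    {K S ε R P d : ℝ} {ρ : Space → ℝ} {y : Space} (hρ : HardyCharge K ρ) (hKS : K ≤ S ^ 2)
    (hS : 0 < S) (hN : 1 ≤ N) (hM : ∫ x, ρ x = N) (hε : 0 < ε)
    (hδ : δ ^ 2 ≤ ε / (6 * 2 ^ N)) (hL : R + 2 * N / ε ≤ L) (hP : 2 * L + 2 * N / ε ≤ P)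
    (hRP : R < P) (hshell : ∫ x, (Metric.ball y P \ Metric.ball y R).indicator ρ x ≤ ε)
    (hgap : ∀ k ∈ Set.Ico 1 N,
      groundEnergy A q N + d ≤ groundEnergy A q k + groundEnergy A q (N - k))
    (hempty : d ≤ coulombEnergy ((Metric.ball y R).indicator ρ) ∨
      (2 ≤ N ∧ ∫ x, (Metric.ball y P)ᶜ.indicator ρ x ≤ ε)) :
    HamiltonianGe (N := N) A q ρ fun x => groundEnergy A q N
      + d * (1 - translate y (fun x => locFn χ χ' Finset.univ x ^ 2) x)
      - N * (2 * Real.sqrt ε * (2 * S) + ε * N) - 2 ^ N * (ε * N) ^ 2 := by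
  intro Φ hΦ
  have hNr : (1 : ℝ) ≤ N := by exact_mod_cast hN
  have hq0 : 0 < 2 * N / ε := by positivity
  have hsqrt := mul_nonneg (Real.sqrt_nonneg ε) hS.le
  have hηN : (N : ℝ) / (2 * N / ε) = ε / 2 := by field_simp
  have mR : MeasurableSet (Metric.ball y R) := measurableSet_ball
  have mP : MeasurableSet (Metric.ball y P) := measurableSet_ball
  have c1 := hρ.indicator mR
  have c2 := hρ.indicator mP.compl
  have c3 := hρ.indicator (mP.diff mR)
  have v3 := c3.potential_le_sqrt hε hS hshell hKS
  -- beyond distance `2 N / ε` a charge of mass at most `N` has potential at most `ε / 2`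
  have far : ∀ {T : Set Space}, MeasurableSet T → ∀ v, (∀ x ∈ T, 2 * N / ε ≤ ‖v - x‖) →
      coulombPotential (T.indicator ρ) v ≤ ε / 2 := fun {T} hT v hv => by
    refine ((hρ.indicator hT).potential_le_of_far hq0 fun x hx => hv x ?_).trans ?_
    · by_contra h0
      exact hx (Set.indicator_of_notMem h0 _)
    · rw [← hηN]
      gcongr
      exact (hρ.integral_indicator_le hT).trans hM.le
  have v1 : ∀ v, χ' (v - y) ≠ 0 →
      coulombPotential ((Metric.ball y R).indicator ρ) v ≤ ε / 2 := fun v hv =>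
    far mR v fun x hx => by
      have h1 := hχ' _ hv
      rw [Metric.mem_ball, dist_eq_norm] at hx
      have h2 := norm_sub_le_norm_sub_add_norm_sub v x y
      linarith
  have v2 : ∀ v, χ (v - y) ≠ 0 →
      coulombPotential ((Metric.ball y P)ᶜ.indicator ρ) v ≤ ε / 2 := fun v hv =>
    far mP.compl v fun x hx => by
      have h1 := hχ _ hv
      rw [Set.mem_compl_iff, Metric.mem_ball, dist_eq_norm, not_lt] at hx
      have h2 := norm_sub_le_norm_sub_add_norm_sub x v y
      rw [norm_sub_rev x v] at h2
      linarith
  -- `2 √ε S` for the shell, the same for an outer part of mass `ε`, and `ε / 2` for a distant charge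
  have key := hΦ.multForm_le_of_split (h.translate y) (b := 4 * (√ε * S) + ε / 2) (d := d)
    (w := groundEnergy A q N - N * (2 * Real.sqrt ε * (2 * S) + ε * N) - 2 ^ N * (ε * N) ^ 2)
    hρ c1 c2
    (hρ.coulombEnergy_add_le c1 c2 fun x => by
      by_cases hxR : x ∈ Metric.ball y R
      · have hxP : x ∈ Metric.ball y P := Metric.ball_subset_ball hRP.le hxR
        simp [hxR, hxP]
      · rw [Set.indicator_of_notMem hxR, zero_add]
        exact Set.indicator_le_self' (fun _ _ => hρ.nonneg x) x)
    (fun v hv => by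
      rw [hρ.potential_split hRP y v]
      linarith [v2 v hv, v3 v])
    (fun v hv => by
      rw [hρ.potential_split hRP y v]
      linarith [v1 v hv, v3 v])
    hgap
    (hempty.imp_right fun ⟨h1, h2⟩ => ⟨h1, fun v hv => by
      have := c2.potential_le_sqrt hε hS h2 hKS v
      rw [hρ.potential_split hRP y v]
      linarith [v1 v hv, v3 v]⟩)
    (by
      have h2 : (0 : ℝ) < 2 ^ N := by positivity
      have h1 : 3 * N * 2 ^ N * δ ^ 2 ≤ N * (ε / 2) := by
        calc 3 * N * 2 ^ N * δ ^ 2 ≤ 3 * N * 2 ^ N * (ε / (6 * 2 ^ N)) := by gcongr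
          _ = N * (ε / 2) := by field_simp; ring
      -- the potential of distant charges and the localisation error together cost at most `N ε`
      have h3 : N * ε ≤ N * (ε * N) := by
        have := mul_le_mul_of_nonneg_left hNr hε.le
        gcongr
        linarith
      have h4 : 0 ≤ 2 ^ N * (ε * N) ^ 2 := by positivity
      linarith)
    (J := translate y fun x => locFn χ χ' Finset.univ x ^ 2)
    (fun x => by simp [translate, locFn])
  refine le_trans (le_of_eq ?_) key
  congr 1
  funext x
  ring

lemma Binding.bindingEnergy_pos (h : Binding A q N) (hN : 2 ≤ N) : 0 < bindingEnergy A q N := by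
  have hne : ((fun k => groundEnergy A q k + groundEnergy A q (N - k)) '' Set.Ico 1 N).Nonempty :=
    ⟨_, Set.mem_image_of_mem _ (⟨le_rfl, by omega⟩ : (1 : ℕ) ∈ Set.Ico 1 N)⟩
  obtain ⟨k, hk, hk'⟩ := hne.csInf_mem ((Set.finite_Ico 1 N).image _)
  have := h k hk
  rw [bindingEnergy, ← hk']
  simp only
  linarith

lemma groundEnergy_add_bindingEnergy_le {k : ℕ} (hk : k ∈ Set.Ico 1 N) :
    groundEnergy A q N + bindingEnergy A q N ≤ groundEnergy A q k + groundEnergy A q (N - k) := by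
  have := csInf_le ((Set.finite_Ico 1 N).image
    fun k => groundEnergy A q k + groundEnergy A q (N - k)).bddBelow (Set.mem_image_of_mem _ hk)
  rw [bindingEnergy]
  linarith

/-- The subsequence and the gap. If no mass escapes and there are at least two particles, the
binding energy is a gap since the outer part is negligible. Otherwise the gap also has to stay below
the self-energy of the inner part. -/
lemma DichotomyOrCompactness.exists_gap {ρ : ℕ → Space → ℝ} {K : ℕ → ℝ} {lam : ℝ} {R : ℝ → ℝ}
    {y : ℝ → ℕ → Space} {P : ℝ → ℕ → ℝ} (h : DichotomyOrCompactness N ρ lam R y P)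
    (hρ : ∀ k, HardyCharge (K k) (ρ k)) (hM : ∀ k, ∫ x, ρ k x = N) (hbind : Binding A q N) :
    ∃ φ : ℕ → ℕ, StrictMono φ ∧ ∃ d : ℝ, 0 < d ∧
      (lam = N → 2 ≤ N → d = bindingEnergy A q N) ∧
      (∀ k ∈ Set.Ico 1 N,
        groundEnergy A q N + d ≤ groundEnergy A q k + groundEnergy A q (N - k)) ∧
      ∀ ε, 0 < ε → ε < lam / 8 → ∀ᶠ k in atTop,
        d ≤ coulombEnergy ((Metric.ball (y ε (φ k)) (R ε)).indicator (ρ (φ k))) ∨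
          (2 ≤ N ∧ ∫ x, (Metric.ball (y ε (φ k)) (P ε (φ k)))ᶜ.indicator (ρ (φ k)) x ≤ ε) := by
  by_cases hc : lam = N ∧ 2 ≤ N
  · refine ⟨id, strictMono_id, bindingEnergy A q N, hbind.bindingEnergy_pos hc.2,
      fun _ _ => rfl, fun k hk => groundEnergy_add_bindingEnergy_le hk, fun ε hε _ => ?_⟩
    filter_upwards [h.eventually_masses hρ hε 0] with k hk
    refine Or.inr ⟨hc.2, ?_⟩
    have := hk.2.2.2.2
    rw [hc.1, sub_self, zero_add] at this
    exact this
  · obtain ⟨φ, hφ, d, hd, hE⟩ := h.exists_energy_ge hρ hM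
    by_cases hN : 2 ≤ N
    · refine ⟨φ, hφ, min d (bindingEnergy A q N), lt_min hd (hbind.bindingEnergy_pos hN),
        fun h1 h2 => absurd ⟨h1, h2⟩ hc, fun k hk => ?_, fun ε hε hl => ?_⟩
      · exact le_trans (by gcongr; exact min_le_right _ _) (groundEnergy_add_bindingEnergy_le hk)
      · exact (hE ε hε hl).mono fun k hk => Or.inl ((min_le_left _ _).trans hk)
    · exact ⟨φ, hφ, d, hd, fun _ h2 => absurd h2 hN, fun k hk => absurd hk.2 (by
        have := hk.1; omega), fun ε hε hl => (hE ε hε hl).mono fun k hk => Or.inl hk⟩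

end Assembly

end Polaron

theorem proposition3p2 (q N : ℕ) (A : Polaron.Space →ₗ[ℝ] Polaron.Space)
    (hbind : Polaron.Binding A q N)
    (Ψ : ℕ → Polaron.WaveFn q N) (hΨ : Polaron.IsMinimizingSeq A Ψ)
    (lam : ℝ) (R : ℝ → ℝ) (y : ℝ → ℕ → Polaron.Space) (P : ℝ → ℕ → ℝ)
    (hρ : Polaron.DichotomyOrCompactness N (fun k => Polaron.density (Ψ k)) lam R y P) :
    BddAbove (Set.range fun k => Polaron.formNorm A (Ψ k)) ∧
    ∃ φ : ℕ → ℕ, StrictMono φ ∧ ∃ d : ℝ, 0 < d ∧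
      (lam = N → 2 ≤ N → d = Polaron.bindingEnergy A q N) ∧
      ∃ ε₀ > 0, ∀ ε : ℝ, 0 < ε → ε < ε₀ →
        ∃ J : Polaron.Config N → ℝ, Polaron.IsSymmCutoff J ∧
          ∃ k₀ : ℕ, ∀ k ≥ k₀,
            Polaron.HamiltonianGe A q (Polaron.density (Ψ (φ k))) fun x =>
              Polaron.groundEnergy A q N
                + d * (1 - Polaron.translate (y ε (φ k)) J x)
                - N * (2 * Real.sqrt ε * (2 * ⨆ l, Polaron.formNorm A (Ψ (φ l))) + ε * N)
                - 2 ^ N * (ε * N) ^ 2 := by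
  refine ⟨hΨ.bddAbove_formNorm, ?_⟩
  have hlam := hρ.lam_mem
  have hN : 1 ≤ N := by
    have : (0 : ℝ) < N := hlam.1.trans_le hlam.2
    exact_mod_cast this
  have hC := fun k => (hΨ.mem k).hardyCharge
  have hM : ∀ k, ∫ x, Polaron.density (Ψ k) x = N := fun k => by
    rw [(hΨ.mem k).fermionic.integrable_density.2, hΨ.normalized k, mul_one]
  obtain ⟨φ, hφ, d, hd, hdl, hgap, hev⟩ := hρ.exists_gap hC hM hbind
  refine ⟨φ, hφ, d, hd, hdl, lam / 8, by linarith [hlam.1], fun ε hε hεl => ?_⟩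
  set S := ⨆ l, Polaron.formNorm A (Ψ (φ l)) with hS
  have hle : ∀ l, Polaron.formNorm A (Ψ (φ l)) ≤ S := fun l =>
    le_ciSup (f := fun l => Polaron.formNorm A (Ψ (φ l)))
      (hΨ.bddAbove_formNorm.mono (by rintro _ ⟨l, rfl⟩; exact ⟨φ l, rfl⟩)) l
  have hsq : ∀ l, 1 + Polaron.kinetic A (Ψ (φ l)) = Polaron.formNorm A (Ψ (φ l)) ^ 2 := fun l => by
    rw [Polaron.formNorm, hΨ.normalized, Real.sq_sqrt]
    linarith [Polaron.kinetic_nonneg A (Ψ (φ l))]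
  have hnn : ∀ l, 0 ≤ Polaron.formNorm A (Ψ (φ l)) := fun l => Real.sqrt_nonneg _
  have hSpos : 0 < S := by
    -- the form norms are at least `1` by normalisation
    refine lt_of_lt_of_le (lt_of_le_of_ne (hnn 0) fun h0 => ?_) (hle 0)
    have := hsq 0
    rw [← h0] at this
    nlinarith [Polaron.kinetic_nonneg A (Ψ (φ 0))]
  have hK : ∀ l, Polaron.kinetic A (Ψ (φ l)) ≤ S ^ 2 := fun l => by
    have := pow_le_pow_left₀ (hnn l) (hle l) 2
    linarith [hsq l]
  have hq : 0 < ε / (6 * 2 ^ N) := by positivity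
  obtain ⟨L, hL, hLpos, χ, χ', hcut, hχ, hχ'⟩ :=
    Polaron.exists_cutoffPair (Real.sqrt_pos.2 hq) (R ε + 2 * N / ε)
  refine ⟨_, Polaron.isSymmCutoff_locFn hcut hLpos hχ, ?_⟩
  have hmass := hφ.tendsto_atTop.eventually
    (hρ.eventually_masses hC hε (2 * L + 2 * N / ε))
  obtain ⟨k₀, hk₀⟩ := eventually_atTop.1 (hmass.and (hev ε hε hεl))
  refine ⟨k₀, fun k hk => ?_⟩
  obtain ⟨⟨hRP, hB, -, hshell, -⟩, hempty⟩ := hk₀ k hk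
  exact Polaron.hamiltonianGe_of_masses hcut hχ hχ' (hC (φ k)) (hK k) hSpos hN (hM _) hε
    (Real.sq_sqrt hq.le).le hL hB.le hRP hshell hgap hempty
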